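/- Let $n\ge1$, let $\langle z,w\rangle=\sum_{j=1}^n z_j\overline{w_j}$ and $|z|^2=\langle z,z\rangle$ on $\mathbb C^n$, let $B$ be the open unit ball of $\mathbb C^n$, and let $\sigma$ be the unnormalized surface measure on $\partial B$ (of total mass $2\pi^n/\Gamma(n)$). A $C^2$ function $f:B\to\mathbb C$ is called $M$-harmonic if $$\widetilde\Delta f=4(1-|z|^2)\sum_{j,k=1}^n(\delta_{jk}-z_j\overline{z_k})\frac{\partial^2 f}{\partial z_j\,\partial\overline{z_k}}=0\quad\text{on }B .$$ The $M$-harmonic Hardy space $H^2$ consists of all $M$-harmonic $f$ on $B$ with $\sup_{0\le r<1}\int_{\partial B}|f(r\zeta)|^2\,d\sigma(\zeta)<\infty$; each such $f$ has a radial boundary value on $\partial B$, namely the limit of $f(r\,\cdot)$ in $L^2(\partial B,\sigma)$ as $r\nearrow1$, which is again denoted by $f$. The $M$-harmonic Szegő kernel $K$ is the reproducing kernel of $H^2$, i.e. the function on $B\times B$, $M$-harmonic in each variable and with $K(z,\cdot)\in H^2$ for every $z\in B$, such that $$f(z)=\int_{\partial B}f(\zeta)\,K(z,\zeta)\,d\sigma(\zeta)\qquad\text{for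 all }f\in H^2,\ z\in B,$$ where $K(z,\cdot)$ on $\partial B$ also denotes the radial boundary value. For $x_1,x_2,y_1,y_2\in\mathbb C$ of modulus less than $1$ put $$FD_1(a,a',b_1,b_2;c;x_1,x_2,y_1,y_2)=\sum_{i_1,i_2,j_1,j_2=0}^\infty\frac{(a)_{i_1+i_2}(a')_{j_1+j_2}(b_1)_{i_1+j_1}(b_2)_{i_2+j_2}}{(c)_{i_1+i_2+j_1+j_2}}\,\frac{x_1^{i_1}}{i_1!}\frac{x_2^{i_2}}{i_2!}\frac{y_1^{j_1}}{j_1!}\frac{y_2^{j_2}}{j_2!},$$ where $(a)_k=a(a+1)\cdots(a+k-1)$. Then the $M$-harmonic Szegő kernel $K$ exists, it is unique, and for all $z,w\in B$ the series below converges absolutely and $$K(z,w)=\frac{\Gamma(n)}{2\pi^n}\,(1-|z|^2)^n(1-|w|^2)^n\,FD_1\bigl(n,n,n,n;n;|z|^2,\langle z,w\rangle,\langle w,z\rangle,|w|^2\bigr).$$ -/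

import Mathlib

noncomputable section

open MeasureTheory Filter Topology

namespace MHarm

/-- The space `ℂⁿ` with its Euclidean norm. -/
abbrev Cn (n : ℕ) : Type := EuclideanSpace ℂ (Fin n)

/-- The open unit ball `Bⁿ` of `ℂⁿ`. -/
abbrev unitBall (n : ℕ) : Set (Cn n) := Metric.ball 0 1

/-- The unit sphere `∂Bⁿ` of `ℂⁿ`. -/
abbrev unitSphere (n : ℕ) : Set (Cn n) := Metric.sphere 0 1

/-- The unnormalized surface measure `σ` on `∂Bⁿ`, of total mass `2πⁿ / Γ(n)`: the measure
for which Lebesgue measure on `ℂⁿ = ℝ²ⁿ` is `r ^ (2n - 1) dr dσ` in polar coordinates. -/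
def surfaceMeasure (n : ℕ) : Measure (unitSphere n) :=
  (volume : Measure (Cn n)).toSphere

/-- The inner product `⟨z, w⟩ = ∑ⱼ zⱼ conj(wⱼ)`, linear in the first variable. -/
def herm {n : ℕ} (z w : Cn n) : ℂ := ∑ j, z j * (starRingEnd ℂ) (w j)

/-- The vector with `c` as its `j`-th coordinate and `0` elsewhere. -/
abbrev coordVec {n : ℕ} (j : Fin n) (c : ℂ) : Cn n := EuclideanSpace.single j c

/-- The Wirtinger derivative `∂f/∂zⱼ = (∂f/∂xⱼ - i ∂f/∂yⱼ) / 2`. -/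
def dz {n : ℕ} (j : Fin n) (f : Cn n → ℂ) (z : Cn n) : ℂ :=
  (fderiv ℝ f z (coordVec j 1) - Complex.I * fderiv ℝ f z (coordVec j Complex.I)) / 2

/-- The Wirtinger derivative `∂f/∂z̄ⱼ = (∂f/∂xⱼ + i ∂f/∂yⱼ) / 2`. -/
def dzbar {n : ℕ} (j : Fin n) (f : Cn n → ℂ) (z : Cn n) : ℂ :=
  (fderiv ℝ f z (coordVec j 1) + Complex.I * fderiv ℝ f z (coordVec j Complex.I)) / 2

/-- The invariant Laplacian
`4 (1 - |z|²) ∑ⱼₖ (δⱼₖ - zⱼ z̄ₖ) ∂²f / ∂zⱼ ∂z̄ₖ`. -/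
def invLaplacian {n : ℕ} (f : Cn n → ℂ) (z : Cn n) : ℂ :=
  4 * (1 - (‖z‖ : ℂ) ^ 2) *
    ∑ j : Fin n, ∑ k : Fin n,
      ((if j = k then 1 else 0) - z j * (starRingEnd ℂ) (z k)) * dz j (dzbar k f) z

/-- `f` is `M`-harmonic on the unit ball (its values outside the ball are irrelevant). -/
def IsMHarmonic {n : ℕ} (f : Cn n → ℂ) : Prop :=
  ContDiffOn ℝ 2 f (unitBall n) ∧ ∀ z ∈ unitBall n, invLaplacian f z = 0

/-- `f` belongs to the `M`-harmonic Hardy space `H²` of the unit ball: it is `M`-harmonic and its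
mean squares over the spheres of radius `r < 1` are bounded. -/
def MemHardy {n : ℕ} (f : Cn n → ℂ) : Prop :=
  IsMHarmonic f ∧
    ∃ C : ℝ, ∀ r ∈ Set.Ico (0 : ℝ) 1,
      ∫ ζ : unitSphere n, ‖f (r • (ζ : Cn n))‖ ^ 2 ∂(surfaceMeasure n) ≤ C

/-- `g` is the radial boundary value of `f`: it belongs to `L²(∂Bⁿ, σ)` and `f(r ζ)` tends to
`g(ζ)` in `L²(∂Bⁿ, σ)` as `r ↗ 1`. (Such a `g` is unique up to a `σ`-null set, and if `f(r ζ)` has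
a limit as `r ↗ 1` for almost every `ζ`, then that limit is `g(ζ)` for almost every `ζ`.) -/
def IsBoundaryValue {n : ℕ} (f : Cn n → ℂ) (g : unitSphere n → ℂ) : Prop :=
  MemLp g 2 (surfaceMeasure n) ∧
    Tendsto (fun r : ℝ =>
        eLpNorm (fun ζ : unitSphere n => f (r • (ζ : Cn n)) - g ζ) 2 (surfaceMeasure n))
      (𝓝[<] 1) (𝓝 0)

/-- `K` is an `M`-harmonic Szegő kernel of the unit ball of `ℂⁿ`, i.e. a reproducing kernel of the
`M`-harmonic Hardy space: it is `M`-harmonic in each variable, each `K(z, ·)` belongs to `H²`, and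
`f(z) = ∫ f(ζ) K(z, ζ) dσ(ζ)` for all `f ∈ H²` and `z ∈ Bⁿ`, the integrand being formed by the
boundary values of `f` and of `K(z, ·)`. -/
structure IsSzegoKernel (n : ℕ) (K : Cn n → Cn n → ℂ) : Prop where
  mharmonic_left : ∀ w ∈ unitBall n, IsMHarmonic fun z => K z w
  mharmonic_right : ∀ z ∈ unitBall n, IsMHarmonic (K z)
  memHardy : ∀ z ∈ unitBall n, MemHardy (K z)
  reproducing : ∀ f : Cn n → ℂ, MemHardy f → ∃ g : unitSphere n → ℂ, IsBoundaryValue f g ∧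
    ∀ z ∈ unitBall n, ∃ k : unitSphere n → ℂ, IsBoundaryValue (K z) k ∧
      f z = ∫ ζ, g ζ * k ζ ∂(surfaceMeasure n)

/-- The Pochhammer symbol `(a)ₖ = a (a + 1) ⋯ (a + k - 1)`. -/
def poch (a : ℂ) (k : ℕ) : ℂ := ∏ i ∈ Finset.range k, (a + i)

/-- The general term of the hypergeometric series `FD₁`, at `i = (i₁, i₂, j₁, j₂)`. -/
def FD1term (a a' b₁ b₂ c x₁ x₂ y₁ y₂ : ℂ) (i : ℕ × ℕ × ℕ × ℕ) : ℂ :=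
  match i with
  | (i₁, i₂, j₁, j₂) =>
    poch a (i₁ + i₂) * poch a' (j₁ + j₂) * poch b₁ (i₁ + j₁) * poch b₂ (i₂ + j₂) /
        poch c (i₁ + i₂ + j₁ + j₂) *
      (x₁ ^ i₁ / (i₁.factorial : ℂ)) * (x₂ ^ i₂ / (i₂.factorial : ℂ)) *
      (y₁ ^ j₁ / (j₁.factorial : ℂ)) * (y₂ ^ j₂ / (j₂.factorial : ℂ))

/-- The hypergeometric function `FD₁(a, a', b₁, b₂; c; x₁, x₂, y₁, y₂)` of four variables. -/
def FD1 (a a' b₁ b₂ c x₁ x₂ y₁ y₂ : ℂ) : ℂ :=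
  ∑' i : ℕ × ℕ × ℕ × ℕ, FD1term a a' b₁ b₂ c x₁ x₂ y₁ y₂ i

end MHarm

end

/-!
The kernel is the integral `szego z w = ∫ P(z, ζ) P(w, ζ) dσ(ζ)` of two Poisson–Szegő kernels
`P(z, ζ) = Γ(n) / (2πⁿ) · (1 - |z|²)ⁿ / |1 - ⟨z, ζ⟩|²ⁿ`, because `P` reproduces the functions of `H²`
from their boundary values.

*Representation.* `P(·, ζ)` is `M`-harmonic (`isMHarmonic_poisson`), and the Poisson–Szegő integral of
`g ∈ L²(σ)` belongs to `H²` and has boundary value `g` (`isBoundaryValue_poissonInt`). Conversely,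
every `f ∈ H²` is such an integral (`MemHardy.exists_eq_poissonInt`). The dilates `f(r ·)` have a weak
limit `g` along an ultrafilter, and the dilates of the difference `D` of `f` and the Poisson–Szegő
integral of `g` tend weakly to zero. For a continuous function `φ` on the unitary group, the average
`z ↦ ∫ φ(U) D(U⁻¹ z) dU` is again `M`-harmonic. On the sphere of radius `r` its values are integrals
of `D(r ·)` against translates of `φ`, which form a compact set, so it tends to zero uniformly on
these spheres; by the maximum principle (`IsMHarmonic.norm_le_of_sphere`) it vanishes. With `φ(U)` the
conjugate of `D(U⁻¹ z)` this yields `D(z) = 0`.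

*Existence and uniqueness.* Since `szego z` has boundary value `P(z, ·)`, the representation is the
reproducing property of `szego`. If `K` is any Szegő kernel, then pairing the boundary values of
`K(z, ·)` and of `szego w` computes both `K(z, w)` and `szego w z` (`IsSzegoKernel.eq_szego`).

*Series.* Expanding the four factors `(1 - ⟨z, ζ⟩)⁻ⁿ`, `(1 - ⟨w, ζ⟩)⁻ⁿ` and their conjugates in
binomial series and integrating reduces `szego z w` to the moments
`∫ ⟨z, ζ⟩ᵃ ⟨w, ζ⟩ᵇ ⟨ζ, z⟩ᶜ ⟨ζ, w⟩ᵈ dσ(ζ)`. These follow by polarization from the formula for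
`∫ ⟨p, ζ⟩ᴺ ⟨ζ, q⟩ᴺ dσ(ζ)` (`sphere_moment`), a Gaussian integral in polar coordinates. Each of them,
multiplied by its binomial coefficients, is a finite sum of terms of `FD₁` (`hasSum_fiber_FD1term`),
and each term of `FD₁` occurs exactly once (`szego_eq`).
-/

noncomputable section

open MeasureTheory Filter Topology

namespace MHarm

/-! ### The invariant Laplacian and the maximum principle -/

/-- The second real derivative of `f` at `z`, evaluated at `v` and `w`. -/
def secondDeriv {n : ℕ} (f : Cn n → ℂ) (z v w : Cn n) : ℂ :=
  fderiv ℝ (fderiv ℝ f) z v w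

/-- Four times the Levi form of `f` at `z`, evaluated at `v`: the Laplacian at `0` of the function
`t ↦ f (z + t v)` of one complex variable. -/
def levi {n : ℕ} (f : Cn n → ℂ) (z v : Cn n) : ℂ :=
  secondDeriv f z v v + secondDeriv f z (Complex.I • v) (Complex.I • v)

lemma isOpen_unitBall (n : ℕ) : IsOpen (unitBall n) := Metric.isOpen_ball

lemma mem_unitBall {n : ℕ} {z : Cn n} : z ∈ unitBall n ↔ ‖z‖ < 1 := by simp

lemma coordVec_eq_smul {n : ℕ} (j : Fin n) (c : ℂ) :
    coordVec j c = c.re • coordVec j (1 : ℂ) + c.im • coordVec j Complex.I := by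
  ext k
  by_cases h : k = j
  · subst h; simp
  · simp [h]

lemma eq_sum_coordVec {n : ℕ} (v : Cn n) : v = ∑ j, coordVec j (v j) := by
  ext k
  simp [Finset.sum_apply]

/-- A real bilinear form in the real coordinates of `ℂⁿ`. -/
lemma bilin_expand {n : ℕ} (B : Cn n →L[ℝ] Cn n →L[ℝ] ℂ) (v w : Cn n) :
    B v w = ∑ j, ∑ k,
      ((v j).re * (w k).re * B (coordVec j 1) (coordVec k 1)
        + (v j).re * (w k).im * B (coordVec j 1) (coordVec k Complex.I)
        + (v j).im * (w k).re * B (coordVec j Complex.I) (coordVec k 1)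
        + (v j).im * (w k).im * B (coordVec j Complex.I) (coordVec k Complex.I)) := by
  conv_lhs => rw [eq_sum_coordVec v, eq_sum_coordVec w]
  simp only [map_sum, sum_apply]
  rw [Finset.sum_comm]
  refine Finset.sum_congr rfl fun j _ => Finset.sum_congr rfl fun k _ => ?_
  rw [coordVec_eq_smul j (v j), coordVec_eq_smul k (w k)]
  simp only [map_add, map_smul, add_apply, smul_apply,
    Complex.real_smul]
  ring

lemma dz_dzbar_eq {n : ℕ} {f : Cn n → ℂ} {z : Cn n} (hf : ContDiffAt ℝ 2 f z) (j k : Fin n) :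
    dz j (dzbar k f) z =
      (secondDeriv f z (coordVec j 1) (coordVec k 1)
        + secondDeriv f z (coordVec j Complex.I) (coordVec k Complex.I)
        + Complex.I * (secondDeriv f z (coordVec j 1) (coordVec k Complex.I)
          - secondDeriv f z (coordVec j Complex.I) (coordVec k 1))) / 4 := by
  have hd : DifferentiableAt ℝ (fderiv ℝ f) z :=
    (hf.fderiv_right (m := 1) (by norm_num)).differentiableAt (by norm_num)
  have h : HasFDerivAt (dzbar k f)
      ((1 / 2 : ℂ) • (((fderiv ℝ (fderiv ℝ f) z).flip (coordVec k 1))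
        + Complex.I • ((fderiv ℝ (fderiv ℝ f) z).flip (coordVec k Complex.I)))) z := by
    have h1 := (hd.hasFDerivAt.clm_apply (hasFDerivAt_const (coordVec k (1 : ℂ)) z))
    have h2 := (hd.hasFDerivAt.clm_apply (hasFDerivAt_const (coordVec k Complex.I) z))
    have h3 := (h1.add (h2.const_mul Complex.I)).const_mul (1 / 2 : ℂ)
    have e : dzbar k f = fun w => (1 / 2 : ℂ) * (fderiv ℝ f w (coordVec k 1) +
        Complex.I * fderiv ℝ f w (coordVec k Complex.I)) := by
      ext w; simp [dzbar]; ring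
    rw [e]
    refine h3.congr_fderiv ?_
    ext w
    simp
  rw [dz, h.fderiv]
  simp only [secondDeriv, smul_apply, add_apply,
    ContinuousLinearMap.flip_apply, smul_eq_mul]
  linear_combination (-1 / 4 : ℂ) *
    fderiv ℝ (fderiv ℝ f) z (coordVec j Complex.I) (coordVec k Complex.I) * Complex.I_sq

lemma secondDeriv_comm {n : ℕ} {f : Cn n → ℂ} {z : Cn n} (hf : ContDiffAt ℝ 2 f z) (v w : Cn n) :
    secondDeriv f z v w = secondDeriv f z w v :=
  (hf.isSymmSndFDerivAt (by simp)) v w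

lemma levi_eq_sum {n : ℕ} {f : Cn n → ℂ} {z : Cn n} (hf : ContDiffAt ℝ 2 f z) (v : Cn n) :
    levi f z v = ∑ j, ∑ k, 4 * (v j * (starRingEnd ℂ) (v k) * dz j (dzbar k f) z) := by
  -- the terms of the Levi form that cancel by the symmetry of the second derivative
  have key : ∑ j, ∑ k, (((v j).re * (v k).re + (v j).im * (v k).im) *
        (secondDeriv f z (coordVec j 1) (coordVec k Complex.I)
          - secondDeriv f z (coordVec j Complex.I) (coordVec k 1))
      + ((v j).im * (v k).re - (v j).re * (v k).im) *
        (secondDeriv f z (coordVec j 1) (coordVec k 1)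
          + secondDeriv f z (coordVec j Complex.I) (coordVec k Complex.I)) : ℂ) = 0 := by
    -- the summand is antisymmetric in `(j, k)`
    rw [← self_eq_neg]
    conv_lhs => rw [Finset.sum_comm]
    rw [← Finset.sum_neg_distrib]
    refine Finset.sum_congr rfl fun j _ => ?_
    rw [← Finset.sum_neg_distrib]
    refine Finset.sum_congr rfl fun k _ => ?_
    rw [secondDeriv_comm hf (coordVec k 1), secondDeriv_comm hf (coordVec k Complex.I),
      secondDeriv_comm hf (coordVec k 1), secondDeriv_comm hf (coordVec k Complex.I)]
    ring
  rw [levi, secondDeriv, secondDeriv, bilin_expand, bilin_expand, ← sub_eq_zero,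
    ← mul_zero (-Complex.I), ← key, ← Finset.sum_add_distrib, ← Finset.sum_sub_distrib,
    Finset.mul_sum]
  refine Finset.sum_congr rfl fun j _ => ?_
  rw [← Finset.sum_add_distrib, ← Finset.sum_sub_distrib, Finset.mul_sum]
  refine Finset.sum_congr rfl fun k _ => ?_
  rw [dz_dzbar_eq hf]
  have e1 : v j = (v j).re + (v j).im * Complex.I := (Complex.re_add_im _).symm
  have e2 : (starRingEnd ℂ) (v k) = (v k).re - (v k).im * Complex.I := by
    apply Complex.ext <;> simp
  rw [e1, e2]
  simp only [PiLp.smul_apply, smul_eq_mul, Complex.mul_re, Complex.mul_im, Complex.I_re,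
    Complex.I_im, zero_mul, one_mul, zero_sub, zero_add, secondDeriv, Complex.add_re,
    Complex.add_im, Complex.ofReal_re, Complex.ofReal_im, mul_zero, mul_one, add_zero, sub_zero,
    Complex.ofReal_neg]
  ring_nf
  simp only [Complex.I_sq, Complex.I_pow_three]
  ring

lemma sum_orthonormalBasis_mul_conj {n : ℕ} (b : OrthonormalBasis (Fin n) ℂ (Cn n)) (j k : Fin n) :
    ∑ m, b m j * (starRingEnd ℂ) (b m k) = if j = k then 1 else 0 := by
  have h := b.sum_inner_mul_inner (coordVec j (1 : ℂ)) (coordVec k (1 : ℂ))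
  simp only [EuclideanSpace.inner_single_left, EuclideanSpace.inner_single_right, map_one,
    one_mul] at h
  rw [h]
  simp [eq_comm]

/-- The invariant Laplacian in invariant form: up to the conformal factor it is the trace of the
Levi form, taken in any orthonormal basis, minus its value at the position vector. -/
lemma invLaplacian_eq {n : ℕ} {f : Cn n → ℂ} {z : Cn n} (hf : ContDiffAt ℝ 2 f z)
    (b : OrthonormalBasis (Fin n) ℂ (Cn n)) :
    invLaplacian f z = (1 - (‖z‖ : ℂ) ^ 2) * (∑ m, levi f z (b m) - levi f z z) := by
  have h1 : ∑ m, levi f z (b m) =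
      ∑ j, ∑ k, 4 * ((if j = k then 1 else 0) * dz j (dzbar k f) z) := by
    simp_rw [levi_eq_sum hf]
    rw [Finset.sum_comm]
    refine Finset.sum_congr rfl fun j _ => ?_
    rw [Finset.sum_comm]
    refine Finset.sum_congr rfl fun k _ => ?_
    rw [← sum_orthonormalBasis_mul_conj b, ← Finset.mul_sum, Finset.sum_mul]
  rw [h1, levi_eq_sum hf, invLaplacian, ← Finset.sum_sub_distrib, mul_right_comm, mul_comm]
  congr 1
  rw [Finset.mul_sum]
  refine Finset.sum_congr rfl fun j _ => ?_
  rw [Finset.mul_sum, ← Finset.sum_sub_distrib]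
  refine Finset.sum_congr rfl fun k _ => ?_
  ring

lemma IsMHarmonic.contDiffAt {n : ℕ} {f : Cn n → ℂ} (hf : IsMHarmonic f) {z : Cn n}
    (hz : z ∈ unitBall n) : ContDiffAt ℝ 2 f z :=
  hf.1.contDiffAt ((isOpen_unitBall n).mem_nhds hz)

lemma one_sub_normSq_ne_zero {n : ℕ} {z : Cn n} (hz : z ∈ unitBall n) :
    1 - (‖z‖ : ℂ) ^ 2 ≠ 0 := by
  have h : ‖z‖ < 1 := mem_unitBall.1 hz
  have h2 : (0 : ℝ) < 1 - ‖z‖ ^ 2 := by nlinarith [norm_nonneg z]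
  exact_mod_cast h2.ne'

lemma IsMHarmonic.sum_levi {n : ℕ} {f : Cn n → ℂ} (hf : IsMHarmonic f) {z : Cn n}
    (hz : z ∈ unitBall n) (b : OrthonormalBasis (Fin n) ℂ (Cn n)) :
    ∑ m, levi f z (b m) = levi f z z := by
  have h := hf.2 z hz
  rw [invLaplacian_eq (hf.contDiffAt hz) b, mul_eq_zero, sub_eq_zero (b := levi f z z)] at h
  exact h.resolve_left (one_sub_normSq_ne_zero hz)

/-- It suffices to verify the trace equation in one orthonormal basis, which may depend on the
point. -/
lemma isMHarmonic_of_sum_levi {n : ℕ} {f : Cn n → ℂ} (hf : ContDiffOn ℝ 2 f (unitBall n))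
    (h : ∀ z ∈ unitBall n, ∃ b : OrthonormalBasis (Fin n) ℂ (Cn n),
      ∑ m, levi f z (b m) = levi f z z) : IsMHarmonic f := by
  refine ⟨hf, fun z hz => ?_⟩
  obtain ⟨b, hb⟩ := h z hz
  rw [invLaplacian_eq (hf.contDiffAt ((isOpen_unitBall n).mem_nhds hz)) b, hb, sub_self, mul_zero]

lemma secondDeriv_comp {n : ℕ} {f : Cn n → ℂ} (U : Cn n ≃ₗᵢ[ℂ] Cn n) {z : Cn n}
    (hf : ContDiffAt ℝ 2 f (U z)) (v w : Cn n) :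
    secondDeriv (fun x => f (U x)) z v w = secondDeriv f (U z) (U v) (U w) := by
  let V : Cn n ≃L[ℝ] Cn n := U.toContinuousLinearEquiv.restrictScalars ℝ
  have hV : ∀ x, V x = U x := fun x => rfl
  have h1 : fderiv ℝ (fun x => f (U x)) = fun x => (fderiv ℝ f (V x)).comp (V : Cn n →L[ℝ] Cn n) :=
    funext fun x => V.comp_right_fderiv
  have hd : HasFDerivAt (fderiv ℝ f) (fderiv ℝ (fderiv ℝ f) (V z)) (V z) :=
    ((hf.fderiv_right (m := 1) (by norm_num)).differentiableAt (by norm_num)).hasFDerivAt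
  have h2 : HasFDerivAt (fun x => (fderiv ℝ f (V x)).comp (V : Cn n →L[ℝ] Cn n))
      ((((ContinuousLinearMap.compL ℝ (Cn n) (Cn n) ℂ).flip (V : Cn n →L[ℝ] Cn n)).comp
        (fderiv ℝ (fderiv ℝ f) (V z))).comp (V : Cn n →L[ℝ] Cn n)) z :=
    ((((ContinuousLinearMap.compL ℝ (Cn n) (Cn n) ℂ).flip
      (V : Cn n →L[ℝ] Cn n)).hasFDerivAt).comp (V z) hd).comp z V.hasFDerivAt
  rw [secondDeriv, h1, h2.fderiv]
  rfl

lemma levi_comp {n : ℕ} {f : Cn n → ℂ} (U : Cn n ≃ₗᵢ[ℂ] Cn n) {z : Cn n}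
    (hf : ContDiffAt ℝ 2 f (U z)) (v : Cn n) :
    levi (fun x => f (U x)) z v = levi f (U z) (U v) := by
  simp [levi, secondDeriv_comp U hf]

/-- `M`-harmonicity is invariant under unitary changes of variables. -/
lemma IsMHarmonic.comp_unitary {n : ℕ} {f : Cn n → ℂ} (hf : IsMHarmonic f)
    (U : Cn n ≃ₗᵢ[ℂ] Cn n) : IsMHarmonic fun x => f (U x) := by
  have hU : ∀ z ∈ unitBall n, U z ∈ unitBall n := fun z hz => by
    simpa using hz
  refine isMHarmonic_of_sum_levi ?_ fun z hz => ?_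
  · exact hf.1.comp (U.toContinuousLinearEquiv.restrictScalars ℝ).contDiff.contDiffOn hU
  · refine ⟨EuclideanSpace.basisFun (Fin n) ℂ, ?_⟩
    simp_rw [levi_comp U (hf.contDiffAt (hU z hz))]
    simpa using hf.sum_levi (hU z hz) ((EuclideanSpace.basisFun (Fin n) ℂ).map U)

/-- Every vector is a nonnegative multiple of the `i₀`-th vector of some orthonormal basis. -/
lemma exists_orthonormalBasis_smul {n : ℕ} (i₀ : Fin n) (z : Cn n) :
    ∃ b : OrthonormalBasis (Fin n) ℂ (Cn n), z = (‖z‖ : ℂ) • b i₀ := by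
  by_cases hz : z = 0
  · exact ⟨EuclideanSpace.basisFun (Fin n) ℂ, by simp [hz]⟩
  · have hz' : (‖z‖ : ℂ) ≠ 0 := by simpa using hz
    let v : Fin n → Cn n := fun _ => (‖z‖ : ℂ)⁻¹ • z
    have hv : Orthonormal ℂ (Set.domRestrict ({i₀} : Set (Fin n)) v) := by
      refine ⟨fun i => ?_, fun i j hij => absurd (Subsingleton.elim i j) hij⟩
      simp [v, norm_smul, hz]
    obtain ⟨b, hb⟩ := hv.exists_orthonormalBasis_extension_of_card_eq (by simp)
    refine ⟨b, ?_⟩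
    rw [hb i₀ rfl, smul_smul, mul_inv_cancel₀ hz', one_smul]

lemma second_deriv_nonpos_of_isLocalMax {g g' : ℝ → ℝ} {g'' : ℝ} (hmax : IsLocalMax g 0)
    (h1 : ∀ᶠ t in 𝓝 0, HasDerivAt g (g' t) t) (h2 : HasDerivAt g' g'' 0) : g'' ≤ 0 := by
  by_contra! hpos
  have e : deriv g =ᶠ[𝓝 0] g' := h1.mono fun t ht => ht.deriv
  have hdd : deriv (deriv g) 0 = g'' := by rw [e.deriv_eq, h2.deriv]
  have hmin : IsLocalMin g 0 := isLocalMin_of_deriv_deriv_pos (by rwa [hdd]) hmax.deriv_eq_zero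
    h1.self_of_nhds.continuousAt
  have hconst : g =ᶠ[𝓝 0] fun _ => g 0 := by
    filter_upwards [hmax, hmin] with t ht1 ht2 using le_antisymm ht1 ht2
  have h3 : deriv g =ᶠ[𝓝 0] fun _ => 0 := by
    have := hconst.deriv
    simpa using this
  rw [h3.deriv_eq, deriv_const] at hdd
  linarith

lemma levi_real_smul {n : ℕ} (f : Cn n → ℂ) (z v : Cn n) (s : ℝ) :
    levi f z ((s : ℂ) • v) = (s : ℂ) ^ 2 * levi f z v := by
  have e : ∀ w : Cn n, (s : ℂ) • w = s • w := fun w => by ext; simp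
  rw [levi, smul_comm Complex.I, e, e, levi, secondDeriv, secondDeriv]
  simp only [map_smul, smul_apply, Complex.real_smul, secondDeriv]
  ring

lemma hasDerivAt_line {n : ℕ} {G : Type*} [NormedAddCommGroup G] [NormedSpace ℝ G] {f : Cn n → G}
    {z b : Cn n} {t : ℝ} (hf : DifferentiableAt ℝ f (z + t • b)) :
    HasDerivAt (fun s : ℝ => f (z + s • b)) (fderiv ℝ f (z + t • b) b) t := by
  have h : HasDerivAt (fun s : ℝ => z + s • b) b t := by
    simpa using ((hasDerivAt_id t).smul_const b).const_add z
  exact hf.hasFDerivAt.comp_hasDerivAt t h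

/-- The second-order condition at a local maximum of `Re (θ f) + δ ‖·‖²`. -/
lemma secondDeriv_re_le {n : ℕ} {f : Cn n → ℂ} {z : Cn n} (hf : ContDiffAt ℝ 2 f z) (θ : ℂ) (δ : ℝ)
    (hmax : IsLocalMax (fun w => (θ * f w).re + δ * ‖w‖ ^ 2) z) (b : Cn n) :
    (θ * secondDeriv f z b b).re + 2 * δ * ‖b‖ ^ 2 ≤ 0 := by
  have hline : Tendsto (fun t : ℝ => z + t • b) (𝓝 0) (𝓝 z) := by
    have : Continuous fun t : ℝ => z + t • b := by fun_prop
    simpa using this.tendsto 0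
  have hmax' : IsLocalMax (fun t : ℝ => (θ * f (z + t • b)).re + δ * ‖z + t • b‖ ^ 2) 0 := by
    have := hline.eventually hmax
    simpa [IsLocalMax, IsMaxFilter] using this
  have hn : ∀ t : ℝ, HasDerivAt (fun s : ℝ => δ * ‖z + s • b‖ ^ 2)
      (δ * (2 * inner ℝ (z + t • b) b)) t := fun t => by
    have h : HasDerivAt (fun s : ℝ => z + s • b) b t := by
      simpa using ((hasDerivAt_id t).smul_const b).const_add z
    exact h.norm_sq.const_mul δ
  have hre : ∀ {g : ℝ → ℂ} {g' : ℂ} {t : ℝ}, HasDerivAt g g' t →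
      HasDerivAt (fun s => (θ * g s).re) (θ * g').re t := fun h =>
    Complex.reCLM.hasFDerivAt.comp_hasDerivAt _ (h.const_mul θ)
  have hdiff : ∀ᶠ t : ℝ in 𝓝 0, DifferentiableAt ℝ f (z + t • b) := by
    refine hline.eventually ?_
    exact (hf.eventually (by simp)).mono fun w hw => hw.differentiableAt (by norm_num)
  have h1 : ∀ᶠ t : ℝ in 𝓝 0, HasDerivAt
      (fun t : ℝ => (θ * f (z + t • b)).re + δ * ‖z + t • b‖ ^ 2)
      ((θ * fderiv ℝ f (z + t • b) b).re + δ * (2 * inner ℝ (z + t • b) b)) t :=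
    hdiff.mono fun t ht => (hre (hasDerivAt_line ht)).add (hn t)
  have h2 : HasDerivAt (fun t : ℝ => (θ * fderiv ℝ f (z + t • b) b).re +
      δ * (2 * inner ℝ (z + t • b) b))
      ((θ * secondDeriv f z b b).re + δ * (2 * ‖b‖ ^ 2)) 0 := by
    have hd : DifferentiableAt ℝ (fderiv ℝ f) (z + (0 : ℝ) • b) := by
      simpa using (hf.fderiv_right (m := 1) (by norm_num)).differentiableAt (by norm_num)
    have h3 := (hasDerivAt_line hd).clm_apply (hasDerivAt_const (0 : ℝ) b)
    have h4 : HasDerivAt (fun t : ℝ => inner ℝ (z + t • b) b) (‖b‖ ^ 2) 0 := by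
      have h : HasDerivAt (fun s : ℝ => z + s • b) b 0 := by
        simpa using ((hasDerivAt_id (0 : ℝ)).smul_const b).const_add z
      simpa using h.inner ℝ (hasDerivAt_const (0 : ℝ) b)
    refine ((hre h3).add ((h4.const_mul 2).const_mul δ)).congr_deriv ?_
    simp [secondDeriv]
  have := second_deriv_nonpos_of_isLocalMax hmax' h1 h2
  linarith

/-- Adding `δ ‖z‖²` makes a function strictly subharmonic for the
invariant Laplacian, so that it has no interior local maximum. -/
lemma IsMHarmonic.not_isLocalMax {n : ℕ} (i₀ : Fin n) {f : Cn n → ℂ} (hf : IsMHarmonic f) {z : Cn n}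
    (hz : z ∈ unitBall n) (θ : ℂ) {δ : ℝ} (hδ : 0 < δ) :
    ¬ IsLocalMax (fun w => (θ * f w).re + δ * ‖w‖ ^ 2) z := by
  intro hmax
  -- In a basis `b` with `z = ‖z‖ b i₀`, the equation reads
  -- `∑ m, levi f z (b m) = ‖z‖² levi f z (b i₀)`. As `‖z‖ < 1`, the terms cannot all be negative.
  obtain ⟨b, hb⟩ := exists_orthonormalBasis_smul i₀ z
  have hlevi : ∀ m, (θ * levi f z (b m)).re < 0 := fun m => by
    have h1 := secondDeriv_re_le (hf.contDiffAt hz) θ δ hmax (b m)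
    have h2 := secondDeriv_re_le (hf.contDiffAt hz) θ δ hmax (Complex.I • b m)
    rw [levi, mul_add, Complex.add_re]
    simp only [norm_smul, Complex.norm_I, b.norm_eq_one] at h1 h2
    linarith
  have hsum := hf.sum_levi hz b
  have e : levi f z z = (‖z‖ : ℂ) ^ 2 * levi f z (b i₀) := by
    conv_lhs => rw [hb]
    rw [levi_real_smul, ← hb]
  have h3 : ∑ m, (θ * levi f z (b m)).re = ‖z‖ ^ 2 * (θ * levi f z (b i₀)).re := by
    rw [← Complex.re_sum, ← Finset.mul_sum, hsum, e, ← Complex.re_ofReal_mul]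
    congr 1; push_cast; ring
  have h4 : ∑ m, (θ * levi f z (b m)).re ≤ (θ * levi f z (b i₀)).re := by
    rw [← Finset.sum_erase_add _ _ (Finset.mem_univ i₀)]
    linarith [Finset.sum_nonpos (s := Finset.univ.erase i₀) fun m _ => (hlevi m).le]
  have h5 : ‖z‖ ^ 2 < 1 := by
    have := mem_unitBall.1 hz
    nlinarith [norm_nonneg z]
  nlinarith [hlevi i₀]

lemma exists_mul_re_eq_norm (c : ℂ) : ∃ θ : ℂ, ‖θ‖ = 1 ∧ (θ * c).re = ‖c‖ := by
  by_cases hc : c = 0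
  · exact ⟨1, by simp, by simp [hc]⟩
  · have hc' : (‖c‖ : ℂ) ≠ 0 := by simpa using hc
    refine ⟨(starRingEnd ℂ) c / ‖c‖, by simp [hc], ?_⟩
    rw [div_mul_eq_mul_div, Complex.conj_mul', pow_two, mul_div_cancel_right₀ _ hc']
    simp

/-- A bound for an `M`-harmonic function on a sphere of radius `r < 1` holds on the enclosed ball. -/
lemma IsMHarmonic.norm_le_of_sphere {n : ℕ} (i₀ : Fin n) {f : Cn n → ℂ} (hf : IsMHarmonic f)
    {r ε : ℝ} (hr : r < 1) (h : ∀ z : Cn n, ‖z‖ = r → ‖f z‖ ≤ ε) {z : Cn n} (hz : ‖z‖ ≤ r) :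
    ‖f z‖ ≤ ε := by
  obtain ⟨θ, hθ, hre⟩ := exists_mul_re_eq_norm (f z)
  rw [← hre]
  have hsub : Metric.closedBall (0 : Cn n) r ⊆ unitBall n :=
    Metric.closedBall_subset_ball hr
  have main : ∀ δ > 0, (θ * f z).re ≤ ε + δ := by
    intro δ hδ
    have hcont : ContinuousOn (fun w => (θ * f w).re + δ * ‖w‖ ^ 2) (Metric.closedBall 0 r) := by
      have := hf.1.continuousOn.mono hsub
      fun_prop
    obtain ⟨y, hy, hymax⟩ := (isCompact_closedBall (0 : Cn n) r).exists_isMaxOn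
      ⟨z, by simpa using hz⟩ hcont
    have hy' : ‖y‖ ≤ r := by simpa using hy
    have hyr : ‖y‖ = r := by
      by_contra hne
      have hlt : ‖y‖ < r := lt_of_le_of_ne hy' hne
      refine hf.not_isLocalMax i₀ (hsub hy) θ hδ (hymax.isLocalMax ?_)
      exact mem_of_superset (Metric.isOpen_ball.mem_nhds (by simpa using hlt))
        Metric.ball_subset_closedBall
    have h1 : (θ * f z).re + δ * ‖z‖ ^ 2 ≤ (θ * f y).re + δ * ‖y‖ ^ 2 :=
      hymax (by simpa using hz)
    have h2 : (θ * f y).re ≤ ε := by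
      refine (Complex.re_le_norm _).trans ?_
      rw [norm_mul, hθ, one_mul]
      exact h y hyr
    have h3 : ‖y‖ ^ 2 ≤ 1 := by nlinarith [norm_nonneg y]
    nlinarith [sq_nonneg ‖z‖]
  exact le_of_forall_pos_le_add main

/-! ### Integrals of `M`-harmonic functions depending on a parameter -/

universe u

/-- A function of a parameter in a compact space and of a point of a finite-dimensional space is
bounded near each point, uniformly in the parameter. -/
lemma exists_nhds_bound {X : Type*} [TopologicalSpace X] [CompactSpace X]
    {E : Type*} [TopologicalSpace E] {F : Type*} [NormedAddCommGroup F] [NormedSpace ℝ F]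
    [FiniteDimensional ℝ F] {G : Type*} [NormedAddCommGroup G] {Φ : E × F → G} {Ω : Set (E × F)}
    (hΦ : ContinuousOn Φ Ω) {ι : X → E} (hι : Continuous ι) {B : Set F} (hB : IsOpen B)
    (hΩ : ∀ x, ∀ z ∈ B, (ι x, z) ∈ Ω) {z₀ : F} (hz₀ : z₀ ∈ B) :
    ∃ s ∈ 𝓝 z₀, s ⊆ B ∧ ∃ C, ∀ x, ∀ z ∈ s, ‖Φ (ι x, z)‖ ≤ C := by
  have : ProperSpace F := FiniteDimensional.proper ℝ F
  obtain ⟨K, hK, hKB, hKc⟩ := local_compact_nhds (hB.mem_nhds hz₀)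
  refine ⟨K, hK, hKB, ?_⟩
  have hc : ContinuousOn (fun p : X × F => Φ (ι p.1, p.2)) (Set.univ ×ˢ K) :=
    hΦ.comp (by fun_prop) fun p hp => hΩ _ _ (hKB hp.2)
  obtain ⟨C, hC⟩ := (isCompact_univ.prod hKc).exists_bound_of_continuousOn hc
  exact ⟨C, fun x z hz => hC (x, z) ⟨trivial, hz⟩⟩

section

variable {E F G : Type*} [NormedAddCommGroup E] [NormedSpace ℝ E] [NormedAddCommGroup F]
  [NormedSpace ℝ F] [NormedAddCommGroup G] [NormedSpace ℝ G]

lemma fderiv_partial {Φ : E × F → G} {p : E × F} (h : DifferentiableAt ℝ Φ p) :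
    HasFDerivAt (fun w => Φ (p.1, w)) ((fderiv ℝ Φ p).comp (ContinuousLinearMap.inr ℝ E F)) p.2 :=
  h.hasFDerivAt.comp p.2 (hasFDerivAt_prodMk_right p.1 p.2)

/-- The derivative in the second variable is smooth in both variables. -/
lemma contDiffOn_partial {m : ℕ} {Φ : E × F → G} {Ω : Set (E × F)} (hΩo : IsOpen Ω)
    (hΦ : ContDiffOn ℝ (m + 1) Φ Ω) :
    ContDiffOn ℝ m (fun p => (fderiv ℝ Φ p).comp (ContinuousLinearMap.inr ℝ E F)) Ω :=
  (hΦ.fderiv_of_isOpen hΩo le_rfl).clm_comp contDiffOn_const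

end

section Continuity

variable {X : Type*} [TopologicalSpace X] [CompactSpace X] [SecondCountableTopology X]
  [MeasurableSpace X] [BorelSpace X] {ν : Measure X}
  {E : Type*} [TopologicalSpace E]
  {F : Type*} [NormedAddCommGroup F] [NormedSpace ℝ F] [FiniteDimensional ℝ F]

lemma integrable_smul_parametric {G : Type*} [NormedAddCommGroup G] [NormedSpace ℂ G]
    {Φ : E × F → G} {Ω : Set (E × F)}
    (hΦ : ContinuousOn Φ Ω) {ι : X → E} (hι : Continuous ι) {B : Set F} (hB : IsOpen B)
    (hΩ : ∀ x, ∀ z ∈ B, (ι x, z) ∈ Ω) {g : X → ℂ} (hg : Integrable g ν) {z : F} (hz : z ∈ B) :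
    Integrable (fun x => g x • Φ (ι x, z)) ν := by
  obtain ⟨s, hs, -, C, hC⟩ := exists_nhds_bound hΦ hι hB hΩ hz
  have hc : Continuous fun x => Φ (ι x, z) :=
    continuousOn_univ.1 (hΦ.comp (f := fun x => (ι x, z)) (by fun_prop) fun x _ => hΩ x z hz)
  exact hg.smul_of_top_left (memLp_top_of_bound hc.aestronglyMeasurable C
    (Eventually.of_forall fun x => hC x z (mem_of_mem_nhds hs)))

lemma continuousOn_integral_parametric {G : Type*} [NormedAddCommGroup G] [NormedSpace ℝ G]
    [NormedSpace ℂ G] {Φ : E × F → G} {Ω : Set (E × F)}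
    (hΦ : ContinuousOn Φ Ω) {ι : X → E} (hι : Continuous ι) {B : Set F} (hB : IsOpen B)
    (hΩ : ∀ x, ∀ z ∈ B, (ι x, z) ∈ Ω) {g : X → ℂ} (hg : Integrable g ν) :
    ContinuousOn (fun w => ∫ x, g x • Φ (ι x, w) ∂ν) B := by
  intro z hz
  refine ContinuousAt.continuousWithinAt ?_
  obtain ⟨s, hs, hsB, C, hC⟩ := exists_nhds_bound hΦ hι hB hΩ hz
  refine continuousAt_of_dominated (bound := fun x => ‖g x‖ * C) ?_ ?_ (hg.norm.mul_const C) ?_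
  · exact Filter.mem_of_superset hs fun w hw =>
      (integrable_smul_parametric hΦ hι hB hΩ hg (hsB hw)).aestronglyMeasurable
  · filter_upwards [hs] with w hw
    refine Eventually.of_forall fun x => ?_
    rw [norm_smul]
    exact mul_le_mul_of_nonneg_left (hC x w hw) (norm_nonneg _)
  · refine Eventually.of_forall fun x => ContinuousAt.const_smul ?_ _
    have h1 : ContinuousOn (fun w => Φ (ι x, w)) B :=
      hΦ.comp (by fun_prop) fun w hw => hΩ x w hw
    exact h1.continuousAt (hB.mem_nhds hz)

end Continuity

section Differentiability

variable {X : Type*} [TopologicalSpace X] [CompactSpace X] [SecondCountableTopology X]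
  [MeasurableSpace X] [BorelSpace X] {ν : Measure X}
  {E : Type*} [NormedAddCommGroup E] [NormedSpace ℝ E]
  {F : Type u} [NormedAddCommGroup F] [NormedSpace ℝ F] [FiniteDimensional ℝ F]

lemma hasFDerivAt_integral_parametric {G : Type u} [NormedAddCommGroup G] [NormedSpace ℝ G]
    [NormedSpace ℂ G] [SMulCommClass ℝ ℂ G] {Φ : E × F → G} {Ω : Set (E × F)} (hΩo : IsOpen Ω)
    (hΦ : ContDiffOn ℝ 1 Φ Ω) {ι : X → E} (hι : Continuous ι) {B : Set F} (hB : IsOpen B)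
    (hΩ : ∀ x, ∀ z ∈ B, (ι x, z) ∈ Ω) {g : X → ℂ} (hg : Integrable g ν) {z : F} (hz : z ∈ B) :
    HasFDerivAt (fun w => ∫ x, g x • Φ (ι x, w) ∂ν)
      (∫ x, g x • (fderiv ℝ Φ (ι x, z)).comp (ContinuousLinearMap.inr ℝ E F) ∂ν) z := by
  have hΨ : ContinuousOn (fun p => (fderiv ℝ Φ p).comp (ContinuousLinearMap.inr ℝ E F)) Ω :=
    (contDiffOn_partial (m := 0) hΩo (by simpa using hΦ)).continuousOn
  obtain ⟨s, hs, hsB, C, hC⟩ := exists_nhds_bound hΨ hι hB hΩ hz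
  refine hasFDerivAt_integral_of_dominated_of_fderiv_le (bound := fun x => ‖g x‖ * C)
    (F' := fun w x => g x • (fderiv ℝ Φ (ι x, w)).comp (ContinuousLinearMap.inr ℝ E F)) hs
    ?_ ?_ ?_ ?_ ?_ ?_
  · exact Filter.mem_of_superset hs fun w hw =>
      (integrable_smul_parametric hΦ.continuousOn hι hB hΩ hg (hsB hw)).aestronglyMeasurable
  · exact integrable_smul_parametric hΦ.continuousOn hι hB hΩ hg hz
  · exact (integrable_smul_parametric hΨ hι hB hΩ hg hz).aestronglyMeasurable
  · refine Eventually.of_forall fun x w hw => ?_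
    rw [norm_smul]
    exact mul_le_mul_of_nonneg_left (hC x w hw) (norm_nonneg _)
  · exact hg.norm.mul_const C
  · refine Eventually.of_forall fun x w hw => ?_
    have hd : DifferentiableAt ℝ Φ (ι x, w) :=
      (hΦ.differentiableOn (by norm_num)).differentiableAt (hΩo.mem_nhds (hΩ x w (hsB hw)))
    exact (fderiv_partial hd).const_smul (g x)

/-- Differentiation under the integral sign, to any order. The induction passes from values in `G`
to values in `F →L[ℝ] G`, whence the common universe of `F` and `G`. -/
lemma contDiffOn_integral_parametric (m : ℕ) : ∀ {G : Type u} [NormedAddCommGroup G]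
    [NormedSpace ℝ G] [NormedSpace ℂ G] [SMulCommClass ℝ ℂ G]
    {Φ : E × F → G} {Ω : Set (E × F)} (_ : IsOpen Ω)
    (_ : ContDiffOn ℝ m Φ Ω) {ι : X → E} (_ : Continuous ι) {B : Set F} (_ : IsOpen B)
    (_ : ∀ x, ∀ z ∈ B, (ι x, z) ∈ Ω) {g : X → ℂ} (_ : Integrable g ν),
    ContDiffOn ℝ m (fun w => ∫ x, g x • Φ (ι x, w) ∂ν) B := by
  induction m with
  | zero =>
    intro G _ _ _ _ Φ Ω hΩo hΦ ι hι B hB hΩ g hg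
    rw [Nat.cast_zero, contDiffOn_zero] at hΦ ⊢
    exact continuousOn_integral_parametric hΦ hι hB hΩ hg
  | succ m ih =>
    intro G _ _ _ _ Φ Ω hΩo hΦ ι hι B hB hΩ g hg
    have hΦ1 : ContDiffOn ℝ 1 Φ Ω := hΦ.of_le (by push_cast; exact le_add_self)
    have hder := fun z hz => hasFDerivAt_integral_parametric (z := z) hΩo hΦ1 hι hB hΩ hg hz
    push_cast at hΦ ⊢
    rw [contDiffOn_succ_iff_fderiv_of_isOpen hB]
    refine ⟨fun z hz => (hder z hz).differentiableAt.differentiableWithinAt, by simp, ?_⟩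
    refine (ih hΩo (contDiffOn_partial hΩo hΦ) hι hB hΩ hg).congr fun z hz => ?_
    exact (hder z hz).fderiv

end Differentiability

/-- A superposition of `M`-harmonic functions depending on a parameter in a compact space is
`M`-harmonic. -/
lemma isMHarmonic_integral {n : ℕ} {X : Type*} [TopologicalSpace X] [CompactSpace X]
    [SecondCountableTopology X] [MeasurableSpace X] [BorelSpace X] {ν : Measure X}
    {E : Type*} [NormedAddCommGroup E] [NormedSpace ℝ E]
    {Φ : E × Cn n → ℂ} {Ω : Set (E × Cn n)} (hΩo : IsOpen Ω)
    (hΦ : ContDiffOn ℝ 2 Φ Ω) {ι : X → E} (hι : Continuous ι)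
    (hΩ : ∀ x, ∀ z ∈ unitBall n, (ι x, z) ∈ Ω) {g : X → ℂ} (hg : Integrable g ν)
    (hM : ∀ x, IsMHarmonic fun z => Φ (ι x, z)) :
    IsMHarmonic fun z => ∫ x, g x * Φ (ι x, z) ∂ν := by
  have hB := isOpen_unitBall n
  -- the first and second derivatives of `Φ` in the second variable
  let Φ₁ : E × Cn n → Cn n →L[ℝ] ℂ := fun p =>
    (fderiv ℝ Φ p).comp (ContinuousLinearMap.inr ℝ E (Cn n))
  let Φ₂ : E × Cn n → Cn n →L[ℝ] Cn n →L[ℝ] ℂ := fun p =>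
    (fderiv ℝ Φ₁ p).comp (ContinuousLinearMap.inr ℝ E (Cn n))
  have hΦ₁ : ContDiffOn ℝ 1 Φ₁ Ω := contDiffOn_partial (m := 1) hΩo (by norm_num; exact hΦ)
  have hΦ₂ : ContinuousOn Φ₂ Ω :=
    (contDiffOn_partial (m := 0) hΩo (by simpa using hΦ₁)).continuousOn
  have hΦ' : ContDiffOn ℝ 1 Φ Ω := hΦ.of_le (by norm_num)
  have hsd : ∀ x, ∀ z ∈ unitBall n, ∀ v w,
      secondDeriv (fun z => Φ (ι x, z)) z v w = Φ₂ (ι x, z) v w := by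
    intro x z hz v w
    have e : fderiv ℝ (fun z => Φ (ι x, z)) =ᶠ[𝓝 z] fun z => Φ₁ (ι x, z) := by
      filter_upwards [hB.mem_nhds hz] with y hy
      exact (fderiv_partial (p := (ι x, y)) ((hΦ'.differentiableOn (by norm_num)).differentiableAt
        (hΩo.mem_nhds (hΩ x y hy)))).fderiv
    rw [secondDeriv, e.fderiv_eq, (fderiv_partial (p := (ι x, z))
      ((hΦ₁.differentiableOn (by norm_num)).differentiableAt
        (hΩo.mem_nhds (hΩ x z hz)))).fderiv]
  have hsi : ∀ z ∈ unitBall n, ∀ v w, secondDeriv (fun z => ∫ x, g x * Φ (ι x, z) ∂ν) z v w =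
      ∫ x, g x * secondDeriv (fun z => Φ (ι x, z)) z v w ∂ν := by
    intro z hz v w
    have e : fderiv ℝ (fun z => ∫ x, g x * Φ (ι x, z) ∂ν) =ᶠ[𝓝 z]
        fun z => ∫ x, g x • Φ₁ (ι x, z) ∂ν := by
      filter_upwards [hB.mem_nhds hz] with y hy
      exact (hasFDerivAt_integral_parametric hΩo hΦ' hι hB hΩ hg hy).fderiv
    rw [secondDeriv, e.fderiv_eq, (hasFDerivAt_integral_parametric hΩo hΦ₁ hι hB hΩ hg hz).fderiv]
    have hi := integrable_smul_parametric (G := Cn n →L[ℝ] Cn n →L[ℝ] ℂ) hΦ₂ hι hB hΩ hg hz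
    rw [ContinuousLinearMap.integral_apply hi,
      ContinuousLinearMap.integral_apply (hi.apply_continuousLinearMap v)]
    simp_rw [hsd _ z hz]
    rfl
  have hint : ∀ z ∈ unitBall n, ∀ v w,
      Integrable (fun x => g x * secondDeriv (fun z => Φ (ι x, z)) z v w) ν := by
    intro z hz v w
    have hi := integrable_smul_parametric (G := Cn n →L[ℝ] Cn n →L[ℝ] ℂ) hΦ₂ hι hB hΩ hg hz
    refine ((hi.apply_continuousLinearMap v).apply_continuousLinearMap w).congr
      (Eventually.of_forall fun x => ?_)
    simp [hsd x z hz]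
  have hlint : ∀ z ∈ unitBall n, ∀ v,
      Integrable (fun x => g x * levi (fun z => Φ (ι x, z)) z v) ν := by
    intro z hz v
    simp_rw [levi, mul_add]
    exact (hint z hz _ _).add (hint z hz _ _)
  have hlevi : ∀ z ∈ unitBall n, ∀ v, levi (fun z => ∫ x, g x * Φ (ι x, z) ∂ν) z v =
      ∫ x, g x * levi (fun z => Φ (ι x, z)) z v ∂ν := by
    intro z hz v
    simp_rw [levi, mul_add]
    rw [integral_add (hint z hz _ _) (hint z hz _ _), hsi z hz, hsi z hz]
  refine isMHarmonic_of_sum_levi ?_ fun z hz => ⟨EuclideanSpace.basisFun (Fin n) ℂ, ?_⟩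
  · exact contDiffOn_integral_parametric 2 hΩo (by exact_mod_cast hΦ) hι hB hΩ hg
  · simp_rw [hlevi z hz]
    rw [← integral_finsetSum _ fun m _ => hlint z hz _]
    simp_rw [← Finset.mul_sum, (hM _).sum_levi hz]

/-! ### The Poisson–Szegő kernel -/

lemma herm_eq_inner {n : ℕ} (z w : Cn n) : herm z w = inner ℂ w z := by
  simp [herm, PiLp.inner_apply]

lemma herm_self {n : ℕ} (z : Cn n) : herm z z = (‖z‖ : ℂ) ^ 2 := by
  rw [herm_eq_inner, inner_self_eq_norm_sq_to_K]; rfl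

lemma conj_herm {n : ℕ} (z w : Cn n) : (starRingEnd ℂ) (herm z w) = herm w z := by
  rw [herm_eq_inner, herm_eq_inner, inner_conj_symm]

lemma norm_herm_le {n : ℕ} (z w : Cn n) : ‖herm z w‖ ≤ ‖z‖ * ‖w‖ := by
  rw [herm_eq_inner, mul_comm]; exact norm_inner_le_norm w z

lemma herm_coordVec_left {n : ℕ} (j : Fin n) (c : ℂ) (w : Cn n) :
    herm (coordVec j c) w = c * (starRingEnd ℂ) (w j) := by
  rw [herm_eq_inner, EuclideanSpace.inner_single_right, mul_comm]

lemma herm_coordVec_right {n : ℕ} (j : Fin n) (c : ℂ) (w : Cn n) :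
    herm w (coordVec j c) = (starRingEnd ℂ) c * w j := by
  rw [herm_eq_inner, EuclideanSpace.inner_single_left]

lemma hasFDerivAt_herm_left {n : ℕ} (ζ z : Cn n) :
    ∃ A : Cn n →L[ℝ] ℂ, (∀ v, A v = herm v ζ) ∧ HasFDerivAt (fun w => herm w ζ) A z := by
  refine ⟨(innerSL ℂ ζ).restrictScalars ℝ, fun v => by simp [herm_eq_inner], ?_⟩
  simp_rw [herm_eq_inner]
  exact ((innerSL ℂ ζ).restrictScalars ℝ).hasFDerivAt

lemma hasFDerivAt_herm_right {n : ℕ} (ζ z : Cn n) :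
    ∃ A : Cn n →L[ℝ] ℂ, (∀ v, A v = herm ζ v) ∧ HasFDerivAt (fun w => herm ζ w) A z := by
  obtain ⟨A, hA, hd⟩ := hasFDerivAt_herm_left ζ z
  refine ⟨(Complex.conjCLE : ℂ →L[ℝ] ℂ).comp A, fun v => by simp [hA, conj_herm], ?_⟩
  refine (((Complex.conjCLE : ℂ →L[ℝ] ℂ).hasFDerivAt).comp z hd).congr_of_eventuallyEq ?_
  exact Eventually.of_forall fun w => by simp [conj_herm]

lemma hasFDerivAt_one_sub_normSq {n : ℕ} (z : Cn n) :
    ∃ A : Cn n →L[ℝ] ℂ, (∀ v, A v = -(herm v z + herm z v)) ∧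
      HasFDerivAt (fun w : Cn n => 1 - (‖w‖ : ℂ) ^ 2) A z := by
  have h := (hasStrictFDerivAt_norm_sq z).hasFDerivAt
  have h2 := (Complex.ofRealCLM.hasFDerivAt.comp z h).const_sub (1 : ℂ)
  refine ⟨_, fun v => ?_, h2.congr_of_eventuallyEq (Eventually.of_forall fun w => by simp)⟩
  have e : (inner ℝ z v : ℝ) = (herm v z).re := by
    rw [herm_eq_inner]
    simp [PiLp.inner_apply, Complex.inner]
  have e2 : herm z v = (starRingEnd ℂ) (herm v z) := (conj_herm v z).symm
  rw [e2, Complex.add_conj]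
  simp [e]

/-- The derivative of a power in terms of the logarithmic derivative, which avoids the truncated
exponent `m - 1`. -/
lemma hasFDerivAt_pow_log {E : Type*} [NormedAddCommGroup E] [NormedSpace ℝ E] {f : E → ℂ}
    {f' : E →L[ℝ] ℂ} {z : E} (hf : HasFDerivAt f f' z) (h0 : f z ≠ 0) (m : ℕ) :
    HasFDerivAt (fun w => f w ^ m) ((m * f z ^ m / f z : ℂ) • f') z := by
  refine (hf.pow m).congr_fderiv ?_
  ext v
  rcases m with _ | m
  · simp
  · simp only [smul_apply, smul_eq_mul, Nat.add_sub_cancel, nsmul_eq_mul]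
    field_simp
    ring

lemma hasFDerivAt_inv_comp {E : Type*} [NormedAddCommGroup E] [NormedSpace ℝ E] {f : E → ℂ}
    {f' : E →L[ℝ] ℂ} {z : E} (hf : HasFDerivAt f f' z) (h0 : f z ≠ 0) :
    HasFDerivAt (fun w => (f w)⁻¹) ((-(f z ^ 2)⁻¹ : ℂ) • f') z := by
  have h := ((hasDerivAt_inv h0).hasFDerivAt.restrictScalars ℝ).comp z hf
  refine h.congr_fderiv ?_
  ext v
  simp [mul_comm]

/-- The normalizing constant `Γ(n) / (2πⁿ)`, the reciprocal of the total mass of `σ`. -/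
def invMass (n : ℕ) : ℂ := Complex.Gamma n / (2 * (Real.pi : ℂ) ^ n)

/-- The Poisson–Szegő kernel `Γ(n) / (2πⁿ) · (1 - |z|²)ⁿ / |1 - ⟨z, ζ⟩|²ⁿ`, with the denominator
split into its holomorphic and antiholomorphic factors. -/
def poisson {n : ℕ} (z ζ : Cn n) : ℂ :=
  invMass n * (1 - (‖z‖ : ℂ) ^ 2) ^ n * ((1 - herm z ζ)⁻¹) ^ n * ((1 - herm ζ z)⁻¹) ^ n

lemma one_sub_herm_ne_zero {n : ℕ} {z ζ : Cn n} (hz : z ∈ unitBall n) (hζ : ‖ζ‖ = 1) :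
    1 - herm z ζ ≠ 0 := by
  intro h
  have h1 : herm z ζ = 1 := (sub_eq_zero.1 h).symm
  have h2 := norm_herm_le z ζ
  rw [h1, hζ, mul_one, norm_one] at h2
  exact absurd (mem_unitBall.1 hz) (not_lt.2 h2)

lemma one_sub_herm_ne_zero' {n : ℕ} {z ζ : Cn n} (hz : z ∈ unitBall n) (hζ : ‖ζ‖ = 1) :
    1 - herm ζ z ≠ 0 := by
  intro h
  have h1 : herm ζ z = 1 := (sub_eq_zero.1 h).symm
  have h2 := norm_herm_le ζ z
  rw [h1, hζ, one_mul, norm_one] at h2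
  exact absurd (mem_unitBall.1 hz) (not_lt.2 h2)

/-- The real differential of the Poisson–Szegő kernel, as a logarithmic derivative. -/
lemma hasFDerivAt_poisson {n : ℕ} {z ζ : Cn n} (hz : z ∈ unitBall n) (hζ : ‖ζ‖ = 1) :
    ∃ A : Cn n →L[ℝ] ℂ, (∀ v, A v = n * poisson z ζ *
        (-(herm v z + herm z v) / (1 - (‖z‖ : ℂ) ^ 2) + herm v ζ / (1 - herm z ζ)
          + herm ζ v / (1 - herm ζ z))) ∧ HasFDerivAt (fun w => poisson w ζ) A z := by
  have hu0 := one_sub_normSq_ne_zero hz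
  have hs0 := one_sub_herm_ne_zero hz hζ
  have ht0 := one_sub_herm_ne_zero' hz hζ
  obtain ⟨U, hU, hu⟩ := hasFDerivAt_one_sub_normSq z
  obtain ⟨S, hS, hs⟩ := hasFDerivAt_herm_left ζ z
  obtain ⟨T, hT, ht⟩ := hasFDerivAt_herm_right ζ z
  have h1 := (hasFDerivAt_pow_log hu hu0 n).const_mul (invMass n)
  have h2 := hasFDerivAt_pow_log (hasFDerivAt_inv_comp (hs.const_sub 1) hs0) (inv_ne_zero hs0) n
  have h3 := hasFDerivAt_pow_log (hasFDerivAt_inv_comp (ht.const_sub 1) ht0) (inv_ne_zero ht0) n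
  refine ⟨_, fun v => ?_, (h1.mul h2).mul h3⟩
  simp only [add_apply, smul_apply, neg_apply, smul_eq_mul, hU, hS, hT, poisson, Pi.mul_apply]
  field_simp
  ring

lemma dzbar_poisson {n : ℕ} {z ζ : Cn n} (hz : z ∈ unitBall n) (hζ : ‖ζ‖ = 1) (k : Fin n) :
    dzbar k (fun w => poisson w ζ) z =
      n * (poisson z ζ * (-z k * (1 - (‖z‖ : ℂ) ^ 2)⁻¹ + ζ k * (1 - herm ζ z)⁻¹)) := by
  obtain ⟨A, hA, h⟩ := hasFDerivAt_poisson hz hζ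
  rw [dzbar, h.fderiv, hA, hA]
  simp only [herm_coordVec_left, herm_coordVec_right, map_one, one_mul, Complex.conj_I]
  linear_combination (n * poisson z ζ / 2 * (-((starRingEnd ℂ) (z k) - z k) /
    (1 - (‖z‖ : ℂ) ^ 2) + (starRingEnd ℂ) (ζ k) / (1 - herm z ζ)
    - ζ k / (1 - herm ζ z))) * Complex.I_sq

lemma dz_dzbar_poisson {n : ℕ} {z ζ : Cn n} (hz : z ∈ unitBall n) (hζ : ‖ζ‖ = 1) (j k : Fin n) :
    dz j (dzbar k fun w => poisson w ζ) z =
      n * poisson z ζ * (n *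
        (-(starRingEnd ℂ) (z j) / (1 - (‖z‖ : ℂ) ^ 2) + (starRingEnd ℂ) (ζ j) / (1 - herm z ζ)) *
        (-z k / (1 - (‖z‖ : ℂ) ^ 2) + ζ k / (1 - herm ζ z))
        - (if j = k then 1 else 0) / (1 - (‖z‖ : ℂ) ^ 2)
        - (starRingEnd ℂ) (z j) * z k / (1 - (‖z‖ : ℂ) ^ 2) ^ 2) := by
  have hu0 := one_sub_normSq_ne_zero hz
  have hs0 := one_sub_herm_ne_zero hz hζ
  have ht0 := one_sub_herm_ne_zero' hz hζ
  obtain ⟨A, hA, hP⟩ := hasFDerivAt_poisson hz hζ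
  obtain ⟨U, hU, hu⟩ := hasFDerivAt_one_sub_normSq z
  obtain ⟨T, hT, ht⟩ := hasFDerivAt_herm_right ζ z
  have hk : HasFDerivAt (fun w : Cn n => -w k)
      (-((EuclideanSpace.proj k : Cn n →L[ℂ] ℂ).restrictScalars ℝ : Cn n →L[ℝ] ℂ)) z :=
    ((EuclideanSpace.proj k : Cn n →L[ℂ] ℂ).restrictScalars ℝ : Cn n →L[ℝ] ℂ).hasFDerivAt.neg
  have h1 := hk.mul (hasFDerivAt_inv_comp hu hu0)
  have h2 := (hasFDerivAt_inv_comp (ht.const_sub 1) ht0).const_mul (ζ k)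
  have h := (hP.mul (h1.add h2)).const_mul (n : ℂ)
  have e : (dzbar k fun w => poisson w ζ) =ᶠ[𝓝 z] fun w =>
      n * (poisson w ζ * (-w k * (1 - (‖w‖ : ℂ) ^ 2)⁻¹ + ζ k * (1 - herm ζ w)⁻¹)) := by
    filter_upwards [(isOpen_unitBall n).mem_nhds hz] with w hw using dzbar_poisson hw hζ k
  rw [dz, e.fderiv_eq]
  erw [h.fderiv]
  simp only [add_apply, smul_apply, neg_apply, smul_eq_mul, hU, hT, hA, herm_coordVec_left,
    herm_coordVec_right, map_one, one_mul, Complex.conj_I, ContinuousLinearMap.coe_restrictScalars',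
    PiLp.proj_apply, Pi.add_apply, Pi.mul_apply]
  by_cases hjk : j = k
  · subst hjk
    simp
    field_simp
    ring_nf
    simp only [Complex.I_sq]
    ring
  · have hkj : k ≠ j := fun h => hjk h.symm
    simp [hjk, hkj]
    field_simp
    ring_nf
    simp only [Complex.I_sq]
    ring

/-- The invariant Laplacian of the Poisson–Szegő kernel vanishes on the ball. -/
lemma invLaplacian_poisson {n : ℕ} {z ζ : Cn n} (hz : z ∈ unitBall n) (hζ : ‖ζ‖ = 1) :
    invLaplacian (fun w => poisson w ζ) z = 0 := by
  have hu0 := one_sub_normSq_ne_zero hz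
  have hs0 := one_sub_herm_ne_zero hz hζ
  have ht0 := one_sub_herm_ne_zero' hz hζ
  -- contraction of `δⱼₖ - zⱼ z̄ₖ` with a rank one matrix
  have rank1 : ∀ x y : Fin n → ℂ, ∑ j, ∑ k, ((if j = k then 1 else 0) -
      z j * (starRingEnd ℂ) (z k)) * (x j * y k) =
      ∑ j, x j * y j - (∑ j, z j * x j) * ∑ k, (starRingEnd ℂ) (z k) * y k := by
    intro x y
    rw [Finset.sum_mul_sum, ← Finset.sum_sub_distrib]
    refine Finset.sum_congr rfl fun j _ => ?_
    simp_rw [sub_mul]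
    rw [Finset.sum_sub_distrib]
    congr 1
    · simp
    · exact Finset.sum_congr rfl fun k _ => by ring
  have diag : ∑ j : Fin n, ∑ k : Fin n, (((if j = k then 1 else 0) -
      z j * (starRingEnd ℂ) (z k)) * (if j = k then 1 else 0) : ℂ) = n - herm z z := by
    simp [herm]
  have hzz : ∑ j, z j * (starRingEnd ℂ) (z j) = (‖z‖ : ℂ) ^ 2 := herm_self z
  have hzz' : ∑ j, (starRingEnd ℂ) (z j) * z j = (‖z‖ : ℂ) ^ 2 := by
    rw [← hzz]; exact Finset.sum_congr rfl fun j _ => mul_comm _ _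
  have hζζ : ∑ j, (starRingEnd ℂ) (ζ j) * ζ j = 1 := by
    have := herm_self ζ
    rw [hζ] at this
    rw [← one_pow 2, ← Complex.ofReal_one, ← this]
    exact Finset.sum_congr rfl fun j _ => mul_comm _ _
  have hzζ : ∑ j, z j * (starRingEnd ℂ) (ζ j) = herm z ζ := rfl
  have hzζ' : ∑ j, (starRingEnd ℂ) (ζ j) * z j = herm z ζ :=
    Finset.sum_congr rfl fun j _ => mul_comm _ _
  have hζz : ∑ j, (starRingEnd ℂ) (z j) * ζ j = herm ζ z :=
    Finset.sum_congr rfl fun j _ => mul_comm _ _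
  set u : ℂ := 1 - (‖z‖ : ℂ) ^ 2 with hu
  set s : ℂ := 1 - herm z ζ with hs
  set t : ℂ := 1 - herm ζ z with ht
  have e1 : (‖z‖ : ℂ) ^ 2 = 1 - u := by rw [hu]; ring
  have e2 : herm z ζ = 1 - s := by rw [hs]; ring
  have e3 : herm ζ z = 1 - t := by rw [ht]; ring
  have c1 := rank1 (fun j => -(starRingEnd ℂ) (z j) / u + (starRingEnd ℂ) (ζ j) / s)
    (fun k => -z k / u + ζ k / t)
  have c2 := rank1 (fun j => (starRingEnd ℂ) (z j)) z
  have d1 : ∑ j, (-(starRingEnd ℂ) (z j) / u + (starRingEnd ℂ) (ζ j) / s) * (-z j / u + ζ j / t) =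
      (1 - u) / u ^ 2 - (1 - t) / (u * t) - (1 - s) / (s * u) + 1 / (s * t) := by
    rw [← e1, ← e2, ← e3, ← hzz', ← hζz, ← hzζ', ← hζζ]
    simp only [Finset.sum_div]
    rw [← Finset.sum_sub_distrib, ← Finset.sum_sub_distrib, ← Finset.sum_add_distrib]
    refine Finset.sum_congr rfl fun j _ => ?_
    field_simp
    ring
  have d2 : ∑ j, z j * (-(starRingEnd ℂ) (z j) / u + (starRingEnd ℂ) (ζ j) / s) =
      -(1 - u) / u + (1 - s) / s := by
    rw [← e1, ← e2, ← hzz, ← hzζ, neg_div]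
    simp only [Finset.sum_div]
    rw [← Finset.sum_neg_distrib, ← Finset.sum_add_distrib]
    exact Finset.sum_congr rfl fun j _ => by ring
  have d3 : ∑ k, (starRingEnd ℂ) (z k) * (-z k / u + ζ k / t) = -(1 - u) / u + (1 - t) / t := by
    rw [← e1, ← e3, ← hzz', ← hζz, neg_div]
    simp only [Finset.sum_div]
    rw [← Finset.sum_neg_distrib, ← Finset.sum_add_distrib]
    exact Finset.sum_congr rfl fun j _ => by ring
  rw [d1, d2, d3] at c1
  rw [hzz, hzz', e1] at c2
  rw [herm_self, e1] at diag
  have split : ∑ j, ∑ k, ((if j = k then 1 else 0) - z j * (starRingEnd ℂ) (z k)) *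
      dz j (dzbar k fun w => poisson w ζ) z =
      n * poisson z ζ * (n * ∑ j, ∑ k, ((if j = k then 1 else 0) - z j * (starRingEnd ℂ) (z k)) *
          ((-(starRingEnd ℂ) (z j) / u + (starRingEnd ℂ) (ζ j) / s) * (-z k / u + ζ k / t))
        - (∑ j : Fin n, ∑ k : Fin n, (((if j = k then 1 else 0) -
            z j * (starRingEnd ℂ) (z k)) * (if j = k then 1 else 0) : ℂ)) / u
        - (∑ j, ∑ k, ((if j = k then 1 else 0) - z j * (starRingEnd ℂ) (z k)) *
          ((starRingEnd ℂ) (z j) * z k)) / u ^ 2) := by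
    simp only [Finset.mul_sum, Finset.sum_div, ← Finset.sum_sub_distrib]
    refine Finset.sum_congr rfl fun j _ => Finset.sum_congr rfl fun k _ => ?_
    rw [dz_dzbar_poisson hz hζ]
    ring
  rw [invLaplacian, split, c1, c2, diag]
  field_simp
  ring

/-- The set of pairs `(ζ, z)` at which no denominator of the Poisson–Szegő kernel vanishes. It
contains the product of the sphere and the ball. -/
lemma isOpen_poisson_domain (n : ℕ) :
    IsOpen {p : Cn n × Cn n | herm p.2 p.1 ≠ 1 ∧ herm p.1 p.2 ≠ 1} := by
  simp_rw [herm_eq_inner]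
  have h1 : Continuous fun p : Cn n × Cn n => inner ℂ p.1 p.2 := by fun_prop
  have h2 : Continuous fun p : Cn n × Cn n => inner ℂ p.2 p.1 := by fun_prop
  exact (isOpen_ne_fun h1 continuous_const).inter (isOpen_ne_fun h2 continuous_const)

lemma contDiffOn_poisson (n : ℕ) :
    ContDiffOn ℝ 2 (fun p : Cn n × Cn n => poisson p.2 p.1)
      {p : Cn n × Cn n | herm p.2 p.1 ≠ 1 ∧ herm p.1 p.2 ≠ 1} := by
  have h1 : ContDiff ℝ 2 fun p : Cn n × Cn n => herm p.2 p.1 := by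
    simp_rw [herm_eq_inner]; exact contDiff_fst.inner ℂ contDiff_snd
  have h2 : ContDiff ℝ 2 fun p : Cn n × Cn n => herm p.1 p.2 := by
    simp_rw [herm_eq_inner]; exact contDiff_snd.inner ℂ contDiff_fst
  have h3 : ContDiff ℝ 2 fun p : Cn n × Cn n => (‖p.2‖ : ℂ) ^ 2 := by
    simp_rw [← Complex.ofReal_pow]
    exact Complex.ofRealCLM.contDiff.comp (contDiff_snd.norm_sq ℂ)
  refine ((contDiffOn_const.mul ((contDiff_const.sub h3).pow n).contDiffOn).mul
    (ContDiffOn.pow (ContDiffOn.inv (contDiff_const.sub h1).contDiffOn fun p hp => ?_) n)).mul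
    (ContDiffOn.pow (ContDiffOn.inv (contDiff_const.sub h2).contDiffOn fun p hp => ?_) n)
  · exact sub_ne_zero.2 hp.1.symm
  · exact sub_ne_zero.2 hp.2.symm

lemma mem_poisson_domain {n : ℕ} (ζ : unitSphere n) {z : Cn n} (hz : z ∈ unitBall n) :
    ((ζ : Cn n), z) ∈ {p : Cn n × Cn n | herm p.2 p.1 ≠ 1 ∧ herm p.1 p.2 ≠ 1} := by
  have hζ : ‖(ζ : Cn n)‖ = 1 := by simp
  exact ⟨(sub_ne_zero.1 (one_sub_herm_ne_zero hz hζ)).symm,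
    (sub_ne_zero.1 (one_sub_herm_ne_zero' hz hζ)).symm⟩

lemma isMHarmonic_poisson {n : ℕ} (ζ : unitSphere n) : IsMHarmonic fun z => poisson z (ζ : Cn n) :=
  ⟨(contDiffOn_poisson n).comp (f := fun z => ((ζ : Cn n), z)) (by fun_prop)
    fun _ hz => mem_poisson_domain ζ hz, fun _ hz => invLaplacian_poisson hz (by simp)⟩

instance (n : ℕ) : IsFiniteMeasure (surfaceMeasure n) := by
  unfold surfaceMeasure; infer_instance

/-- The Poisson–Szegő integral of a function on the sphere. -/
def poissonInt {n : ℕ} (g : unitSphere n → ℂ) (z : Cn n) : ℂ :=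
  ∫ ζ, g ζ * poisson z ζ ∂(surfaceMeasure n)

lemma isMHarmonic_poissonInt {n : ℕ} {g : unitSphere n → ℂ}
    (hg : Integrable g (surfaceMeasure n)) : IsMHarmonic (poissonInt g) :=
  isMHarmonic_integral (isOpen_poisson_domain n) (contDiffOn_poisson n) continuous_subtype_val
    (fun ζ _ hz => mem_poisson_domain ζ hz) hg isMHarmonic_poisson

/-! ### Moments of the surface measure -/

lemma integrable_pow_mul_conj_pow_mul_gaussian (a b : ℕ) :
    Integrable fun ξ : ℂ => ((starRingEnd ℂ) ξ) ^ a * ξ ^ b * (Real.exp (-‖ξ‖ ^ 2) : ℂ) := by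
  have h : Integrable fun ξ : ℂ => ‖ξ‖ ^ (a + b) * Real.exp (-‖ξ‖ ^ 2) := by
    rw [integrable_fun_norm_addHaar (volume : Measure ℂ)
      (f := fun r => r ^ (a + b) * Real.exp (-r ^ 2))]
    have h1 := integrableOn_rpow_mul_exp_neg_rpow (p := 2) (s := ((1 + (a + b) : ℕ) : ℝ))
      (lt_of_lt_of_le (by norm_num) (Nat.cast_nonneg _)) (by norm_num)
    refine h1.congr_fun (fun x hx => ?_) measurableSet_Ioi
    simp only [Complex.finrank_real_complex, smul_eq_mul, Real.rpow_natCast]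
    rw [show ((2 : ℝ)) = ((2 : ℕ) : ℝ) by norm_num, Real.rpow_natCast]
    ring
  refine h.mono' (by fun_prop) (Eventually.of_forall fun ξ => ?_)
  rw [norm_mul, norm_mul, norm_pow, norm_pow, RCLike.norm_conj, ← pow_add, Complex.norm_real,
    Real.norm_eq_abs, abs_of_pos (Real.exp_pos _)]

/-- The one-dimensional Gaussian moments: monomials are orthogonal, with norms `π a!`. -/
lemma integral_conj_pow_mul_pow_mul_gaussian (a b : ℕ) :
    ∫ ξ : ℂ, ((starRingEnd ℂ) ξ) ^ a * ξ ^ b * (Real.exp (-‖ξ‖ ^ 2) : ℂ) =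
      if a = b then (Real.pi : ℂ) * a.factorial else 0 := by
  split_ifs with hab
  · subst hab
    have h := Complex.integral_rpow_mul_exp_neg_rpow (p := 2) (q := ((2 * a : ℕ) : ℝ))
      (by norm_num) (lt_of_lt_of_le (by norm_num) (Nat.cast_nonneg _))
    simp only [Real.rpow_natCast] at h
    rw [show ((((2 * a : ℕ) : ℝ) + 2) / 2 : ℝ) = a + 1 by push_cast; ring,
      Real.Gamma_nat_eq_factorial] at h
    have h2 : ∀ ξ : ℂ, ((starRingEnd ℂ) ξ) ^ a * ξ ^ a * (Real.exp (-‖ξ‖ ^ 2) : ℂ) =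
        ((‖ξ‖ ^ (2 * a) * Real.exp (-‖ξ‖ ^ (2 : ℝ)) : ℝ) : ℂ) := by
      intro ξ
      rw [← mul_pow, Complex.conj_mul', ← pow_mul]
      rw [show ((2 : ℝ)) = ((2 : ℕ) : ℝ) by norm_num, Real.rpow_natCast]
      push_cast; rfl
    simp_rw [h2]
    rw [integral_complex_ofReal, h]
    push_cast
    ring
  · -- rotate by the angle `π / (b - a)`, which multiplies the integrand by `-1`
    have hba : ((b : ℝ) - a) ≠ 0 := sub_ne_zero.2 (by exact_mod_cast Ne.symm hab)
    let t : ℝ := Real.pi / (b - a)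
    let e : ℂ ≃ₗᵢ[ℝ] ℂ := rotation (Circle.exp t)
    have he : MeasurePreserving e volume volume := e.measurePreserving
    have h1 := he.integral_comp e.toHomeomorph.measurableEmbedding
      (fun ξ : ℂ => ((starRingEnd ℂ) ξ) ^ a * ξ ^ b * (Real.exp (-‖ξ‖ ^ 2) : ℂ))
    have key : ((starRingEnd ℂ) (Circle.exp t : ℂ)) ^ a * (Circle.exp t : ℂ) ^ b = -1 := by
      rw [Circle.coe_exp, ← Complex.exp_conj, ← Complex.exp_nat_mul, ← Complex.exp_nat_mul,
        ← Complex.exp_add, ← Complex.exp_pi_mul_I]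
      congr 1
      have hba' : ((b : ℂ) - a) ≠ 0 := by exact_mod_cast hba
      simp [t]
      field_simp
      ring
    have h2 : ∀ ξ : ℂ, ((starRingEnd ℂ) (e ξ)) ^ a * (e ξ) ^ b * (Real.exp (-‖e ξ‖ ^ 2) : ℂ) =
        -(((starRingEnd ℂ) ξ) ^ a * ξ ^ b * (Real.exp (-‖ξ‖ ^ 2) : ℂ)) := by
      intro ξ
      rw [e.norm_map, rotation_apply, map_mul, mul_pow, mul_pow]
      linear_combination ((starRingEnd ℂ) ξ) ^ a * ξ ^ b * (Real.exp (-‖ξ‖ ^ 2) : ℂ) * key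
    simp_rw [h2] at h1
    rw [integral_neg] at h1
    exact self_eq_neg.1 h1.symm

/-- Lebesgue measure on `Fin n → ℂ` and on the Euclidean space `ℂⁿ` agree up to a constant. The
constant is `1`, as comparison of Gaussian integrals shows in `gaussian_moment`. -/
lemma exists_integral_toLp (n : ℕ) : ∃ c : ℂ, ∀ F : Cn n → ℂ,
    ∫ v : Fin n → ℂ, F (WithLp.toLp 2 v) = c * ∫ x, F x := by
  let e : (Fin n → ℂ) ≃L[ℝ] Cn n := (PiLp.continuousLinearEquiv 2 ℝ fun _ : Fin n => ℂ).symm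
  have : (Measure.map e (volume : Measure (Fin n → ℂ))).IsAddHaarMeasure :=
    e.isAddHaarMeasure_map _
  obtain ⟨c, h⟩ : ∃ c : NNReal, Measure.map e (volume : Measure (Fin n → ℂ)) =
      c • (volume : Measure (Cn n)) := ⟨_, Measure.isAddLeftInvariant_eq_smul _ _⟩
  refine ⟨(c : ℝ), fun F => ?_⟩
  have h1 : ∫ v : Fin n → ℂ, F (WithLp.toLp 2 v) =
      ∫ x, F x ∂(Measure.map e (volume : Measure (Fin n → ℂ))) :=
    (e.toHomeomorph.measurableEmbedding.integral_map F).symm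
  rw [h1, h, integral_smul_nnreal_measure]
  rfl

lemma gaussian_product {n : ℕ} (v : Fin n → ℂ) :
    (Real.exp (-‖(WithLp.toLp 2 v : Cn n)‖ ^ 2) : ℂ) = ∏ j, (Real.exp (-‖v j‖ ^ 2) : ℂ) := by
  rw [EuclideanSpace.norm_sq_eq, ← Finset.sum_neg_distrib, Real.exp_sum]
  push_cast
  rfl

/-- The Gaussian moments on the product space, by the multinomial theorem. -/
lemma gaussian_moment_pi {n : ℕ} (p q : Cn n) (N N' : ℕ) :
    ∫ v : Fin n → ℂ, herm p (WithLp.toLp 2 v) ^ N * herm (WithLp.toLp 2 v) q ^ N' *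
      (Real.exp (-‖(WithLp.toLp 2 v : Cn n)‖ ^ 2) : ℂ) =
      if N = N' then (Real.pi : ℂ) ^ n * N.factorial * herm p q ^ N else 0 := by
  classical
  let T : (Fin n → ℕ) → (Fin n → ℕ) → (Fin n → ℂ) → ℂ := fun a b v =>
    ∏ j, ((p j) ^ a j * ((starRingEnd ℂ) (q j)) ^ b j *
      (((starRingEnd ℂ) (v j)) ^ a j * (v j) ^ b j * (Real.exp (-‖v j‖ ^ 2) : ℂ)))
  have hT : ∀ v : Fin n → ℂ, herm p (WithLp.toLp 2 v) ^ N * herm (WithLp.toLp 2 v) q ^ N' *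
      (Real.exp (-‖(WithLp.toLp 2 v : Cn n)‖ ^ 2) : ℂ) =
      ∑ a ∈ Finset.univ.piAntidiag N, ∑ b ∈ Finset.univ.piAntidiag N',
        ((Nat.multinomial Finset.univ a : ℂ) * (Nat.multinomial Finset.univ b : ℂ)) * T a b v := by
    intro v
    rw [gaussian_product, herm, herm, Finset.sum_pow_eq_sum_piAntidiag,
      Finset.sum_pow_eq_sum_piAntidiag, Finset.sum_mul_sum, Finset.sum_mul]
    refine Finset.sum_congr rfl fun a _ => ?_
    rw [Finset.sum_mul]
    refine Finset.sum_congr rfl fun b _ => ?_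
    simp only [T, Finset.prod_mul_distrib, mul_pow]
    ring
  have hint1 : ∀ a b : Fin n → ℕ, ∀ j, Integrable fun ξ : ℂ =>
      (p j) ^ a j * ((starRingEnd ℂ) (q j)) ^ b j *
        (((starRingEnd ℂ) ξ) ^ a j * ξ ^ b j * (Real.exp (-‖ξ‖ ^ 2) : ℂ)) := fun a b j =>
    (integrable_pow_mul_conj_pow_mul_gaussian (a j) (b j)).const_mul _
  have hTint : ∀ a b, Integrable (T a b) := fun a b => Integrable.fintype_prod (hint1 a b)
  have hTval : ∀ a b, ∫ v, T a b v = if a = b then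
      (Real.pi : ℂ) ^ n * ((∏ j, (a j).factorial : ℕ) : ℂ) *
        ∏ j, (p j * (starRingEnd ℂ) (q j)) ^ a j else 0 := by
    intro a b
    have h1 := integral_fintype_prod_volume_eq_prod (fun (j : Fin n) (ξ : ℂ) =>
      (p j) ^ a j * ((starRingEnd ℂ) (q j)) ^ b j *
        (((starRingEnd ℂ) ξ) ^ a j * ξ ^ b j * (Real.exp (-‖ξ‖ ^ 2) : ℂ)))
    refine h1.trans ?_
    simp_rw [integral_const_mul, integral_conj_pow_mul_pow_mul_gaussian]
    split_ifs with hab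
    · subst hab
      simp only [if_true, Finset.prod_mul_distrib, Finset.prod_const, Finset.card_univ,
        Fintype.card_fin, mul_pow]
      push_cast
      ring
    · obtain ⟨j, hj⟩ := Function.ne_iff.1 hab
      exact Finset.prod_eq_zero (Finset.mem_univ j) (by simp [hj])
  simp_rw [hT]
  rw [integral_finsetSum _ fun a _ => integrable_finsetSum _ fun b _ => (hTint a b).const_mul _]
  simp_rw [integral_finsetSum _ fun b _ => (hTint _ b).const_mul _, integral_const_mul, hTval]
  split_ifs with hN
  · subst hN
    rw [herm, Finset.sum_pow_eq_sum_piAntidiag, Finset.mul_sum]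
    refine Finset.sum_congr rfl fun a ha => ?_
    rw [Finset.sum_eq_single_of_mem a ha fun b _ hb => by simp [hb.symm]]
    rw [if_pos rfl]
    have hspec := Nat.multinomial_spec (Finset.univ : Finset (Fin n)) a
    rw [(Finset.mem_piAntidiag.1 ha).1] at hspec
    rw [← hspec]
    push_cast
    ring
  · refine Finset.sum_eq_zero fun a ha => Finset.sum_eq_zero fun b hb => ?_
    rw [if_neg, mul_zero]
    rintro rfl
    exact hN ((Finset.mem_piAntidiag.1 ha).1.symm.trans (Finset.mem_piAntidiag.1 hb).1)

lemma finrank_Cn (n : ℕ) : Module.finrank ℝ (Cn n) = 2 * n := by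
  have e : Module.finrank ℝ (Fin n → ℂ) = Module.finrank ℝ (Cn n) :=
    (PiLp.continuousLinearEquiv 2 ℝ fun _ : Fin n => ℂ).symm.toLinearEquiv.finrank_eq
  rw [← e, Module.finrank_pi_fintype]
  simp [mul_comm]

lemma integral_gaussian_Cn (n : ℕ) :
    ∫ x : Cn n, (Real.exp (-‖x‖ ^ 2) : ℂ) = (Real.pi : ℂ) ^ n := by
  have h := GaussianFourier.integral_rexp_neg_mul_sq_norm (V := Cn n) (b := 1) one_pos
  rw [finrank_Cn] at h
  have e : ((2 * n : ℕ) : ℝ) / 2 = n := by push_cast; ring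
  rw [e, Real.rpow_natCast, div_one] at h
  rw [integral_complex_ofReal, ← Complex.ofReal_pow, ← h]
  simp

/-- The Gaussian moments on `ℂⁿ`. -/
lemma gaussian_moment {n : ℕ} (p q : Cn n) (N N' : ℕ) :
    ∫ x : Cn n, herm p x ^ N * herm x q ^ N' * (Real.exp (-‖x‖ ^ 2) : ℂ) =
      if N = N' then (Real.pi : ℂ) ^ n * N.factorial * herm p q ^ N else 0 := by
  obtain ⟨c, hc⟩ := exists_integral_toLp n
  -- the case of exponents `0` shows that the two normalizations of Lebesgue measure agree
  have h0 := gaussian_moment_pi (0 : Cn n) 0 0 0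
  have h1 := hc fun x => (Real.exp (-‖x‖ ^ 2) : ℂ)
  simp only [pow_zero, one_mul, if_true, Nat.factorial_zero, Nat.cast_one, mul_one] at h0
  rw [h0, integral_gaussian_Cn] at h1
  have hpi : (Real.pi : ℂ) ^ n ≠ 0 := pow_ne_zero _ (by exact_mod_cast Real.pi_ne_zero)
  have hc1 : c = 1 := by
    have : c * (Real.pi : ℂ) ^ n = 1 * (Real.pi : ℂ) ^ n := by rw [← h1, one_mul]
    exact mul_right_cancel₀ hpi this
  rw [← gaussian_moment_pi p q N N',
    hc fun x => herm p x ^ N * herm x q ^ N' * (Real.exp (-‖x‖ ^ 2) : ℂ), hc1, one_mul]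

lemma integral_volumeIoiPow_gaussian (m D : ℕ) :
    ∫ r : Set.Ioi (0 : ℝ), (((r : ℝ) ^ D * Real.exp (-(r : ℝ) ^ 2) : ℝ) : ℂ)
      ∂(Measure.volumeIoiPow m) = ((Real.Gamma ((m + D + 1) / 2) / 2 : ℝ) : ℂ) := by
  rw [integral_complex_ofReal]
  congr 1
  simp only [Measure.volumeIoiPow, ENNReal.ofReal]
  rw [integral_withDensity_eq_integral_smul
      ((measurable_subtype_coe.pow_const _).real_toNNReal),
    integral_subtype_comap measurableSet_Ioi
      fun a : ℝ => Real.toNNReal (a ^ m) • (a ^ D * Real.exp (-a ^ 2))]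
  have h := integral_rpow_mul_exp_neg_rpow (p := 2) (q := ((m + D : ℕ) : ℝ)) (by norm_num)
    (lt_of_lt_of_le (by norm_num) (Nat.cast_nonneg _))
  rw [show Real.Gamma ((m + D + 1) / 2) / 2 = 1 / 2 * Real.Gamma ((((m + D : ℕ) : ℝ) + 1) / 2) by
    push_cast; ring, ← h]
  refine setIntegral_congr_fun measurableSet_Ioi fun x hx => ?_
  simp only [NNReal.smul_def, Real.coe_toNNReal _ (pow_nonneg (Set.mem_Ioi.1 hx).le m), smul_eq_mul,
    Real.rpow_natCast]
  rw [show ((2 : ℝ)) = ((2 : ℕ) : ℝ) by norm_num, Real.rpow_natCast]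
  ring

/-- Integration of a homogeneous function against the Gaussian, in polar coordinates. -/
lemma integral_homogeneous_gaussian {n : ℕ} (hn : 1 ≤ n) {H : Cn n → ℂ} (D : ℕ)
    (hH : ∀ (r : ℝ) (x : Cn n), 0 < r → H (r • x) = (r : ℂ) ^ D * H x) :
    ∫ x : Cn n, H x * (Real.exp (-‖x‖ ^ 2) : ℂ) =
      (∫ ζ : unitSphere n, H ζ ∂(surfaceMeasure n)) *
        ((Real.Gamma (n + D / 2) / 2 : ℝ) : ℂ) := by
  have : Nontrivial (Cn n) := Module.nontrivial_of_finrank_pos (R := ℝ) (by rw [finrank_Cn]; omega)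
  have h1 : ∫ x : Cn n, H x * (Real.exp (-‖x‖ ^ 2) : ℂ) =
      ∫ x : ({(0)}ᶜ : Set (Cn n)), H x * (Real.exp (-‖(x : Cn n)‖ ^ 2) : ℂ)
        ∂(Measure.comap (↑) (volume : Measure (Cn n))) := by
    rw [integral_subtype_comap (measurableSet_singleton _).compl
      fun x : Cn n => H x * (Real.exp (-‖x‖ ^ 2) : ℂ), restrict_compl_singleton]
  have h2 := (volume : Measure (Cn n)).measurePreserving_homeomorphUnitSphereProd.integral_comp
    (Homeomorph.measurableEmbedding _)
    (fun y : unitSphere n × Set.Ioi (0 : ℝ) =>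
      H y.1 * (((y.2 : ℝ) ^ D * Real.exp (-(y.2 : ℝ) ^ 2) : ℝ) : ℂ))
  rw [h1]
  refine Eq.trans ?_ (h2.trans ?_)
  · refine integral_congr_ae (Eventually.of_forall fun x => ?_)
    have hx : 0 < ‖(x : Cn n)‖ := norm_pos_iff.2 x.2
    have hx' : (x : Cn n) = ‖(x : Cn n)‖ • ((homeomorphUnitSphereProd (Cn n) x).1 : Cn n) := by
      simp [smul_smul, hx.ne']
    simp only [homeomorphUnitSphereProd_apply_snd_coe]
    conv_lhs => rw [hx', hH _ _ hx, ← hx']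
    push_cast
    ring
  · refine (integral_prod_mul (fun ζ : unitSphere n => H ζ) (fun r : Set.Ioi (0 : ℝ) =>
      (((r : ℝ) ^ D * Real.exp (-(r : ℝ) ^ 2) : ℝ) : ℂ))).trans ?_
    rw [integral_volumeIoiPow_gaussian, finrank_Cn]
    have e : (((2 * n - 1 : ℕ) : ℝ) + D + 1) / 2 = n + D / 2 := by
      rw [Nat.cast_sub (by omega)]; push_cast; ring
    rw [e]
    rfl

lemma herm_smul_left {n : ℕ} (c : ℂ) (z w : Cn n) : herm (c • z) w = c * herm z w := by
  rw [herm_eq_inner, herm_eq_inner, inner_smul_right]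

lemma herm_smul_right {n : ℕ} (c : ℂ) (z w : Cn n) :
    herm z (c • w) = (starRingEnd ℂ) c * herm z w := by
  rw [herm_eq_inner, herm_eq_inner, inner_smul_left]

lemma herm_add_left {n : ℕ} (z z' w : Cn n) : herm (z + z') w = herm z w + herm z' w := by
  simp only [herm_eq_inner, inner_add_right]

lemma herm_add_right {n : ℕ} (z w w' : Cn n) : herm z (w + w') = herm z w + herm z w' := by
  simp only [herm_eq_inner, inner_add_left]

lemma real_smul_eq {n : ℕ} (r : ℝ) (z : Cn n) : r • z = (r : ℂ) • z := by
  ext; simp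

lemma poch_mul_Gamma {n : ℕ} (hn : 1 ≤ n) (N : ℕ) :
    poch n N * Complex.Gamma n = Complex.Gamma (n + N) := by
  induction N with
  | zero => simp [poch]
  | succ N ih =>
    have h0 : (n : ℂ) + N ≠ 0 := by exact_mod_cast (by omega : n + N ≠ 0)
    rw [poch, Finset.prod_range_succ, ← poch, mul_right_comm, ih, Nat.cast_add, Nat.cast_one,
      ← add_assoc, Complex.Gamma_add_one _ h0, mul_comm]

lemma Gamma_nat_ne_zero {n : ℕ} (hn : 1 ≤ n) : Complex.Gamma n ≠ 0 :=
  Complex.Gamma_ne_zero_of_re_pos (by simpa using Nat.pos_of_ne_zero (by omega))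

lemma poch_ne_zero {n : ℕ} (hn : 1 ≤ n) (N : ℕ) : poch n N ≠ 0 := by
  refine Finset.prod_ne_zero_iff.2 fun i _ => ?_
  exact_mod_cast (by omega : n + i ≠ 0)

/-- The reproducing formula for homogeneous holomorphic polynomials, polarized. It follows from the
Gaussian moments by integration in polar coordinates. -/
lemma sphere_moment {n : ℕ} (hn : 1 ≤ n) (p q : Cn n) (N N' : ℕ) :
    invMass n * ∫ ζ : unitSphere n, herm p ζ ^ N * herm (ζ : Cn n) q ^ N' ∂(surfaceMeasure n) =
      if N = N' then N.factorial / poch n N * herm p q ^ N else 0 := by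
  have h := integral_homogeneous_gaussian hn (H := fun x => herm p x ^ N * herm x q ^ N') (N + N')
    (fun r x _ => by
      rw [real_smul_eq, herm_smul_left, herm_smul_right, Complex.conj_ofReal]
      ring)
  rw [gaussian_moment] at h
  have hpi : (Real.pi : ℂ) ^ n ≠ 0 := pow_ne_zero _ (by exact_mod_cast Real.pi_ne_zero)
  have hΓ := Gamma_nat_ne_zero hn
  have hpos : (0 : ℝ) < n + ((N + N' : ℕ) : ℝ) / 2 := by
    have : (1 : ℝ) ≤ n := by exact_mod_cast hn
    positivity
  split_ifs at h ⊢ with hN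
  · subst hN
    have e : (n : ℝ) + ((N + N : ℕ) : ℝ) / 2 = ((n + N : ℕ) : ℝ) := by push_cast; ring
    rw [e, Complex.ofReal_div, ← Complex.Gamma_ofReal] at h
    have h2 := poch_mul_Gamma hn N
    rw [invMass]
    have hp := poch_ne_zero hn N
    push_cast at h h2
    rw [← h2] at h
    field_simp
    linear_combination -2 * h
  · have hG : ((Real.Gamma (n + ((N + N' : ℕ) : ℝ) / 2) / 2 : ℝ) : ℂ) ≠ 0 := by
      exact_mod_cast (div_pos (Real.Gamma_pos_of_pos hpos) two_pos).ne'
    rw [(mul_eq_zero.1 h.symm).resolve_right hG, mul_zero]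

/-! ### The series `FD₁` as a sum of mixed moments -/

/-- Comparison of coefficients in an identity of polynomial functions. -/
lemma coeff_eq_of_sum_eq {N : ℕ} {A B : ℕ → ℂ}
    (h : ∀ s : ℂ, ∑ a ∈ Finset.range (N + 1), A a * s ^ a =
      ∑ a ∈ Finset.range (N + 1), B a * s ^ a) {a : ℕ} (ha : a ≤ N) : A a = B a := by
  have hp : ∑ a ∈ Finset.range (N + 1), Polynomial.monomial a (A a) =
      ∑ a ∈ Finset.range (N + 1), Polynomial.monomial a (B a) := by
    refine Polynomial.funext fun s => ?_
    simpa [Polynomial.eval_finsetSum] using h s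
  have := congrArg (fun p => Polynomial.coeff p a) hp
  simpa [Polynomial.finsetSum_coeff, Polynomial.coeff_monomial, Nat.lt_succ_of_le ha] using this

/-- The mixed moments `∫ ⟨z, ζ⟩ᵃ ⟨w, ζ⟩ᵇ ⟨ζ, z⟩ᶜ ⟨ζ, w⟩ᵈ dσ(ζ)`. -/
def mixedMoment {n : ℕ} (z w : Cn n) (a b c d : ℕ) : ℂ :=
  ∫ ζ : unitSphere n, herm z ζ ^ a * herm w ζ ^ b * (herm (ζ : Cn n) z ^ c * herm (ζ : Cn n) w ^ d)
    ∂(surfaceMeasure n)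

lemma continuous_herm_left {n : ℕ} (z : Cn n) : Continuous fun ζ : unitSphere n => herm z ζ := by
  simp_rw [herm_eq_inner]; fun_prop

lemma continuous_herm_right {n : ℕ} (z : Cn n) :
    Continuous fun ζ : unitSphere n => herm (ζ : Cn n) z := by
  simp_rw [herm_eq_inner]; fun_prop

lemma integrable_of_continuous {n : ℕ} {G : Type*} [NormedAddCommGroup G] {f : unitSphere n → G}
    (hf : Continuous f) : Integrable f (surfaceMeasure n) := by
  rw [← integrableOn_univ]
  exact hf.continuousOn.integrableOn_compact isCompact_univ

/-- Expanding the polarized moment formula at `p = s z + w` and `q = t̄ z + w` in powers of `s` and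
`t` yields the generating function of the mixed moments. -/
lemma sum_mixedMoment {n : ℕ} (hn : 1 ≤ n) (z w : Cn n) (a b N' : ℕ) (t : ℂ) :
    ∑ c ∈ Finset.range (N' + 1),
        ((N'.choose c : ℂ) * (invMass n * mixedMoment z w a b c (N' - c))) * t ^ c =
      if a + b = N' then ((a + b).factorial / poch n (a + b) : ℂ) *
        ((t * herm z z + herm z w) ^ a * (t * herm w z + herm w w) ^ b) else 0 := by
  have key : ∀ s : ℂ, ∑ a' ∈ Finset.range (a + b + 1), (((a + b).choose a' : ℂ) *
      ∑ c ∈ Finset.range (N' + 1), ((N'.choose c : ℂ) *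
        (invMass n * mixedMoment z w a' (a + b - a') c (N' - c))) * t ^ c) * s ^ a' =
      ∑ a' ∈ Finset.range (a + b + 1), (((a + b).choose a' : ℂ) *
        (if a + b = N' then ((a + b).factorial / poch n (a + b) : ℂ) *
        ((t * herm z z + herm z w) ^ a' * (t * herm w z + herm w w) ^ (a + b - a')) else 0)) *
          s ^ a' := by
    intro s
    have h := sphere_moment hn (s • z + w) ((starRingEnd ℂ) t • z + w) (a + b) N'
    have hpt : ∀ ζ : unitSphere n, herm (s • z + w) ζ ^ (a + b) *
        herm (ζ : Cn n) ((starRingEnd ℂ) t • z + w) ^ N' =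
        ∑ a' ∈ Finset.range (a + b + 1), ∑ c ∈ Finset.range (N' + 1),
          ((a + b).choose a' * N'.choose c * t ^ c * s ^ a' : ℂ) *
          (herm z ζ ^ a' * herm w ζ ^ (a + b - a') *
            (herm (ζ : Cn n) z ^ c * herm (ζ : Cn n) w ^ (N' - c))) := by
      intro ζ
      rw [herm_add_left, herm_add_right, herm_smul_left, herm_smul_right, Complex.conj_conj,
        add_pow, add_pow, Finset.sum_mul_sum]
      refine Finset.sum_congr rfl fun a' _ => Finset.sum_congr rfl fun c _ => ?_
      ring
    have hint : ∀ a' c, Integrable (fun ζ : unitSphere n =>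
        ((a + b).choose a' * N'.choose c * t ^ c * s ^ a' : ℂ) *
          (herm z ζ ^ a' * herm w ζ ^ (a + b - a') *
            (herm (ζ : Cn n) z ^ c * herm (ζ : Cn n) w ^ (N' - c)))) (surfaceMeasure n) := by
      intro a' c
      have h1 := continuous_herm_left z
      have h2 := continuous_herm_left w
      have h3 := continuous_herm_right z
      have h4 := continuous_herm_right w
      exact integrable_of_continuous (by fun_prop)
    simp_rw [hpt] at h
    rw [integral_finsetSum _ fun a' _ => integrable_finsetSum _ fun c _ => hint a' c] at h
    simp_rw [integral_finsetSum _ fun c _ => hint _ c, integral_const_mul] at h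
    trans invMass n * ∑ a' ∈ Finset.range (a + b + 1), ∑ c ∈ Finset.range (N' + 1),
        ((a + b).choose a' * N'.choose c * t ^ c * s ^ a' : ℂ) *
          mixedMoment z w a' (a + b - a') c (N' - c)
    · rw [Finset.mul_sum]
      refine Finset.sum_congr rfl fun a' _ => ?_
      rw [Finset.mul_sum, Finset.mul_sum, Finset.sum_mul]
      exact Finset.sum_congr rfl fun c _ => by ring
    · refine Eq.trans h ?_
      split_ifs with hN
      · have e : herm (s • z + w) ((starRingEnd ℂ) t • z + w) =
            s * (t * herm z z + herm z w) + (t * herm w z + herm w w) := by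
          rw [herm_add_left, herm_add_right, herm_add_right, herm_smul_left, herm_smul_left,
            herm_smul_right, herm_smul_right, Complex.conj_conj]
          ring
        rw [e, add_pow, Finset.mul_sum]
        exact Finset.sum_congr rfl fun a' _ => by rw [mul_pow]; ring
      · simp
  have h := coeff_eq_of_sum_eq key (Nat.le_add_right a b)
  rw [Nat.add_sub_cancel_left] at h
  refine mul_left_cancel₀ ?_ h
  exact_mod_cast (Nat.choose_pos (Nat.le_add_right a b)).ne'

/-- Unbalanced mixed moments vanish. -/
lemma mixedMoment_eq_zero {n : ℕ} (hn : 1 ≤ n) (z w : Cn n) {a b c d : ℕ} (h : a + b ≠ c + d) :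
    invMass n * mixedMoment z w a b c d = 0 := by
  have key : ∀ t : ℂ, ∑ c' ∈ Finset.range (c + d + 1),
      (((c + d).choose c' : ℂ) * (invMass n * mixedMoment z w a b c' (c + d - c'))) * t ^ c' =
      ∑ c' ∈ Finset.range (c + d + 1), (fun _ => (0 : ℂ)) c' * t ^ c' := by
    intro t
    rw [sum_mixedMoment hn, if_neg h]
    simp
  have h1 := coeff_eq_of_sum_eq key (Nat.le_add_right c d)
  rw [Nat.add_sub_cancel_left] at h1
  refine (mul_eq_zero.1 h1).resolve_left ?_
  exact_mod_cast (Nat.choose_pos (Nat.le_add_right c d)).ne'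

/-- The balanced mixed moments, read off from the generating function. -/
lemma choose_mul_mixedMoment {n : ℕ} (hn : 1 ≤ n) (z w : Cn n) {a b c d : ℕ} (h : a + b = c + d) :
    ((c + d).choose c : ℂ) * (invMass n * mixedMoment z w a b c d) =
      ((a + b).factorial / poch n (a + b) : ℂ) *
        ∑ p ∈ (Finset.range (a + 1) ×ˢ Finset.range (b + 1)) with p.1 + p.2 = c,
          (a.choose p.1 : ℂ) * (b.choose p.2 : ℂ) * (herm z z ^ p.1 * herm z w ^ (a - p.1)) *
            (herm w z ^ p.2 * herm w w ^ (b - p.2)) := by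
  set Q : ℕ × ℕ → ℂ := fun p =>
    (a.choose p.1 : ℂ) * (b.choose p.2 : ℂ) * (herm z z ^ p.1 * herm z w ^ (a - p.1)) *
            (herm w z ^ p.2 * herm w w ^ (b - p.2)) with hQ
  have key : ∀ t : ℂ, ∑ c' ∈ Finset.range (c + d + 1),
      (((c + d).choose c' : ℂ) * (invMass n * mixedMoment z w a b c' (c + d - c'))) * t ^ c' =
      ∑ c' ∈ Finset.range (c + d + 1), (fun c' => ((a + b).factorial / poch n (a + b) : ℂ) *
        ∑ p ∈ (Finset.range (a + 1) ×ˢ Finset.range (b + 1)) with p.1 + p.2 = c', Q p) c' *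
          t ^ c' := by
    intro t
    rw [sum_mixedMoment hn, if_pos h]
    simp_rw [mul_assoc _ _ (t ^ _)]
    rw [← Finset.mul_sum]
    congr 1
    have hmaps : ∀ p ∈ Finset.range (a + 1) ×ˢ Finset.range (b + 1),
        p.1 + p.2 ∈ Finset.range (c + d + 1) := by
      intro p hp
      simp only [Finset.mem_product, Finset.mem_range] at hp ⊢
      omega
    trans ∑ p ∈ Finset.range (a + 1) ×ˢ Finset.range (b + 1), Q p * t ^ (p.1 + p.2)
    · rw [add_pow, add_pow, Finset.sum_mul_sum, Finset.sum_product]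
      refine Finset.sum_congr rfl fun i _ => Finset.sum_congr rfl fun j _ => ?_
      simp only [hQ]
      ring
    · rw [← Finset.sum_fiberwise_of_maps_to hmaps]
      refine Finset.sum_congr rfl fun c' _ => ?_
      rw [Finset.sum_mul]
      refine Finset.sum_congr rfl fun p hp => ?_
      rw [(Finset.mem_filter.1 hp).2]
  have h1 := coeff_eq_of_sum_eq key (Nat.le_add_right c d)
  rwa [Nat.add_sub_cancel_left] at h1

/-- The coefficients `(n)ₖ / k!` of the binomial series of `(1 - x)⁻ⁿ`. -/
def binomCoeff (n k : ℕ) : ℂ := poch n k / k.factorial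

lemma poch_eq_ascFactorial (n k : ℕ) : poch n k = (n.ascFactorial k : ℂ) := by
  rw [poch, Nat.ascFactorial_eq_prod_range]
  push_cast
  rfl

lemma hasSum_binomCoeff {n : ℕ} (hn : 1 ≤ n) {x : ℂ} (hx : ‖x‖ < 1) :
    HasSum (fun k => binomCoeff n k * x ^ k) (((1 - x)⁻¹) ^ n) := by
  obtain ⟨m, rfl⟩ : ∃ m, n = m + 1 := ⟨n - 1, by omega⟩
  have h := hasSum_choose_mul_geometric_of_norm_lt_one m hx
  rw [one_div, ← inv_pow] at h
  refine h.congr_fun fun k => ?_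
  rw [binomCoeff, poch_eq_ascFactorial, Nat.ascFactorial_eq_factorial_mul_choose, Nat.cast_mul,
    mul_div_cancel_left₀ _ (by exact_mod_cast k.factorial_ne_zero), add_comm k m,
    Nat.choose_symm_add]

lemma summable_norm_binomCoeff {n : ℕ} (hn : 1 ≤ n) {r : ℝ} (h0 : 0 ≤ r) (hr : r < 1) :
    Summable fun k => ‖binomCoeff n k‖ * r ^ k := by
  have h := (hasSum_binomCoeff hn (x := (r : ℂ)) (by simpa [abs_of_nonneg h0] using hr)).summable
  refine (summable_norm_iff.2 h).congr fun k => ?_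
  rw [norm_mul, norm_pow, Complex.norm_real, Real.norm_of_nonneg h0]

lemma hasSum_mul_of_summable_norm {α β : Type*} {f : α → ℂ} {g : β → ℂ} {F G : ℂ}
    (hf : HasSum f F) (hf' : Summable fun a => ‖f a‖) (hg : HasSum g G)
    (hg' : Summable fun b => ‖g b‖) : HasSum (fun p : α × β => f p.1 * g p.2) (F * G) :=
  hf.mul hg (summable_mul_of_summable_norm hf' hg')

/-- The exponents `(i₁ + i₂, j₁ + j₂, i₁ + j₁, i₂ + j₂)` of `⟨z, ζ⟩`, `⟨w, ζ⟩`, `⟨ζ, z⟩`, `⟨ζ, w⟩` in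
the moment to which the term of `FD₁` of index `(i₁, i₂, j₁, j₂)` contributes. -/
def degrees (i : ℕ × ℕ × ℕ × ℕ) : ℕ × ℕ × ℕ × ℕ :=
  (i.1 + i.2.1, i.2.2.1 + i.2.2.2, i.1 + i.2.2.1, i.2.1 + i.2.2.2)

/-- The term, integrated over the sphere, of the fourfold binomial expansion of the product of two
Poisson–Szegő kernels. -/
def kernelTerm {n : ℕ} (z w : Cn n) (y : ℕ × ℕ × ℕ × ℕ) : ℂ :=
  binomCoeff n y.1 * binomCoeff n y.2.1 * (binomCoeff n y.2.2.1 * binomCoeff n y.2.2.2) *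
    (invMass n * mixedMoment z w y.1 y.2.1 y.2.2.1 y.2.2.2)

/-- The terms of `FD₁` whose index has given degrees add up to one term of the expansion of the
integral of two Poisson–Szegő kernels. -/
lemma hasSum_fiber_FD1term {n : ℕ} (hn : 1 ≤ n) (z w : Cn n) (y : ℕ × ℕ × ℕ × ℕ) :
    HasSum (fun i : {i // degrees i = y} => FD1term n n n n n
      ((‖z‖ : ℂ) ^ 2) (herm z w) (herm w z) ((‖w‖ : ℂ) ^ 2) i) (kernelTerm z w y) := by
  obtain ⟨a, b, c, d⟩ := y
  rw [← herm_self, ← herm_self]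
  set f := FD1term n n n n n (herm z z) (herm z w) (herm w z) (herm w w) with hf
  by_cases h : a + b = c + d
  · -- the fibre is parametrized by `(i₁, j₁)` with `i₁ ≤ a`, `j₁ ≤ b` and `i₁ + j₁ = c`
    let S : Finset (ℕ × ℕ) := {p ∈ Finset.range (a + 1) ×ˢ Finset.range (b + 1) | p.1 + p.2 = c}
    let ψ : ℕ × ℕ → ℕ × ℕ × ℕ × ℕ := fun p => (p.1, a - p.1, p.2, b - p.2)
    have hψ : Function.Injective ψ := by
      rintro ⟨i, j⟩ ⟨i', j'⟩ h
      simp only [ψ, Prod.mk.injEq] at h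
      rw [h.1, h.2.2.1]
    have hmem : ∀ i, degrees i = (a, b, c, d) ↔ i ∈ S.image ψ := by
      rintro ⟨i₁, i₂, j₁, j₂⟩
      simp only [degrees, S, ψ, Finset.mem_image, Finset.mem_filter, Finset.mem_product,
        Finset.mem_range, Prod.mk.injEq, Prod.exists]
      constructor
      · rintro ⟨h1, h2, h3, h4⟩
        exact ⟨i₁, j₁, by omega, by omega, by omega, by omega, by omega⟩
      · rintro ⟨i, j, h1, h2, h3, h4, h5⟩
        omega
    have hval : kernelTerm z w (a, b, c, d) = ∑ i ∈ S.image ψ, f i := by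
      rw [Finset.sum_image hψ.injOn]
      have hch := choose_mul_mixedMoment hn z w h
      have hch0 : ((c + d).choose c : ℂ) ≠ 0 := by
        exact_mod_cast (Nat.choose_pos (Nat.le_add_right c d)).ne'
      have hM : invMass n * mixedMoment z w a b c d = ∑ p ∈ S,
          ((a + b).factorial / poch n (a + b) : ℂ) / ((c + d).choose c : ℂ) *
          ((a.choose p.1 : ℂ) * (b.choose p.2 : ℂ) * (herm z z ^ p.1 * herm z w ^ (a - p.1)) *
            (herm w z ^ p.2 * herm w w ^ (b - p.2))) := by
        rw [← Finset.mul_sum, div_mul_eq_mul_div, eq_div_iff hch0, mul_comm]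
        exact hch
      rw [kernelTerm, hM, Finset.mul_sum]
      refine Finset.sum_congr rfl fun p hp => ?_
      obtain ⟨i, j⟩ := p
      simp only [S, Finset.mem_filter, Finset.mem_product, Finset.mem_range] at hp
      obtain ⟨i₂, rfl⟩ : ∃ i₂, a = i + i₂ := ⟨a - i, by omega⟩
      obtain ⟨j₂, rfl⟩ : ∃ j₂, b = j + j₂ := ⟨b - j, by omega⟩
      obtain rfl : c = i + j := hp.2.symm
      obtain rfl : d = i₂ + j₂ := by omega
      have hp0 := poch_ne_zero hn (i + i₂ + (j + j₂))
      have e : i + j + (i₂ + j₂) = i + i₂ + (j + j₂) := by omega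
      have e2 : i + i₂ + j + j₂ = i + i₂ + (j + j₂) := by omega
      have ch : ∀ k l : ℕ, ((k + l).choose k : ℂ) =
          (k + l).factorial / (k.factorial * l.factorial) := fun k l => by
        rw [Nat.cast_choose ℂ (Nat.le_add_right k l), Nat.add_sub_cancel_left]
      have ch' : ((i + i₂ + (j + j₂)).choose (i + j) : ℂ) =
          (i + i₂ + (j + j₂)).factorial / ((i + j).factorial * (i₂ + j₂).factorial) := by
        rw [← e, ch]
      have hfac : ∀ k : ℕ, (k.factorial : ℂ) ≠ 0 := fun k => by
        exact_mod_cast k.factorial_ne_zero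
      simp only [hf, FD1term, ψ, binomCoeff, Nat.add_sub_cancel_left, ch, ch', e, e2]
      have := hfac i; have := hfac j; have := hfac i₂; have := hfac j₂
      have := hfac (i + i₂); have := hfac (j + j₂); have := hfac (i + j); have := hfac (i₂ + j₂)
      have := hfac (i + i₂ + (j + j₂))
      field_simp
    rw [hval]
    have := (S.image ψ).hasSum f
    exact (Equiv.subtypeEquivRight hmem).hasSum_iff.2 this
  · have hempty : IsEmpty {i // degrees i = (a, b, c, d)} := by
      refine ⟨fun ⟨⟨i₁, i₂, j₁, j₂⟩, hi⟩ => h ?_⟩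
      simp only [degrees, Prod.mk.injEq] at hi
      omega
    rw [kernelTerm, mixedMoment_eq_zero hn z w h, mul_zero]
    exact hasSum_empty

/-! ### The integral of two Poisson–Szegő kernels -/

/-- The four binomial series may be multiplied and integrated term by term over the sphere, with
absolute convergence. -/
lemma hasSum_kernelTerm {n : ℕ} (hn : 1 ≤ n) {z w : Cn n} (hz : z ∈ unitBall n)
    (hw : w ∈ unitBall n) :
    (Summable fun y => ‖kernelTerm z w y‖) ∧
    HasSum (kernelTerm z w) (invMass n * ∫ ζ : unitSphere n,
      ((1 - herm z ζ)⁻¹) ^ n * (((1 - herm w ζ)⁻¹) ^ n *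
        (((1 - herm (ζ : Cn n) z)⁻¹) ^ n * ((1 - herm (ζ : Cn n) w)⁻¹) ^ n))
      ∂(surfaceMeasure n)) := by
  let F : ℕ × ℕ × ℕ × ℕ → unitSphere n → ℂ := fun y ζ =>
    (binomCoeff n y.1 * herm z ζ ^ y.1) * ((binomCoeff n y.2.1 * herm w ζ ^ y.2.1) *
      ((binomCoeff n y.2.2.1 * herm (ζ : Cn n) z ^ y.2.2.1) *
        (binomCoeff n y.2.2.2 * herm (ζ : Cn n) w ^ y.2.2.2)))
  -- `F y` is the term of index `y` of the product of the series, and `b y` bounds it on the sphere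
  let β : Cn n → ℕ → ℝ := fun x k => ‖binomCoeff n k‖ * ‖x‖ ^ k
  let b : ℕ × ℕ × ℕ × ℕ → ℝ := fun y => β z y.1 * (β w y.2.1 * (β z y.2.2.1 * β w y.2.2.2))
  have hβ0 : ∀ x k, 0 ≤ β x k := fun x k => by positivity
  have hβ : ∀ {x : Cn n}, x ∈ unitBall n → Summable (β x) := fun hx =>
    summable_norm_binomCoeff hn (norm_nonneg _) (mem_unitBall.1 hx)
  have hb : Summable b :=
    (hβ hz).mul_of_nonneg ((hβ hw).mul_of_nonneg ((hβ hz).mul_of_nonneg (hβ hw) (hβ0 z) (hβ0 w))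
      (hβ0 w) (fun p => mul_nonneg (hβ0 z _) (hβ0 w _))) (hβ0 z)
      (fun p => mul_nonneg (hβ0 w _) (mul_nonneg (hβ0 z _) (hβ0 w _)))
  have hle : ∀ (x : Cn n) (ζ : unitSphere n), ‖herm x ζ‖ ≤ ‖x‖ := fun x ζ => by
    simpa using norm_herm_le x (ζ : Cn n)
  have hle' : ∀ (x : Cn n) (ζ : unitSphere n), ‖herm (ζ : Cn n) x‖ ≤ ‖x‖ := fun x ζ => by
    simpa using norm_herm_le (ζ : Cn n) x
  have hF : ∀ y ζ, ‖F y ζ‖ ≤ b y := by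
    intro y ζ
    simp only [F, b, β, norm_mul, norm_pow]
    gcongr
    exacts [hle z ζ, hle w ζ, hle' z ζ, hle' w ζ]
  have hFc : ∀ y, Continuous (F y) := by
    intro y
    have h1 := continuous_herm_left z
    have h2 := continuous_herm_left w
    have h3 := continuous_herm_right z
    have h4 := continuous_herm_right w
    fun_prop
  have hFi : ∀ y, Integrable (F y) (surfaceMeasure n) := fun y => integrable_of_continuous (hFc y)
  have hnorm : ∀ y, ∫ ζ, ‖F y ζ‖ ∂(surfaceMeasure n) ≤ b y * (surfaceMeasure n).real Set.univ := by
    intro y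
    refine (integral_mono (hFi y).norm (integrable_const (b y)) (hF y)).trans ?_
    simp [mul_comm]
  have hsum : Summable fun y => ∫ ζ, ‖F y ζ‖ ∂(surfaceMeasure n) :=
    Summable.of_nonneg_of_le (fun y => integral_nonneg fun ζ => norm_nonneg _) hnorm
      (hb.mul_right _)
  have hpt : ∀ ζ : unitSphere n, HasSum (fun y => F y ζ)
      (((1 - herm z ζ)⁻¹) ^ n * (((1 - herm w ζ)⁻¹) ^ n *
        (((1 - herm (ζ : Cn n) z)⁻¹) ^ n * ((1 - herm (ζ : Cn n) w)⁻¹) ^ n))) := by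
    intro ζ
    have aux : ∀ {h : ℂ} {x : Cn n}, x ∈ unitBall n → ‖h‖ ≤ ‖x‖ →
        HasSum (fun k => binomCoeff n k * h ^ k) (((1 - h)⁻¹) ^ n) ∧
          Summable fun k => ‖binomCoeff n k * h ^ k‖ := fun hx hh =>
      have h1 := hasSum_binomCoeff hn (hh.trans_lt (mem_unitBall.1 hx))
      ⟨h1, h1.summable.norm⟩
    obtain ⟨a1, a2⟩ := aux hz (hle z ζ)
    obtain ⟨b1, b2⟩ := aux hw (hle w ζ)
    obtain ⟨c1, c2⟩ := aux hz (hle' z ζ)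
    obtain ⟨d1, d2⟩ := aux hw (hle' w ζ)
    have s1 := hasSum_mul_of_summable_norm c1 c2 d1 d2
    have s2 := hasSum_mul_of_summable_norm b1 b2 s1 s1.summable.norm
    have s3 := hasSum_mul_of_summable_norm a1 a2 s2 s2.summable.norm
    refine s3.congr_fun fun y => ?_
    simp only [F]
  have hI : ∀ y, kernelTerm z w y = invMass n * ∫ ζ, F y ζ ∂(surfaceMeasure n) := by
    intro y
    have e : ∀ ζ, F y ζ = binomCoeff n y.1 * binomCoeff n y.2.1 *
        (binomCoeff n y.2.2.1 * binomCoeff n y.2.2.2) * (herm z ζ ^ y.1 * herm w ζ ^ y.2.1 *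
          (herm (ζ : Cn n) z ^ y.2.2.1 * herm (ζ : Cn n) w ^ y.2.2.2)) := fun ζ => by
      simp only [F]; ring
    simp_rw [e]
    rw [integral_const_mul, kernelTerm, mixedMoment]
    ring
  constructor
  · refine Summable.of_nonneg_of_le (fun y => norm_nonneg _) (fun y => ?_)
      (hsum.mul_left ‖invMass n‖)
    rw [hI, norm_mul]
    exact mul_le_mul_of_nonneg_left (norm_integral_le_integral_norm _) (norm_nonneg _)
  · have h := hasSum_integral_of_summable_integral_norm hFi hsum
    simp_rw [fun ζ => (hpt ζ).tsum_eq] at h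
    rw [show kernelTerm z w = fun y => invMass n * ∫ ζ, F y ζ ∂(surfaceMeasure n) from funext hI]
    exact h.mul_left (invMass n)

/-- The series `FD₁` converges absolutely, by comparison with its value at `z = w = ρ e₁`, where
all terms are nonnegative. -/
lemma summable_FD1term {n : ℕ} (hn : 1 ≤ n) {z w : Cn n} (hz : z ∈ unitBall n)
    (hw : w ∈ unitBall n) :
    Summable (FD1term n n n n n ((‖z‖ : ℂ) ^ 2) (herm z w) (herm w z) ((‖w‖ : ℂ) ^ 2)) := by
  let ρ : ℝ := max ‖z‖ ‖w‖
  have hρ0 : 0 ≤ ρ := le_max_of_le_left (norm_nonneg z)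
  have hρ1 : ρ < 1 := max_lt (mem_unitBall.1 hz) (mem_unitBall.1 hw)
  have hzρ : ‖z‖ ≤ ρ := le_max_left _ _
  have hwρ : ‖w‖ ≤ ρ := le_max_right _ _
  let e : Cn n := coordVec ⟨0, hn⟩ (ρ : ℂ)
  have hnorm : ‖e‖ = ρ := by simp [e, abs_of_nonneg hρ0]
  have he : e ∈ unitBall n := mem_unitBall.2 (hnorm.trans_lt hρ1)
  have hee : herm e e = (ρ : ℂ) ^ 2 := by rw [herm_self, hnorm]
  obtain ⟨g, hg⟩ : ∃ g : ℕ × ℕ × ℕ × ℕ → ℝ, g = fun i =>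
    (n.ascFactorial (i.1 + i.2.1) : ℝ) * n.ascFactorial (i.2.2.1 + i.2.2.2) *
      n.ascFactorial (i.1 + i.2.2.1) * n.ascFactorial (i.2.1 + i.2.2.2) /
        n.ascFactorial (i.1 + i.2.1 + i.2.2.1 + i.2.2.2) *
      ((ρ ^ 2) ^ i.1 / i.1.factorial) * ((ρ ^ 2) ^ i.2.1 / i.2.1.factorial) *
      ((ρ ^ 2) ^ i.2.2.1 / i.2.2.1.factorial) * ((ρ ^ 2) ^ i.2.2.2 / i.2.2.2.factorial) := ⟨_, rfl⟩
  have hg0 : ∀ i, 0 ≤ g i := fun i => by rw [hg]; positivity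
  have hgval : ∀ i, FD1term n n n n n ((‖e‖ : ℂ) ^ 2) (herm e e) (herm e e) ((‖e‖ : ℂ) ^ 2) i =
      (g i : ℂ) := by
    rintro ⟨i₁, i₂, j₁, j₂⟩
    simp only [FD1term, hg, hnorm, hee, poch_eq_ascFactorial]
    push_cast
    rfl
  have hgfib : ∀ y, HasSum (fun i : {i // degrees i = y} => g i) ‖kernelTerm e e y‖ := by
    intro y
    have h := hasSum_fiber_FD1term hn e e y
    simp_rw [hgval] at h
    have h1 : HasSum (fun i : {i // degrees i = y} => g i) (kernelTerm e e y).re :=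
      Complex.reCLM.hasSum h
    have h2 := h.unique (Complex.hasSum_ofReal.2 h1)
    have h3 : 0 ≤ (kernelTerm e e y).re := HasSum.nonneg (fun i : {i // degrees i = y} => hg0 i.1) h1
    have h4 : ‖kernelTerm e e y‖ = (kernelTerm e e y).re := by
      conv_lhs => rw [h2]
      rw [Complex.norm_real, Real.norm_of_nonneg h3]
    rwa [h4]
  have hgsum : Summable g := by
    rw [← (Equiv.sigmaFiberEquiv degrees).summable_iff, summable_sigma_of_nonneg]
    · refine ⟨fun y => (hgfib y).summable, ?_⟩
      refine (hasSum_kernelTerm hn he he).1.congr fun y => ?_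
      exact (hgfib y).tsum_eq.symm
    · exact fun i => hg0 _
  refine Summable.of_norm_bounded hgsum ?_
  rintro ⟨i₁, i₂, j₁, j₂⟩
  have hx1 : ‖(‖z‖ : ℂ) ^ 2‖ ≤ ρ ^ 2 := by
    rw [norm_pow, Complex.norm_real, norm_norm]; gcongr
  have hy2 : ‖(‖w‖ : ℂ) ^ 2‖ ≤ ρ ^ 2 := by
    rw [norm_pow, Complex.norm_real, norm_norm]; gcongr
  have hx2 : ‖herm z w‖ ≤ ρ ^ 2 := by
    rw [pow_two]; exact (norm_herm_le z w).trans (by gcongr)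
  have hy1 : ‖herm w z‖ ≤ ρ ^ 2 := by
    rw [pow_two]; exact (norm_herm_le w z).trans (by gcongr)
  simp only [FD1term, hg, poch_eq_ascFactorial, norm_mul, norm_div, Complex.norm_natCast,
    norm_pow (herm z w), norm_pow (herm w z), norm_pow ((‖z‖ : ℂ) ^ 2), norm_pow ((‖w‖ : ℂ) ^ 2)]
  gcongr

/-- The kernel `∫ P(z, ζ) P(w, ζ) dσ(ζ)`, with `P` the Poisson–Szegő kernel. As a function of `w` it
is the Poisson–Szegő integral of `P(z, ·)`. -/
def szego {n : ℕ} (z w : Cn n) : ℂ :=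
  poissonInt (fun ζ => poisson z ζ) w

/-- Summing `FD₁` over the fibres of `degrees` gives the expansion of the integral. -/
lemma szego_eq {n : ℕ} (hn : 1 ≤ n) {z w : Cn n} (hz : z ∈ unitBall n) (hw : w ∈ unitBall n) :
    szego z w = invMass n * (1 - (‖z‖ : ℂ) ^ 2) ^ n * (1 - (‖w‖ : ℂ) ^ 2) ^ n *
      FD1 n n n n n ((‖z‖ : ℂ) ^ 2) (herm z w) (herm w z) ((‖w‖ : ℂ) ^ 2) := by
  have hs := summable_FD1term hn hz hw
  have hFD : FD1 n n n n n ((‖z‖ : ℂ) ^ 2) (herm z w) (herm w z) ((‖w‖ : ℂ) ^ 2) =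
      invMass n * ∫ ζ : unitSphere n,
      ((1 - herm z ζ)⁻¹) ^ n * (((1 - herm w ζ)⁻¹) ^ n *
        (((1 - herm (ζ : Cn n) z)⁻¹) ^ n * ((1 - herm (ζ : Cn n) w)⁻¹) ^ n))
      ∂(surfaceMeasure n) := by
    have h1 := ((Equiv.sigmaFiberEquiv degrees).hasSum_iff.2 hs.hasSum).sigma
      (hasSum_fiber_FD1term hn z w)
    exact h1.unique (hasSum_kernelTerm hn hz hw).2
  rw [hFD, szego, poissonInt, mul_left_comm, ← mul_assoc, ← integral_const_mul]
  refine integral_congr_ae (Eventually.of_forall fun ζ => ?_)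
  simp only [poisson]
  ring

lemma szego_comm {n : ℕ} (z w : Cn n) : szego z w = szego w z := by
  simp only [szego, poissonInt, mul_comm]

lemma poch_zero (a : ℂ) : poch a 0 = 1 := by simp [poch]

/-- The Poisson–Szegő kernel has total mass one: the formula for `szego z w` at `w = 0`. -/
lemma poissonInt_one {n : ℕ} (hn : 1 ≤ n) {z : Cn n} (hz : z ∈ unitBall n) :
    poissonInt (fun _ => 1) z = 1 := by
  have h0 : (0 : Cn n) ∈ unitBall n := by simp
  have h1 := szego_eq hn hz h0
  have hp0 : ∀ ζ : Cn n, poisson (0 : Cn n) ζ = invMass n := fun ζ => by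
    simp [poisson, herm_eq_inner]
  have hm : invMass n ≠ 0 := by
    rw [invMass]
    exact div_ne_zero (Gamma_nat_ne_zero hn)
      (mul_ne_zero two_ne_zero (pow_ne_zero _ (by exact_mod_cast Real.pi_ne_zero)))
  have h2 : szego z 0 = invMass n * poissonInt (fun _ => 1) z := by
    rw [szego_comm, szego, poissonInt, poissonInt, ← integral_const_mul]
    simp [hp0]
  -- with `w = 0` the series `FD₁` reduces to the binomial series of `(1 - |z|²)⁻ⁿ`
  have hx : ‖(‖z‖ : ℂ) ^ 2‖ < 1 := by
    have := mem_unitBall.1 hz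
    rw [norm_pow, Complex.norm_real, norm_norm]
    nlinarith [norm_nonneg z]
  have h3 : FD1 n n n n n ((‖z‖ : ℂ) ^ 2) (herm z 0) (herm 0 z) ((‖(0 : Cn n)‖ : ℂ) ^ 2) =
      ((1 - (‖z‖ : ℂ) ^ 2)⁻¹) ^ n := by
    rw [← (hasSum_binomCoeff hn hx).tsum_eq, FD1]
    let ι : ℕ → ℕ × ℕ × ℕ × ℕ := fun k => (k, 0, 0, 0)
    have hι : Function.Injective ι := fun a b h => (Prod.mk.inj h).1
    rw [← hι.tsum_eq]
    · refine tsum_congr fun k => ?_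
      have := poch_ne_zero hn k
      simp only [FD1term, ι, add_zero, poch_zero, pow_zero, Nat.factorial_zero, binomCoeff]
      field_simp
      simp
    · rintro ⟨i₁, i₂, j₁, j₂⟩ hi
      have e1 : herm z 0 = 0 := by simp [herm_eq_inner]
      have e2 : herm 0 z = 0 := by simp [herm_eq_inner]
      simp only [FD1term, e1, e2, Function.mem_support, ne_eq, mul_eq_zero, not_or] at hi
      have aux : ∀ k : ℕ, ¬ ((0 : ℂ) ^ k / (k.factorial : ℂ) = 0) → k = 0 := fun k hk => by
        by_contra h
        exact hk (by simp [h])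
      have := aux i₂ hi.1.1.2
      have := aux j₁ hi.1.2
      have := aux j₂ (by simpa using hi.2)
      subst_vars
      exact ⟨i₁, rfl⟩
  rw [h2, h3] at h1
  have hu := pow_ne_zero n (one_sub_normSq_ne_zero hz)
  refine mul_left_cancel₀ hm (h1.trans ?_)
  rw [norm_zero, inv_pow]
  field_simp
  simp

/-! ### Boundary values of Poisson–Szegő integrals -/

lemma invMass_eq_ofReal (n : ℕ) : invMass n = ((Real.Gamma n / (2 * Real.pi ^ n) : ℝ) : ℂ) := by
  rw [invMass]
  push_cast
  rw [← Complex.Gamma_ofReal]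
  simp

/-- The Poisson–Szegő kernel is nonnegative. -/
lemma poisson_eq_norm {n : ℕ} {z : Cn n} (hz : z ∈ unitBall n) (ζ : Cn n) :
    poisson z ζ = (‖poisson z ζ‖ : ℂ) := by
  have hG : 0 ≤ Real.Gamma n := Real.Gamma_nonneg_of_nonneg (Nat.cast_nonneg n)
  have h1 : 0 ≤ 1 - ‖z‖ ^ 2 := by
    have := mem_unitBall.1 hz
    nlinarith [norm_nonneg z]
  have e : poisson z ζ = ((Real.Gamma n / (2 * Real.pi ^ n) * (1 - ‖z‖ ^ 2) ^ n *
      ((‖1 - herm z ζ‖ ^ 2)⁻¹) ^ n : ℝ) : ℂ) := by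
    have e1 : 1 - herm ζ z = (starRingEnd ℂ) (1 - herm z ζ) := by
      rw [map_sub, map_one, conj_herm]
    rw [poisson, invMass_eq_ofReal, e1, mul_assoc, ← mul_pow, ← mul_inv, Complex.mul_conj']
    push_cast
    rfl
  rw [e, Complex.norm_real, Real.norm_of_nonneg (by positivity)]

lemma poisson_symm {n : ℕ} (r : ℝ) (ζ η : unitSphere n) :
    poisson (r • (ζ : Cn n)) η = poisson (r • (η : Cn n)) ζ := by
  have h1 : ‖(ζ : Cn n)‖ = 1 := by simp
  have h2 : ‖(η : Cn n)‖ = 1 := by simp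
  simp only [poisson, real_smul_eq, herm_smul_left, herm_smul_right, Complex.conj_ofReal,
    norm_smul, h1, h2]
  ring

lemma smul_mem_unitBall {n : ℕ} {r : ℝ} (h0 : 0 ≤ r) (h1 : r < 1) (ζ : unitSphere n) :
    r • (ζ : Cn n) ∈ unitBall n := by
  rw [mem_unitBall, norm_smul, Real.norm_of_nonneg h0]
  simpa using h1

lemma continuous_poisson {n : ℕ} {z : Cn n} (hz : z ∈ unitBall n) :
    Continuous fun ζ : unitSphere n => poisson z (ζ : Cn n) :=
  (contDiffOn_poisson n).continuousOn.comp_continuous (f := fun ζ : unitSphere n => ((ζ : Cn n), z))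
    (by fun_prop) fun ζ => mem_poisson_domain ζ hz

lemma continuous_poisson_prod {n : ℕ} {r : ℝ} (h0 : 0 ≤ r) (h1 : r < 1) :
    Continuous fun p : unitSphere n × unitSphere n => poisson (r • (p.1 : Cn n)) (p.2 : Cn n) :=
  (contDiffOn_poisson n).continuousOn.comp_continuous
    (f := fun p : unitSphere n × unitSphere n => ((p.2 : Cn n), r • (p.1 : Cn n)))
    (by fun_prop) fun p => mem_poisson_domain p.2 (smul_mem_unitBall h0 h1 p.1)

lemma integral_norm_poisson {n : ℕ} (hn : 1 ≤ n) {z : Cn n} (hz : z ∈ unitBall n) :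
    ∫ ζ : unitSphere n, ‖poisson z (ζ : Cn n)‖ ∂(surfaceMeasure n) = 1 := by
  have h := poissonInt_one hn hz
  simp only [poissonInt, one_mul] at h
  rw [show (fun ζ : unitSphere n => poisson z (ζ : Cn n)) = fun ζ : unitSphere n =>
    ((‖poisson z (ζ : Cn n)‖ : ℝ) : ℂ) from funext fun ζ => poisson_eq_norm hz ζ,
    integral_complex_ofReal] at h
  exact_mod_cast h

/-- Away from the diagonal of the sphere, the denominator of the kernel stays bounded below as `r`
tends to `1`. -/
lemma norm_one_sub_herm_ge {n : ℕ} {r δ : ℝ} (hr : 1 / 2 ≤ r) (hr1 : r < 1) (hδ : 0 ≤ δ)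
    (ζ η : unitSphere n) (h : δ ≤ dist η ζ) : δ ^ 2 / 4 ≤ ‖1 - herm (r • (ζ : Cn n)) η‖ := by
  have h1 : ‖(ζ : Cn n)‖ = 1 := by simp
  have h2 : ‖(η : Cn n)‖ = 1 := by simp
  have h3 : ‖(η : Cn n) - ζ‖ ^ 2 = 2 - 2 * (herm (ζ : Cn n) η).re := by
    have := norm_sub_sq (𝕜 := ℂ) (η : Cn n) (ζ : Cn n)
    rw [h1, h2, ← herm_eq_inner] at this
    rw [this]
    simp
    ring
  have h4 : δ ^ 2 ≤ ‖(η : Cn n) - ζ‖ ^ 2 := by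
    rw [Subtype.dist_eq, dist_eq_norm] at h
    gcongr
  have h5 : (1 - herm (r • (ζ : Cn n)) η).re ≤ ‖1 - herm (r • (ζ : Cn n)) η‖ :=
    Complex.re_le_norm _
  rw [real_smul_eq, herm_smul_left] at h5 ⊢
  rw [Complex.sub_re, Complex.re_ofReal_mul, Complex.one_re] at h5
  have h6 : (herm (ζ : Cn n) η).re = 1 - ‖(η : Cn n) - ζ‖ ^ 2 / 2 := by linarith
  rw [h6] at h5
  nlinarith [sq_nonneg δ]

lemma norm_poisson_le {n : ℕ} {r δ : ℝ} (hr : 1 / 2 ≤ r) (hr1 : r < 1) (hδ : 0 < δ)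
    (ζ η : unitSphere n) (h : δ ≤ dist η ζ) :
    ‖poisson (r • (ζ : Cn n)) (η : Cn n)‖ ≤
      ‖invMass n‖ * (((4 / δ ^ 2) ^ n) ^ 2) * (1 - r ^ 2) ^ n := by
  have h1 : ‖(ζ : Cn n)‖ = 1 := by simp
  have hge := norm_one_sub_herm_ge hr hr1 hδ.le ζ η h
  have hpos : 0 < δ ^ 2 / 4 := by positivity
  have hinv : ‖1 - herm (r • (ζ : Cn n)) η‖⁻¹ ≤ 4 / δ ^ 2 := by
    rw [show 4 / δ ^ 2 = (δ ^ 2 / 4)⁻¹ by rw [inv_div]]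
    exact inv_anti₀ hpos hge
  have e1 : ‖1 - herm (η : Cn n) (r • (ζ : Cn n))‖ = ‖1 - herm (r • (ζ : Cn n)) η‖ := by
    rw [← RCLike.norm_conj, map_sub, map_one, conj_herm]
  have e2 : ‖(1 - (‖r • (ζ : Cn n)‖ : ℂ) ^ 2)‖ = 1 - r ^ 2 := by
    rw [norm_smul, h1, mul_one, Real.norm_of_nonneg (by linarith)]
    have : (1 - (r : ℂ) ^ 2) = ((1 - r ^ 2 : ℝ) : ℂ) := by push_cast; rfl
    rw [this, Complex.norm_real, Real.norm_of_nonneg (by nlinarith)]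
  rw [poisson, norm_mul, norm_mul, norm_mul, norm_pow, norm_pow, norm_pow, norm_inv, norm_inv, e1,
    e2]
  have h0 : 0 ≤ (1 - r ^ 2) ^ n := pow_nonneg (by nlinarith) n
  calc _ ≤ ‖invMass n‖ * (1 - r ^ 2) ^ n * (4 / δ ^ 2) ^ n * (4 / δ ^ 2) ^ n := by gcongr
    _ = _ := by ring

lemma integrable_mul_poisson {n : ℕ} {g : unitSphere n → ℂ} (hg : Integrable g (surfaceMeasure n))
    {z : Cn n} (hz : z ∈ unitBall n) :
    Integrable (fun ζ : unitSphere n => g ζ * poisson z (ζ : Cn n)) (surfaceMeasure n) := by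
  obtain ⟨C, hC⟩ := isCompact_univ.exists_bound_of_continuousOn (continuous_poisson hz).continuousOn
  exact hg.mul_bdd (continuous_poisson hz).aestronglyMeasurable
    (Eventually.of_forall fun ζ => hC ζ trivial)

/-- The Poisson–Szegő kernel is an approximate identity. -/
lemma tendsto_poissonInt_of_continuous {n : ℕ} (hn : 1 ≤ n) {h : unitSphere n → ℂ}
    (hh : Continuous h) {ε : ℝ} (hε : 0 < ε) :
    ∀ᶠ r : ℝ in 𝓝[<] 1, ∀ ζ : unitSphere n, ‖poissonInt h (r • (ζ : Cn n)) - h ζ‖ ≤ ε := by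
  obtain ⟨M, hM⟩ := isCompact_univ.exists_bound_of_continuousOn hh.continuousOn
  have huc : UniformContinuous h := CompactSpace.uniformContinuous_of_continuous hh
  obtain ⟨δ, hδ, hδh⟩ := Metric.uniformContinuous_iff.1 huc (ε / 2) (by positivity)
  let A : ℝ := 2 * M * (‖invMass n‖ * (((4 / δ ^ 2) ^ n) ^ 2)) * (surfaceMeasure n).real Set.univ
  have hlim : Tendsto (fun r : ℝ => A * (1 - r ^ 2) ^ n) (𝓝[<] 1) (𝓝 0) := by
    have hc : Continuous fun r : ℝ => A * (1 - r ^ 2) ^ n := by fun_prop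
    have := hc.tendsto 1
    rw [show A * (1 - (1 : ℝ) ^ 2) ^ n = 0 by rw [one_pow, sub_self, zero_pow (by omega), mul_zero]]
      at this
    exact this.mono_left nhdsWithin_le_nhds
  filter_upwards [hlim.eventually (gt_mem_nhds (half_pos hε)), self_mem_nhdsWithin,
    nhdsWithin_le_nhds (lt_mem_nhds (show (1 / 2 : ℝ) < 1 by norm_num))] with r hA hr1 hr ζ
  have hr1 : r < 1 := hr1
  have hr0 : 0 ≤ r := by linarith
  have hz := smul_mem_unitBall hr0 hr1 ζ
  have hi := integrable_mul_poisson (integrable_of_continuous hh) hz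
  have hp := integrable_of_continuous (continuous_poisson hz)
  have e : poissonInt h (r • (ζ : Cn n)) - h ζ =
      ∫ η : unitSphere n, (h η - h ζ) * poisson (r • (ζ : Cn n)) η ∂(surfaceMeasure n) := by
    have h1 := poissonInt_one hn hz
    simp only [poissonInt, one_mul] at h1
    simp_rw [sub_mul]
    rw [integral_sub hi (hp.const_mul _), integral_const_mul, h1, mul_one, poissonInt]
  set B : ℝ := 2 * M * (‖invMass n‖ * (((4 / δ ^ 2) ^ n) ^ 2) * (1 - r ^ 2) ^ n) with hB
  have hM0 : 0 ≤ M := (norm_nonneg _).trans (hM ζ trivial)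
  have hB0 : 0 ≤ B := by
    have : 0 ≤ (1 - r ^ 2) ^ n := pow_nonneg (by nlinarith) n
    positivity
  have hpt : ∀ η : unitSphere n, ‖(h η - h ζ) * poisson (r • (ζ : Cn n)) η‖ ≤
      ε / 2 * ‖poisson (r • (ζ : Cn n)) (η : Cn n)‖ + B := by
    intro η
    rw [norm_mul]
    by_cases hd : dist η ζ < δ
    · have := hδh hd
      rw [dist_eq_norm] at this
      have := mul_le_mul_of_nonneg_right this.le (norm_nonneg (poisson (r • (ζ : Cn n)) (η : Cn n)))
      linarith
    · have h1 := norm_poisson_le hr.le hr1 hδ ζ η (not_lt.1 hd)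
      have h2 : ‖h η - h ζ‖ ≤ 2 * M := by
        refine (norm_sub_le _ _).trans ?_
        linarith [hM η trivial, hM ζ trivial]
      have h3 : ‖h η - h ζ‖ * ‖poisson (r • (ζ : Cn n)) (η : Cn n)‖ ≤ B := by
        rw [hB]; gcongr
      have : 0 ≤ ε / 2 * ‖poisson (r • (ζ : Cn n)) (η : Cn n)‖ := by positivity
      linarith
  rw [e]
  have hpn : Integrable (fun η : unitSphere n => ε / 2 * ‖poisson (r • (ζ : Cn n)) (η : Cn n)‖)
    (surfaceMeasure n) := hp.norm.const_mul _
  refine (norm_integral_le_of_norm_le (hpn.add (integrable_const B))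
    (Eventually.of_forall hpt)).trans ?_
  simp only [Pi.add_apply]
  rw [integral_add hpn (integrable_const B), integral_const_mul,
    integral_norm_poisson hn hz, integral_const, smul_eq_mul]
  have : (surfaceMeasure n).real Set.univ * B = A * (1 - r ^ 2) ^ n := by
    simp only [hB, A]; ring
  linarith

/-- Jensen's inequality for the probability measure `P(z, ·) σ`. -/
lemma norm_poissonInt_sq_le {n : ℕ} (hn : 1 ≤ n) {g : unitSphere n → ℂ}
    (hg : MemLp g 2 (surfaceMeasure n)) {z : Cn n} (hz : z ∈ unitBall n) :
    ‖poissonInt g z‖ ^ 2 ≤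
      ∫ ζ : unitSphere n, ‖g ζ‖ ^ 2 * ‖poisson z (ζ : Cn n)‖ ∂(surfaceMeasure n) := by
  have hg1 : Integrable g (surfaceMeasure n) := hg.integrable one_le_two
  have hg2 : Integrable (fun ζ => ‖g ζ‖ ^ 2) (surfaceMeasure n) := hg.integrable_norm_pow two_ne_zero
  obtain ⟨C, hC⟩ := isCompact_univ.exists_bound_of_continuousOn (continuous_poisson hz).continuousOn
  have hpc := (continuous_poisson hz).norm
  have hi1 : Integrable (fun ζ : unitSphere n => ‖g ζ‖ * ‖poisson z (ζ : Cn n)‖)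
      (surfaceMeasure n) := by
    refine (integrable_mul_poisson hg1 hz).norm.congr (Eventually.of_forall fun ζ => ?_)
    simp
  have hi2 : Integrable (fun ζ : unitSphere n => ‖g ζ‖ ^ 2 * ‖poisson z (ζ : Cn n)‖)
      (surfaceMeasure n) :=
    hg2.mul_bdd hpc.aestronglyMeasurable
      (Eventually.of_forall fun ζ => by simpa using hC ζ trivial)
  have hi3 : Integrable (fun ζ : unitSphere n => ‖poisson z (ζ : Cn n)‖) (surfaceMeasure n) :=
    integrable_of_continuous hpc
  set m := ∫ ζ : unitSphere n, ‖g ζ‖ * ‖poisson z (ζ : Cn n)‖ ∂(surfaceMeasure n) with hm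
  have h1 : ‖poissonInt g z‖ ≤ m := by
    refine (norm_integral_le_integral_norm _).trans (le_of_eq ?_)
    simp [hm]
  -- the variance of `‖g‖` with respect to the probability measure `P(z, ·) σ` is nonnegative
  have h2 : 0 ≤ ∫ ζ : unitSphere n, (‖g ζ‖ - m) ^ 2 * ‖poisson z (ζ : Cn n)‖
      ∂(surfaceMeasure n) := integral_nonneg fun ζ => by positivity
  have h3 : ∫ ζ : unitSphere n, (‖g ζ‖ - m) ^ 2 * ‖poisson z (ζ : Cn n)‖ ∂(surfaceMeasure n) =
      ∫ ζ : unitSphere n, ‖g ζ‖ ^ 2 * ‖poisson z (ζ : Cn n)‖ ∂(surfaceMeasure n) - 2 * m * m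
        + m ^ 2 * 1 := by
    have e : ∀ ζ : unitSphere n, (‖g ζ‖ - m) ^ 2 * ‖poisson z (ζ : Cn n)‖ =
        ‖g ζ‖ ^ 2 * ‖poisson z (ζ : Cn n)‖ - 2 * m * (‖g ζ‖ * ‖poisson z (ζ : Cn n)‖)
          + m ^ 2 * ‖poisson z (ζ : Cn n)‖ := fun ζ => by ring
    have hi4 : Integrable (fun ζ : unitSphere n => ‖g ζ‖ ^ 2 * ‖poisson z (ζ : Cn n)‖ -
        2 * m * (‖g ζ‖ * ‖poisson z (ζ : Cn n)‖)) (surfaceMeasure n) :=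
      hi2.sub (hi1.const_mul _)
    simp_rw [e]
    rw [integral_add hi4 (hi3.const_mul _),
      integral_sub hi2 (hi1.const_mul _), integral_const_mul, integral_const_mul,
      integral_norm_poisson hn hz]
  have h4 : ‖poissonInt g z‖ ^ 2 ≤ m ^ 2 := by gcongr
  nlinarith

lemma continuous_poissonInt {n : ℕ} {g : unitSphere n → ℂ} (hg : Integrable g (surfaceMeasure n))
    {r : ℝ} (h0 : 0 ≤ r) (h1 : r < 1) :
    Continuous fun ζ : unitSphere n => poissonInt g (r • (ζ : Cn n)) :=
  (isMHarmonic_poissonInt hg).1.continuousOn.comp_continuous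
    (f := fun ζ : unitSphere n => r • (ζ : Cn n)) (by fun_prop) fun ζ => smul_mem_unitBall h0 h1 ζ

/-- Poisson–Szegő integrals contract the `L²` norm on spheres. -/
lemma integral_norm_poissonInt_sq_le {n : ℕ} (hn : 1 ≤ n) {g : unitSphere n → ℂ}
    (hg : MemLp g 2 (surfaceMeasure n)) {r : ℝ} (h0 : 0 ≤ r) (h1 : r < 1) :
    ∫ ζ : unitSphere n, ‖poissonInt g (r • (ζ : Cn n))‖ ^ 2 ∂(surfaceMeasure n) ≤
      ∫ ζ, ‖g ζ‖ ^ 2 ∂(surfaceMeasure n) := by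
  have hg1 : Integrable g (surfaceMeasure n) := hg.integrable one_le_two
  have hg2 : Integrable (fun ζ => ‖g ζ‖ ^ 2) (surfaceMeasure n) := hg.integrable_norm_pow two_ne_zero
  obtain ⟨C, hC⟩ := isCompact_univ.exists_bound_of_continuousOn
    (continuous_poisson_prod (n := n) h0 h1).continuousOn
  have hprod : Integrable (fun p : unitSphere n × unitSphere n =>
      ‖g p.2‖ ^ 2 * ‖poisson (r • (p.1 : Cn n)) (p.2 : Cn n)‖)
      ((surfaceMeasure n).prod (surfaceMeasure n)) :=
    (hg2.comp_snd (surfaceMeasure n)).mul_bdd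
      (continuous_poisson_prod h0 h1).norm.aestronglyMeasurable
      (Eventually.of_forall fun p => by simpa using hC p trivial)
  calc ∫ ζ : unitSphere n, ‖poissonInt g (r • (ζ : Cn n))‖ ^ 2 ∂(surfaceMeasure n)
      ≤ ∫ ζ : unitSphere n, ∫ η : unitSphere n, ‖g η‖ ^ 2 * ‖poisson (r • (ζ : Cn n)) (η : Cn n)‖
          ∂(surfaceMeasure n) ∂(surfaceMeasure n) := by
        refine integral_mono ?_ hprod.integral_prod_left fun ζ =>
          norm_poissonInt_sq_le hn hg (smul_mem_unitBall h0 h1 ζ)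
        exact integrable_of_continuous ((continuous_poissonInt hg1 h0 h1).norm.pow 2)
    _ = ∫ η : unitSphere n, ∫ ζ : unitSphere n, ‖g η‖ ^ 2 * ‖poisson (r • (ζ : Cn n)) (η : Cn n)‖
          ∂(surfaceMeasure n) ∂(surfaceMeasure n) := integral_integral_swap hprod
    _ = ∫ ζ, ‖g ζ‖ ^ 2 ∂(surfaceMeasure n) := by
        refine integral_congr_ae (Eventually.of_forall fun η => ?_)
        simp only
        rw [integral_const_mul]
        simp_rw [fun ζ => poisson_symm r ζ η]
        rw [integral_norm_poisson hn (smul_mem_unitBall h0 h1 η), mul_one]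

lemma eLpNorm_two_le {X : Type*} [MeasurableSpace X] {μ : Measure X} {f g : X → ℂ}
    (hf : MemLp f 2 μ) (hg : MemLp g 2 μ) (h : ∫ x, ‖f x‖ ^ 2 ∂μ ≤ ∫ x, ‖g x‖ ^ 2 ∂μ) :
    eLpNorm f 2 μ ≤ eLpNorm g 2 μ := by
  rw [hf.eLpNorm_eq_integral_rpow_norm two_ne_zero ENNReal.ofNat_ne_top,
    hg.eLpNorm_eq_integral_rpow_norm two_ne_zero ENNReal.ofNat_ne_top]
  refine ENNReal.ofReal_le_ofReal (Real.rpow_le_rpow (integral_nonneg fun x => by positivity) ?_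
    (by simp))
  simpa using h

lemma memLp_of_continuous {n : ℕ} {f : unitSphere n → ℂ} (hf : Continuous f) :
    MemLp f 2 (surfaceMeasure n) := by
  obtain ⟨C, hC⟩ := isCompact_univ.exists_bound_of_continuousOn hf.continuousOn
  exact MemLp.of_bound hf.aestronglyMeasurable C (Eventually.of_forall fun ζ => hC ζ trivial)

lemma memHardy_poissonInt {n : ℕ} (hn : 1 ≤ n) {g : unitSphere n → ℂ}
    (hg : MemLp g 2 (surfaceMeasure n)) : MemHardy (poissonInt g) :=
  ⟨isMHarmonic_poissonInt (hg.integrable one_le_two), _, fun _ hr =>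
    integral_norm_poissonInt_sq_le hn hg hr.1 hr.2⟩

lemma poissonInt_sub {n : ℕ} {g h : unitSphere n → ℂ} (hg : Integrable g (surfaceMeasure n))
    (hh : Integrable h (surfaceMeasure n)) {z : Cn n} (hz : z ∈ unitBall n) :
    poissonInt (fun ζ => g ζ - h ζ) z = poissonInt g z - poissonInt h z := by
  simp only [poissonInt, sub_mul]
  exact integral_sub (integrable_mul_poisson hg hz) (integrable_mul_poisson hh hz)

/-- The boundary value of the Poisson–Szegő integral of an `L²` function is that function. -/
lemma isBoundaryValue_poissonInt {n : ℕ} (hn : 1 ≤ n) {g : unitSphere n → ℂ}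
    (hg : MemLp g 2 (surfaceMeasure n)) : IsBoundaryValue (poissonInt g) g := by
  refine ⟨hg, ENNReal.tendsto_nhds_zero.2 fun ε hε => ?_⟩
  have hg1 : Integrable g (surfaceMeasure n) := hg.integrable one_le_two
  have hε3 : ε / 3 ≠ 0 := (ENNReal.div_pos hε.ne' (by norm_num)).ne'
  -- approximate `g` by a continuous `h` in `L²`, and split `P[g] - g = P[g - h] + (P[h] - h) - (g - h)`
  obtain ⟨h, hgh, hh2⟩ := hg.exists_boundedContinuous_eLpNorm_sub_le (by norm_num) hε3
  have hh1 : Integrable h (surfaceMeasure n) := hh2.integrable one_le_two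
  obtain ⟨δ, hδ, hδε⟩ : ∃ δ : ℝ, 0 < δ ∧
      (surfaceMeasure n) Set.univ ^ ((2 : ENNReal).toReal⁻¹) * ENNReal.ofReal δ ≤ ε / 3 := by
    have ht : Tendsto (fun δ : ℝ => (surfaceMeasure n) Set.univ ^ ((2 : ENNReal).toReal⁻¹) *
        ENNReal.ofReal δ) (𝓝[>] 0) (𝓝 0) := by
      have h1 : Tendsto (fun δ : ℝ => ENNReal.ofReal δ) (𝓝[>] 0) (𝓝 0) := by
        have := (ENNReal.continuous_ofReal.tendsto 0).mono_left
          (nhdsWithin_le_nhds (s := Set.Ioi (0 : ℝ)))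
        simpa using this
      have := ENNReal.Tendsto.const_mul (a := (surfaceMeasure n) Set.univ ^
        ((2 : ENNReal).toReal⁻¹)) h1
        (Or.inr (ENNReal.rpow_ne_top_of_nonneg (by simp) (measure_ne_top _ _)))
      simpa using this
    obtain ⟨δ, h1, h2⟩ := ((ht.eventually (ge_mem_nhds (pos_iff_ne_zero.2 hε3))).and
      self_mem_nhdsWithin).exists
    exact ⟨δ, h2, h1⟩
  filter_upwards [tendsto_poissonInt_of_continuous hn h.continuous hδ, self_mem_nhdsWithin,
    nhdsWithin_le_nhds (lt_mem_nhds (show (0 : ℝ) < 1 by norm_num))] with r hr hr1 hr0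
  have hr1 : r < 1 := hr1
  have hd2 : MemLp (fun ζ => g ζ - h ζ) 2 (surfaceMeasure n) := hg.sub hh2
  have e : (fun ζ : unitSphere n => poissonInt g (r • (ζ : Cn n)) - g ζ) =
      (fun ζ : unitSphere n => poissonInt (fun ζ => g ζ - h ζ) (r • (ζ : Cn n))) +
        ((fun ζ : unitSphere n => poissonInt h (r • (ζ : Cn n)) - h ζ) -
          fun ζ : unitSphere n => g ζ - h ζ) := by
    ext ζ
    simp only [Pi.add_apply, Pi.sub_apply]
    rw [poissonInt_sub hg1 hh1 (smul_mem_unitBall hr0.le hr1 ζ)]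
    ring
  have c1 := continuous_poissonInt (hd2.integrable one_le_two) hr0.le hr1
  have c2 := continuous_poissonInt hh1 hr0.le hr1
  have b1 : eLpNorm (fun ζ : unitSphere n => poissonInt (fun ζ => g ζ - h ζ) (r • (ζ : Cn n))) 2
      (surfaceMeasure n) ≤ ε / 3 :=
    (eLpNorm_two_le (memLp_of_continuous c1) hd2
      (integral_norm_poissonInt_sq_le hn hd2 hr0.le hr1)).trans hgh
  have b2 : eLpNorm (fun ζ : unitSphere n => poissonInt h (r • (ζ : Cn n)) - h ζ) 2
      (surfaceMeasure n) ≤ ε / 3 :=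
    (eLpNorm_le_of_ae_bound (Eventually.of_forall hr)).trans hδε
  rw [e]
  refine (eLpNorm_add_le c1.aestronglyMeasurable
    ((c2.sub h.continuous).aestronglyMeasurable.sub hd2.1) one_le_two).trans ?_
  refine (add_le_add b1 ((eLpNorm_sub_le (c2.sub h.continuous).aestronglyMeasurable hd2.1
    one_le_two).trans (add_le_add b2 hgh))).trans ?_
  rw [← add_assoc, ENNReal.add_thirds]

/-! ### The unitary group and the surface measure -/

/-- The unitary group of `ℂⁿ`, as a topological group of operators. -/
abbrev UGroup (n : ℕ) : Type := unitary (Cn n →L[ℂ] Cn n)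

instance (n : ℕ) : ContinuousStar (Cn n →L[ℂ] Cn n) :=
  ⟨(ContinuousLinearMap.adjoint (𝕜 := ℂ) (E := Cn n) (F := Cn n)).continuous⟩

instance (n : ℕ) : CompactSpace (UGroup n) := by
  have : ProperSpace (Cn n →L[ℂ] Cn n) := FiniteDimensional.proper_real _
  refine isCompact_iff_compactSpace.1 (Metric.isCompact_of_isClosed_isBounded
    (isClosed_unitary (R := Cn n →L[ℂ] Cn n)) ?_)
  refine (Metric.isBounded_closedBall (x := (0 : Cn n →L[ℂ] Cn n)) (r := 1)).subset fun A hA => ?_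
  rw [mem_closedBall_zero_iff]
  refine ContinuousLinearMap.opNorm_le_bound _ zero_le_one fun x => ?_
  rw [one_mul, Unitary.norm_map ⟨A, hA⟩ x]

/-- The action of a unitary operator on the sphere. -/
def rot {n : ℕ} (U : UGroup n) (ζ : unitSphere n) : unitSphere n :=
  ⟨U.1 ζ, by rw [mem_sphere_zero_iff_norm, Unitary.norm_map]; simp⟩

lemma coe_rot {n : ℕ} (U : UGroup n) (ζ : unitSphere n) : (rot U ζ : Cn n) = U.1 ζ := rfl

lemma rot_mul {n : ℕ} (U V : UGroup n) (ζ : unitSphere n) : rot (U * V) ζ = rot U (rot V ζ) := rfl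

lemma rot_one {n : ℕ} (ζ : unitSphere n) : rot (1 : UGroup n) ζ = ζ := rfl

lemma continuous_rot_prod {n : ℕ} :
    Continuous fun p : UGroup n × unitSphere n => rot p.1 p.2 := by
  refine Continuous.subtype_mk ?_ _
  exact (continuous_subtype_val.comp continuous_fst).clm_apply
    (continuous_subtype_val.comp continuous_snd)

/-- The unitary group acts transitively on the sphere. -/
lemma exists_rot_eq {n : ℕ} (hn : 1 ≤ n) (ζ η : unitSphere n) : ∃ U : UGroup n, rot U ζ = η := by
  obtain ⟨b, hb⟩ := exists_orthonormalBasis_smul (⟨0, hn⟩ : Fin n) (ζ : Cn n)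
  obtain ⟨c, hc⟩ := exists_orthonormalBasis_smul (⟨0, hn⟩ : Fin n) (η : Cn n)
  have h1 : ‖(ζ : Cn n)‖ = 1 := by simp
  have h2 : ‖(η : Cn n)‖ = 1 := by simp
  rw [h1] at hb
  rw [h2] at hc
  let e : Cn n ≃ₗᵢ[ℂ] Cn n := b.repr.trans c.repr.symm
  refine ⟨Unitary.linearIsometryEquiv.symm e, Subtype.ext ?_⟩
  rw [coe_rot]
  have : e (ζ : Cn n) = η := by
    rw [hb, hc]
    simp [e]
  exact this

open scoped Pointwise in
/-- The surface measure is invariant under unitary maps, since Lebesgue measure is. -/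
lemma measurePreserving_rot {n : ℕ} (U : UGroup n) :
    MeasurePreserving (rot U) (surfaceMeasure n) (surfaceMeasure n) := by
  have hm : Measurable (rot U) :=
    (continuous_rot_prod.comp (Continuous.prodMk continuous_const continuous_id)).measurable
  refine ⟨hm, Measure.ext fun A hA => ?_⟩
  rw [Measure.map_apply hm hA, surfaceMeasure, Measure.toSphere_apply' _ (hm hA),
    Measure.toSphere_apply' _ hA]
  congr 1
  let e : Cn n ≃ₗᵢ[ℝ] Cn n :=
    { (Unitary.linearIsometryEquiv U).toLinearEquiv.restrictScalars ℝ with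
      norm_map' := Unitary.norm_map U }
  have he : ∀ x, e x = U.1 x := fun x => rfl
  have h2 := e.measurePreserving.measure_preimage_equiv (f := e.toMeasurableEquiv)
    (Set.Ioo (0 : ℝ) 1 • (Subtype.val '' A : Set (Cn n)))
  rw [← h2]
  congr 1
  ext x
  simp only [Set.mem_smul, Set.mem_image, Set.mem_preimage]
  constructor
  · rintro ⟨r, hr, _, ⟨ζ, hζ, rfl⟩, rfl⟩
    refine ⟨r, hr, _, ⟨rot U ζ, hζ, rfl⟩, ?_⟩
    change r • U.1 ζ = e (r • (ζ : Cn n))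
    rw [map_smul, he]
  · rintro ⟨r, hr, _, ⟨ζ, hζ, rfl⟩, hx⟩
    change r • (ζ : Cn n) = U.1 x at hx
    refine ⟨r, hr, _, ⟨rot U⁻¹ ζ, ?_, rfl⟩, ?_⟩
    · rw [← rot_mul, mul_inv_cancel, rot_one]; exact hζ
    · apply e.injective
      rw [map_smul, he, he, ← hx, ← coe_rot, ← rot_mul, mul_inv_cancel, rot_one]

lemma surfaceMeasure_univ_ne_zero {n : ℕ} (hn : 1 ≤ n) :
    surfaceMeasure n Set.univ ≠ 0 := by
  have : Nonempty (Fin n) := ⟨⟨0, hn⟩⟩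
  have : Nontrivial (Cn n) := inferInstance
  rw [Ne, Measure.measure_univ_eq_zero]
  exact Measure.toSphere_ne_zero _

/-- Haar measure on the unitary group, scaled to the total mass of `σ`. -/
def unitaryMeasure (n : ℕ) : Measure (UGroup n) :=
  (surfaceMeasure n Set.univ / Measure.haar (Set.univ : Set (UGroup n))) • Measure.haar

lemma haar_univ_ne_top (n : ℕ) : Measure.haar (Set.univ : Set (UGroup n)) ≠ ⊤ :=
  (isCompact_univ.measure_lt_top).ne

lemma haar_univ_ne_zero (n : ℕ) : Measure.haar (Set.univ : Set (UGroup n)) ≠ 0 := by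
  rw [Ne, Measure.measure_univ_eq_zero]
  exact NeZero.ne _

instance (n : ℕ) : IsFiniteMeasure (unitaryMeasure n) := by
  refine ⟨?_⟩
  rw [unitaryMeasure, Measure.smul_apply, smul_eq_mul,
    ENNReal.div_mul_cancel (haar_univ_ne_zero n) (haar_univ_ne_top n)]
  exact measure_lt_top _ _

lemma integrable_unitaryMeasure {n : ℕ} {E : Type*} [NormedAddCommGroup E] {f : UGroup n → E}
    (hf : Continuous f) : Integrable f (unitaryMeasure n) := by
  have : IsFiniteMeasureOnCompacts (unitaryMeasure n) :=
    ⟨fun _ _ => measure_lt_top _ _⟩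
  exact hf.integrable_of_hasCompactSupport (HasCompactSupport.of_compactSpace _)

instance (n : ℕ) : (unitaryMeasure n).IsMulLeftInvariant := by
  unfold unitaryMeasure; infer_instance

lemma unitaryMeasure_univ (n : ℕ) : unitaryMeasure n Set.univ = surfaceMeasure n Set.univ := by
  rw [unitaryMeasure, Measure.smul_apply, smul_eq_mul,
    ENNReal.div_mul_cancel (haar_univ_ne_zero n) (haar_univ_ne_top n)]

/-- For `n = 0` this fails: the sphere is empty, and the scaled measure is zero. -/
lemma isOpenPosMeasure_unitaryMeasure {n : ℕ} (hn : 1 ≤ n) :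
    (unitaryMeasure n).IsOpenPosMeasure := by
  refine ⟨fun U hU hne => ?_⟩
  rw [unitaryMeasure, Measure.smul_apply, smul_eq_mul]
  exact mul_ne_zero (ENNReal.div_ne_zero.2 ⟨surfaceMeasure_univ_ne_zero hn, haar_univ_ne_top n⟩)
    (hU.measure_ne_zero _ hne)

/-- The orbit map `U ↦ U⁻¹ e` carries the scaled Haar measure to `σ`. For a Borel set `A`, the
measure of `{(ζ, U) | U⁻¹ ζ ∈ A}` is computed in both orders: by transitivity and left invariance the
sections at `ζ` all have the same measure, and by unitary invariance of `σ` so have those at `U`. -/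
lemma measurePreserving_orbit {n : ℕ} (hn : 1 ≤ n) (e : unitSphere n) :
    MeasurePreserving (fun U : UGroup n => rot U⁻¹ e) (unitaryMeasure n) (surfaceMeasure n) := by
  have hc : Continuous fun p : unitSphere n × UGroup n => rot p.2⁻¹ p.1 :=
    continuous_rot_prod.comp (continuous_snd.inv.prodMk continuous_fst)
  have hm : ∀ η : unitSphere n, Measurable fun U : UGroup n => rot U⁻¹ η := fun η =>
    (hc.comp (Continuous.prodMk continuous_const continuous_id)).measurable
  refine ⟨hm e, Measure.ext fun A hA => ?_⟩
  rw [Measure.map_apply (hm e) hA]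
  have hS := hc.measurable hA
  have h1 := Measure.prod_apply (μ := surfaceMeasure n) (ν := unitaryMeasure n) hS
  have h2 := Measure.prod_apply_symm (μ := surfaceMeasure n) (ν := unitaryMeasure n) hS
  have h3 : ∀ η : unitSphere n, unitaryMeasure n
      (Prod.mk η ⁻¹' ((fun p : unitSphere n × UGroup n => rot p.2⁻¹ p.1) ⁻¹' A)) =
      unitaryMeasure n ((fun U : UGroup n => rot U⁻¹ e) ⁻¹' A) := by
    intro η
    obtain ⟨V, hV⟩ := exists_rot_eq hn e η
    have h := measure_preimage_mul (unitaryMeasure n) V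
      ((fun U : UGroup n => rot U⁻¹ η) ⁻¹' A)
    have e1 : (fun U : UGroup n => V * U) ⁻¹' ((fun U : UGroup n => rot U⁻¹ η) ⁻¹' A) =
        (fun U : UGroup n => rot U⁻¹ e) ⁻¹' A := by
      ext U
      simp only [Set.mem_preimage]
      rw [← hV, mul_inv_rev, rot_mul, ← rot_mul V⁻¹ V, inv_mul_cancel, rot_one]
    rw [e1] at h
    exact h.symm
  have h4 : ∀ U : UGroup n, surfaceMeasure n
      ((fun x => (x, U)) ⁻¹' ((fun p : unitSphere n × UGroup n => rot p.2⁻¹ p.1) ⁻¹' A)) =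
      surfaceMeasure n A := fun U =>
    (measurePreserving_rot U⁻¹).measure_preimage hA.nullMeasurableSet
  rw [h1] at h2
  simp only [h3, h4, lintegral_const, unitaryMeasure_univ] at h2
  exact (ENNReal.mul_left_inj (surfaceMeasure_univ_ne_zero hn) (measure_ne_top _ _)).1 h2

/-! ### Weak limits and averages over the unitary group -/

/-- Bounded families in a Hilbert space converge weakly along ultrafilters. -/
lemma exists_weak_limit {H : Type*} [NormedAddCommGroup H] [InnerProductSpace ℂ H]
    [CompleteSpace H] {ι : Type*} (𝒰 : Ultrafilter ι) {x : ι → H} {C : ℝ}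
    (hx : ∀ᶠ i in 𝒰, ‖x i‖ ≤ C) :
    ∃ g : H, ∀ y : H, Tendsto (fun i => inner ℂ (x i) y) 𝒰 (𝓝 (inner ℂ g y)) := by
  let T : ι → WeakDual ℂ H := fun i =>
    StrongDual.toWeakDual (InnerProductSpace.toDual ℂ H (x i))
  have hmem : (WeakDual.toStrongDual ⁻¹' Metric.closedBall (0 : StrongDual ℂ H) C) ∈
      𝒰.map T := by
    rw [Ultrafilter.mem_map]
    filter_upwards [hx] with i hi
    simp only [T, Set.mem_preimage, mem_closedBall_zero_iff]
    exact ((InnerProductSpace.toDual ℂ H).norm_map (x i)).trans_le hi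
  obtain ⟨ℓ, -, hℓ⟩ := (WeakDual.isCompact_closedBall (0 : StrongDual ℂ H) C).ultrafilter_le_nhds'
    (𝒰.map T) hmem
  refine ⟨(InnerProductSpace.toDual ℂ H).symm (WeakDual.toStrongDual ℓ), fun y => ?_⟩
  have h1 : Tendsto T 𝒰 (𝓝 ℓ) := hℓ
  have h2 := ((WeakDual.eval_continuous y).tendsto ℓ).comp h1
  rw [InnerProductSpace.toDual_symm_apply]
  exact h2

lemma inner_toLp {X : Type*} [MeasurableSpace X] {μ : Measure X} {f g : X → ℂ}
    (hf : MemLp f 2 μ) (hg : MemLp g 2 μ) :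
    inner ℂ (hf.toLp f) (hg.toLp g) = ∫ x, (starRingEnd ℂ) (f x) * g x ∂μ := by
  rw [L2.inner_def]
  refine integral_congr_ae ?_
  filter_upwards [hf.coeFn_toLp, hg.coeFn_toLp] with x h1 h2
  rw [h1, h2, RCLike.inner_apply, mul_comm]

lemma memLp_conj {X : Type*} [MeasurableSpace X] {μ : Measure X} {f : X → ℂ}
    (hf : MemLp f 2 μ) : MemLp (fun x => (starRingEnd ℂ) (f x)) 2 μ := hf.star

lemma norm_toLp_sq {X : Type*} [MeasurableSpace X] {μ : Measure X} {f : X → ℂ}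
    (hf : MemLp f 2 μ) : ‖hf.toLp f‖ ^ 2 = ∫ x, ‖f x‖ ^ 2 ∂μ := by
  have h := inner_self_eq_norm_sq_to_K (𝕜 := ℂ) (hf.toLp f)
  rw [inner_toLp] at h
  have h2 : ∀ x, (starRingEnd ℂ) (f x) * f x = ((‖f x‖ ^ 2 : ℝ) : ℂ) := fun x => by
    rw [mul_comm, Complex.mul_conj']; push_cast; rfl
  simp only [h2] at h
  rw [integral_complex_ofReal] at h
  have h3 := congrArg Complex.re h.symm
  simpa [← Complex.ofReal_pow] using h3

/-- Integration against a continuous function along the orbit map is integration against a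
square-integrable density on the sphere. -/
lemma exists_orbit_density {n : ℕ} (hn : 1 ≤ n) (e : unitSphere n) {ψ : UGroup n → ℂ}
    (hψ : MemLp ψ 2 (unitaryMeasure n)) :
    ∃ h : unitSphere n → ℂ, MemLp h 2 (surfaceMeasure n) ∧
      ∀ F : unitSphere n → ℂ, MemLp F 2 (surfaceMeasure n) →
        ∫ U, ψ U * F (rot U⁻¹ e) ∂(unitaryMeasure n) = ∫ ζ, h ζ * F ζ ∂(surfaceMeasure n) := by
  let T := Lp.compMeasurePreservingₗᵢ (E := ℂ) (p := 2) ℂ _ (measurePreserving_orbit hn e)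
  let p := (memLp_conj hψ).toLp _
  let q := ContinuousLinearMap.adjoint T.toContinuousLinearMap p
  refine ⟨fun ζ => (starRingEnd ℂ) (q ζ), memLp_conj (Lp.memLp q), fun F hF => ?_⟩
  have h1 : inner ℂ q (hF.toLp F) = inner ℂ p (T (hF.toLp F)) :=
    ContinuousLinearMap.adjoint_inner_left _ _ _
  have h2 : T (hF.toLp F) = (hF.comp_measurePreserving (measurePreserving_orbit hn e)).toLp _ :=
    Lp.toLp_compMeasurePreserving hF _
  have h3 : q = (Lp.memLp q).toLp q := (Lp.toLp_coeFn q _).symm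
  rw [h2, inner_toLp, h3, inner_toLp] at h1
  rw [h1]
  simp

/-- Dilates `f(r ·)` bounded in `L²` converge weakly along an ultrafilter. -/
lemma exists_weak_boundary_value {n : ℕ} {f : Cn n → ℂ} {𝒰 : Ultrafilter ℝ} {C : ℝ}
    (h2 : ∀ᶠ r in (𝒰 : Filter ℝ), MemLp (fun ζ : unitSphere n => f (r • (ζ : Cn n))) 2 (surfaceMeasure n))
    (hC : ∀ᶠ r in (𝒰 : Filter ℝ), ∫ ζ : unitSphere n, ‖f (r • (ζ : Cn n))‖ ^ 2 ∂(surfaceMeasure n) ≤ C) :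
    ∃ g : unitSphere n → ℂ, MemLp g 2 (surfaceMeasure n) ∧
      ∀ h : unitSphere n → ℂ, MemLp h 2 (surfaceMeasure n) →
        Tendsto (fun r : ℝ => ∫ ζ : unitSphere n, h ζ * f (r • (ζ : Cn n)) ∂(surfaceMeasure n))
          𝒰 (𝓝 (∫ ζ, h ζ * g ζ ∂(surfaceMeasure n))) := by
  classical
  -- the dilates are square-integrable only eventually, whence the default value `0`
  let x : ℝ → Lp ℂ 2 (surfaceMeasure n) := fun r =>
    if h : MemLp (fun ζ : unitSphere n => f (r • (ζ : Cn n))) 2 (surfaceMeasure n)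
      then h.toLp _ else 0
  obtain ⟨g, hg⟩ := exists_weak_limit 𝒰 (x := x) (C := √C) (by
    filter_upwards [h2, hC] with r hr hr'
    refine Real.le_sqrt_of_sq_le ?_
    simp only [x, dif_pos hr]
    rwa [norm_toLp_sq])
  refine ⟨g, Lp.memLp g, fun h hh => ?_⟩
  have h3 := (Complex.continuous_conj.tendsto _).comp (hg ((memLp_conj hh).toLp _))
  have e1 : (starRingEnd ℂ) (inner ℂ g ((memLp_conj hh).toLp _)) =
      ∫ ζ, h ζ * g ζ ∂(surfaceMeasure n) := by
    rw [inner_conj_symm]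
    have : g = (Lp.memLp g).toLp g := (Lp.toLp_coeFn g _).symm
    conv_lhs => rw [this]
    rw [inner_toLp]
    simp
  rw [e1] at h3
  refine h3.congr' ?_
  filter_upwards [h2] with r hr
  simp only [Function.comp, x, dif_pos hr]
  rw [inner_conj_symm, inner_toLp]
  simp

lemma continuous_dilate {n : ℕ} {f : Cn n → ℂ} (hf : ContinuousOn f (unitBall n)) {r : ℝ}
    (h0 : 0 ≤ r) (h1 : r < 1) : Continuous fun ζ : unitSphere n => f (r • (ζ : Cn n)) :=
  hf.comp_continuous (continuous_subtype_val.const_smul r) (smul_mem_unitBall h0 h1)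

lemma unitary_mem_unitBall {n : ℕ} (U : UGroup n) {z : Cn n} (hz : z ∈ unitBall n) :
    U.1 z ∈ unitBall n := by
  rw [mem_unitBall, Unitary.norm_map]
  exact mem_unitBall.1 hz

lemma continuous_orbit {n : ℕ} {f : Cn n → ℂ} (hf : ContinuousOn f (unitBall n)) {z : Cn n}
    (hz : z ∈ unitBall n) : Continuous fun U : UGroup n => f ((U⁻¹).1 z) :=
  hf.comp_continuous ((continuous_subtype_val.comp continuous_inv).clm_apply continuous_const)
    fun U => unitary_mem_unitBall U⁻¹ hz

/-- The convolution of an `M`-harmonic function with a function on the unitary group. -/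
def unitaryAverage {n : ℕ} (φ : UGroup n → ℂ) (f : Cn n → ℂ) (z : Cn n) : ℂ :=
  ∫ U, φ U * f ((U⁻¹).1 z) ∂(unitaryMeasure n)

lemma isMHarmonic_unitaryAverage {n : ℕ} {φ : UGroup n → ℂ} (hφ : Continuous φ) {f : Cn n → ℂ}
    (hf : IsMHarmonic f) : IsMHarmonic (unitaryAverage φ f) := by
  have hb : ContDiff ℝ 2 fun p : (Cn n →L[ℂ] Cn n) × Cn n => p.1 p.2 :=
    (isBoundedBilinearMap_apply (𝕜 := ℂ) (E := Cn n) (F := Cn n)).contDiff.restrict_scalars ℝ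
  refine isMHarmonic_integral (E := Cn n →L[ℂ] Cn n) (Φ := fun p => f (p.1 p.2))
    (Ω := {p | p.1 p.2 ∈ unitBall n}) ((isOpen_unitBall n).preimage hb.continuous)
    (hf.1.comp hb.contDiffOn fun p hp => hp) (ι := fun U : UGroup n => (U⁻¹).1)
    (continuous_subtype_val.comp continuous_inv)
    (fun U z hz => unitary_mem_unitBall U⁻¹ hz) (g := φ)
    (integrable_unitaryMeasure hφ) fun U => ?_
  exact hf.comp_unitary (Unitary.linearIsometryEquiv U⁻¹)

/-- At a point `r V e` of the orbit of `r e`, the average is the integral of a left translate. -/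
lemma unitaryAverage_rot {n : ℕ} (φ : UGroup n → ℂ) (f : Cn n → ℂ) (r : ℝ) (V : UGroup n)
    (e : unitSphere n) :
    unitaryAverage φ f (r • (rot V e : Cn n)) =
      ∫ U, φ (V * U) * f (r • (rot U⁻¹ e : Cn n)) ∂(unitaryMeasure n) := by
  rw [unitaryAverage, ← integral_mul_left_eq_self _ V]
  congr 1
  ext U
  rw [real_smul_eq, map_smul, ← coe_rot, ← rot_mul, mul_inv_rev, mul_assoc, inv_mul_cancel, mul_one,
    real_smul_eq]

lemma integral_orbit {n : ℕ} (hn : 1 ≤ n) (e : unitSphere n) {F : unitSphere n → ℝ}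
    (hF : Continuous F) :
    ∫ U, F (rot U⁻¹ e) ∂(unitaryMeasure n) = ∫ ζ, F ζ ∂(surfaceMeasure n) := by
  have hmp := measurePreserving_orbit hn e
  have h := integral_map (μ := unitaryMeasure n) hmp.measurable.aemeasurable
    (f := F) hF.aestronglyMeasurable
  rw [← h, hmp.map_eq]

lemma integral_norm_le_of_sq {n : ℕ} {F : unitSphere n → ℂ} (hF : Continuous F) {C : ℝ}
    (hC : ∫ ζ, ‖F ζ‖ ^ 2 ∂(surfaceMeasure n) ≤ C) :
    ∫ ζ, ‖F ζ‖ ∂(surfaceMeasure n) ≤ (surfaceMeasure n).real Set.univ + C := by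
  have i0 : Integrable (fun ζ => ‖F ζ‖) (surfaceMeasure n) :=
    (integrable_of_continuous hF).norm
  have i2 : Integrable (fun ζ => ‖F ζ‖ ^ 2) (surfaceMeasure n) :=
    (memLp_two_iff_integrable_sq_norm hF.aestronglyMeasurable).1 (memLp_of_continuous hF)
  calc ∫ ζ, ‖F ζ‖ ∂(surfaceMeasure n) ≤ ∫ ζ, (1 + ‖F ζ‖ ^ 2) ∂(surfaceMeasure n) := by
        refine integral_mono i0 ((integrable_const 1).add i2) fun ζ => ?_
        change ‖F ζ‖ ≤ 1 + ‖F ζ‖ ^ 2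
        nlinarith [sq_nonneg (‖F ζ‖ - 1), norm_nonneg (F ζ)]
    _ = (surfaceMeasure n).real Set.univ + ∫ ζ, ‖F ζ‖ ^ 2 ∂(surfaceMeasure n) := by
        rw [integral_add (integrable_const 1) i2, integral_const, smul_eq_mul, mul_one]
    _ ≤ _ := by gcongr

lemma norm_integral_orbit_le {n : ℕ} (hn : 1 ≤ n) (e : unitSphere n) {F : unitSphere n → ℂ}
    (hF : Continuous F) (ψ : C(UGroup n, ℂ)) :
    ‖∫ U, ψ U * F (rot U⁻¹ e) ∂(unitaryMeasure n)‖ ≤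
      ‖ψ‖ * ∫ ζ, ‖F ζ‖ ∂(surfaceMeasure n) := by
  have i1 : Integrable (fun U => ‖F (rot U⁻¹ e)‖) (unitaryMeasure n) := by
    have hc : Continuous fun U : UGroup n => ‖F (rot U⁻¹ e)‖ :=
      (hF.comp (continuous_rot_prod.comp (continuous_inv.prodMk continuous_const))).norm
    exact integrable_unitaryMeasure hc
  rw [← integral_orbit hn e hF.norm, ← integral_const_mul]
  refine norm_integral_le_of_norm_le (i1.const_mul _) (ae_of_all _ fun U => ?_)
  rw [norm_mul]
  exact mul_le_mul_of_nonneg_right (ψ.norm_coe_le_norm U) (norm_nonneg _)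

/-! ### Every function of `H²` is a Poisson–Szegő integral -/

lemma secondDeriv_sub {n : ℕ} {f g : Cn n → ℂ} {z : Cn n} (hf : ContDiffAt ℝ 2 f z)
    (hg : ContDiffAt ℝ 2 g z) (v w : Cn n) :
    secondDeriv (fun x => f x - g x) z v w = secondDeriv f z v w - secondDeriv g z v w := by
  have h1 : fderiv ℝ (fun x => f x - g x) =ᶠ[𝓝 z] fun x => fderiv ℝ f x - fderiv ℝ g x := by
    filter_upwards [hf.eventually (by simp), hg.eventually (by simp)] with x hx hx'
    exact fderiv_fun_sub (hx.differentiableAt (by simp)) (hx'.differentiableAt (by simp))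
  have h2 : DifferentiableAt ℝ (fderiv ℝ f) z :=
    (hf.fderiv_right (m := 1) (by norm_num)).differentiableAt (by simp)
  have h3 : DifferentiableAt ℝ (fderiv ℝ g) z :=
    (hg.fderiv_right (m := 1) (by norm_num)).differentiableAt (by simp)
  rw [secondDeriv, h1.fderiv_eq, fderiv_fun_sub h2 h3]
  rfl

lemma IsMHarmonic.sub {n : ℕ} {f g : Cn n → ℂ} (hf : IsMHarmonic f) (hg : IsMHarmonic g) :
    IsMHarmonic fun x => f x - g x := by
  refine isMHarmonic_of_sum_levi (hf.1.sub hg.1) fun z hz => ?_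
  refine ⟨EuclideanSpace.basisFun (Fin n) ℂ, ?_⟩
  have h : ∀ v, levi (fun x => f x - g x) z v = levi f z v - levi g z v := fun v => by
    simp only [levi, secondDeriv_sub (hf.contDiffAt hz) (hg.contDiffAt hz)]
    ring
  simp only [h]
  rw [Finset.sum_sub_distrib, hf.sum_levi hz, hg.sum_levi hz]

lemma eventually_mem_Ioo_of_lt {a : ℝ} (ha : a < 1) : ∀ᶠ r : ℝ in 𝓝[<] 1, r ∈ Set.Ioo a 1 :=
  Ioo_mem_nhdsLT ha

/-- Weak convergence of the dilates to zero is uniform over the translates of a continuous function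
on the unitary group, since these form a compact set. -/
lemma eventually_norm_orbit_integral_le {n : ℕ} (hn : 1 ≤ n) {f : Cn n → ℂ} (hf : MemHardy f)
    {𝒰 : Filter ℝ} (h𝒰 : 𝒰 ≤ 𝓝[<] 1)
    (hw : ∀ h : unitSphere n → ℂ, MemLp h 2 (surfaceMeasure n) →
      Tendsto (fun r : ℝ => ∫ ζ : unitSphere n, h ζ * f (r • (ζ : Cn n)) ∂(surfaceMeasure n))
        𝒰 (𝓝 0))
    (e : unitSphere n) (φ : C(UGroup n, ℂ)) {ε : ℝ} (hε : 0 < ε) :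
    ∀ᶠ r in 𝒰, ∀ V : UGroup n,
      ‖∫ U, φ (V * U) * f (r • (rot U⁻¹ e : Cn n)) ∂(unitaryMeasure n)‖ ≤ ε := by
  obtain ⟨hM, C, hC⟩ := hf
  -- the translates `φ (V ·)` depend continuously on `V` in the uniform norm
  let T : C(UGroup n, C(UGroup n, ℂ)) :=
    (ContinuousMap.mk (fun p : UGroup n × UGroup n => φ (p.1 * p.2)) (by fun_prop)).curry
  have hT : ∀ V U, T V U = φ (V * U) := fun _ _ => rfl
  let C' := |(surfaceMeasure n).real Set.univ + C| + 1
  have hC' : 0 < C' := by positivity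
  obtain ⟨t, -, htf, ht⟩ := (isCompact_range T.continuous).finite_cover_balls
    (show 0 < ε / (2 * C') by positivity)
  have hconv : ∀ ψ : C(UGroup n, ℂ), ∀ᶠ r in 𝒰,
      ‖∫ U, ψ U * f (r • (rot U⁻¹ e : Cn n)) ∂(unitaryMeasure n)‖ < ε / 2 := by
    intro ψ
    have hψ : MemLp (ψ : UGroup n → ℂ) 2 (unitaryMeasure n) :=
      ψ.continuous.memLp_of_hasCompactSupport (HasCompactSupport.of_compactSpace _)
    obtain ⟨h, hh, hd⟩ := exists_orbit_density hn e hψ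
    filter_upwards [(hw h hh).norm.eventually (gt_mem_nhds (show ‖(0 : ℂ)‖ < ε / 2 by simpa)),
      h𝒰 (eventually_mem_Ioo_of_lt zero_lt_one)] with r hr hr1
    rwa [hd _ (memLp_of_continuous (continuous_dilate hM.1.continuousOn hr1.1.le hr1.2))]
  have hall : ∀ᶠ r in 𝒰, ∀ ψ ∈ t,
      ‖∫ U, ψ U * f (r • (rot U⁻¹ e : Cn n)) ∂(unitaryMeasure n)‖ < ε / 2 :=
    (eventually_all_finite htf).2 fun ψ _ => hconv ψ
  filter_upwards [hall, h𝒰 (eventually_mem_Ioo_of_lt zero_lt_one)] with r hr hr1 V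
  obtain ⟨ψ, hψt, hψ⟩ := Set.mem_iUnion₂.1 (ht ⟨V, rfl⟩)
  have hF := continuous_dilate hM.1.continuousOn hr1.1.le hr1.2
  have hFo : Continuous fun U : UGroup n => f (r • (rot U⁻¹ e : Cn n)) :=
    hF.comp (continuous_rot_prod.comp (continuous_inv.prodMk continuous_const))
  have hint : ∀ χ : C(UGroup n, ℂ), Integrable
      (fun U => χ U * f (r • (rot U⁻¹ e : Cn n))) (unitaryMeasure n) := fun χ =>
    integrable_unitaryMeasure (χ.continuous.mul hFo)
  have h1 := norm_integral_orbit_le hn e hF (T V - ψ)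
  have h2 := integral_norm_le_of_sq hF (hC r ⟨hr1.1.le, hr1.2⟩)
  have h3 : ‖T V - ψ‖ < ε / (2 * C') := by rwa [← mem_ball_iff_norm]
  have h4 : ∫ U, (T V - ψ) U * f (r • (rot U⁻¹ e : Cn n)) ∂(unitaryMeasure n) =
      ∫ U, φ (V * U) * f (r • (rot U⁻¹ e : Cn n)) ∂(unitaryMeasure n) -
      ∫ U, ψ U * f (r • (rot U⁻¹ e : Cn n)) ∂(unitaryMeasure n) := by
    simp only [← hT]
    rw [← integral_sub (hint (T V)) (hint ψ)]
    simp only [ContinuousMap.sub_apply, sub_mul]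
  have h5 : ‖T V - ψ‖ * ∫ ζ : unitSphere n, ‖f (r • (ζ : Cn n))‖ ∂(surfaceMeasure n) ≤ ε / 2 := by
    calc _ ≤ ε / (2 * C') * C' := by
          gcongr
          exact h2.trans ((le_abs_self _).trans (by simp [C']))
      _ = ε / 2 := by field_simp
  rw [h4] at h1
  have h6 := norm_sub_norm_le
    (∫ U, φ (V * U) * f (r • (rot U⁻¹ e : Cn n)) ∂(unitaryMeasure n))
    (∫ U, ψ U * f (r • (rot U⁻¹ e : Cn n)) ∂(unitaryMeasure n))
  linarith [hr ψ hψt]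

/-- A Hardy function whose dilates tend weakly to zero vanishes. Its convolutions with continuous
functions on the unitary group tend to zero uniformly, hence vanish by the maximum principle. -/
lemma eq_zero_of_tendsto_weakly {n : ℕ} (hn : 1 ≤ n) {f : Cn n → ℂ} (hf : MemHardy f)
    {𝒰 : Filter ℝ} [𝒰.NeBot] (h𝒰 : 𝒰 ≤ 𝓝[<] 1)
    (hw : ∀ h : unitSphere n → ℂ, MemLp h 2 (surfaceMeasure n) →
      Tendsto (fun r : ℝ => ∫ ζ : unitSphere n, h ζ * f (r • (ζ : Cn n)) ∂(surfaceMeasure n))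
        𝒰 (𝓝 0))
    {z : Cn n} (hz : z ∈ unitBall n) : f z = 0 := by
  have hcont := continuous_orbit hf.1.1.continuousOn hz
  let e : unitSphere n := ⟨coordVec ⟨0, hn⟩ 1, by simp⟩
  -- with this weight, the average at `z` is the square of an `L²` norm
  let φ : C(UGroup n, ℂ) := ⟨fun U => (starRingEnd ℂ) (f ((U⁻¹).1 z)),
    Complex.continuous_conj.comp hcont⟩
  have hzero : unitaryAverage φ f z = 0 := by
    refine norm_le_zero_iff.1 (le_of_forall_pos_le_add fun ε hε => ?_)
    rw [zero_add]
    obtain ⟨r, hr, hr0, hrz⟩ := ((eventually_norm_orbit_integral_le hn hf h𝒰 hw e φ hε).and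
      ((Eventually.filter_mono h𝒰 (eventually_mem_Ioo_of_lt zero_lt_one)).and
        (Eventually.filter_mono h𝒰 (eventually_mem_Ioo_of_lt (mem_unitBall.1 hz))))).exists
    refine (isMHarmonic_unitaryAverage φ.continuous hf.1).norm_le_of_sphere ⟨0, hn⟩ hr0.2
      (fun x hx => ?_) hrz.1.le
    have hx1 : ‖r⁻¹ • x‖ = 1 := by
      rw [norm_smul, hx, Real.norm_of_nonneg (inv_nonneg.2 hr0.1.le), inv_mul_cancel₀ hr0.1.ne']
    obtain ⟨V, hV⟩ := exists_rot_eq hn e ⟨r⁻¹ • x, by simpa using hx1⟩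
    have hxV : x = r • (rot V e : Cn n) := by
      rw [hV, smul_smul, mul_inv_cancel₀ hr0.1.ne', one_smul]
    rw [hxV, unitaryAverage_rot]
    exact hr V
  have hsq : ∀ U : UGroup n, φ U * f ((U⁻¹).1 z) = ((‖f ((U⁻¹).1 z)‖ ^ 2 : ℝ) : ℂ) := fun U => by
    change (starRingEnd ℂ) (f ((U⁻¹).1 z)) * f ((U⁻¹).1 z) = _
    rw [mul_comm, Complex.mul_conj']
    push_cast
    rfl
  simp only [unitaryAverage, hsq] at hzero
  rw [integral_complex_ofReal, Complex.ofReal_eq_zero] at hzero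
  have hc2 : Continuous fun U : UGroup n => ‖f ((U⁻¹).1 z)‖ ^ 2 := hcont.norm.pow 2
  have h0 := (integral_eq_zero_iff_of_nonneg (fun U => sq_nonneg _)
    (integrable_unitaryMeasure hc2)).1 hzero
  have := isOpenPosMeasure_unitaryMeasure hn
  -- evaluate at the identity of the group
  have h1 := congrFun ((hc2.ae_eq_iff_eq (unitaryMeasure n) continuous_const).1 h0) 1
  change ‖f (((1 : UGroup n)⁻¹).1 z)‖ ^ 2 = 0 at h1
  rw [inv_one] at h1
  exact norm_eq_zero.1 (pow_eq_zero_iff two_ne_zero |>.1 h1)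

lemma isBoundaryValue_congr {n : ℕ} {f f' : Cn n → ℂ} {g : unitSphere n → ℂ}
    (h : ∀ z ∈ unitBall n, f z = f' z) (hf : IsBoundaryValue f g) : IsBoundaryValue f' g := by
  refine ⟨hf.1, hf.2.congr' ?_⟩
  filter_upwards [eventually_mem_Ioo_of_lt zero_lt_one] with r hr
  congr 1
  ext ζ
  rw [h _ (smul_mem_unitBall hr.1.le hr.2 ζ)]

/-- Strong convergence to the boundary value implies weak convergence. -/
lemma IsBoundaryValue.tendsto_integral {n : ℕ} {f : Cn n → ℂ} {g h : unitSphere n → ℂ}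
    (hfg : IsBoundaryValue f g) (hf : ContinuousOn f (unitBall n))
    (hh : MemLp h 2 (surfaceMeasure n)) :
    Tendsto (fun r : ℝ => ∫ ζ : unitSphere n, h ζ * f (r • (ζ : Cn n)) ∂(surfaceMeasure n))
      (𝓝[<] 1) (𝓝 (∫ ζ, h ζ * g ζ ∂(surfaceMeasure n))) := by
  rw [tendsto_iff_norm_sub_tendsto_zero]
  have h1 : Tendsto (fun r : ℝ => ‖(memLp_conj hh).toLp _‖ * (eLpNorm
      (fun ζ : unitSphere n => f (r • (ζ : Cn n)) - g ζ) 2 (surfaceMeasure n)).toReal)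
      (𝓝[<] 1) (𝓝 0) := by
    have := ((ENNReal.tendsto_toReal ENNReal.zero_ne_top).comp hfg.2).const_mul
      ‖(memLp_conj hh).toLp _‖
    simpa using this
  refine squeeze_zero' (Eventually.of_forall fun r => norm_nonneg _) ?_ h1
  filter_upwards [eventually_mem_Ioo_of_lt zero_lt_one] with r hr
  have hm := memLp_of_continuous (continuous_dilate hf hr.1.le hr.2)
  have hd := hm.sub hfg.1
  have e1 : ∫ ζ : unitSphere n, h ζ * f (r • (ζ : Cn n)) ∂(surfaceMeasure n) -
      ∫ ζ, h ζ * g ζ ∂(surfaceMeasure n) = inner ℂ ((memLp_conj hh).toLp _) (hd.toLp _) := by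
    have i1 : Integrable (fun ζ : unitSphere n => h ζ * f (r • (ζ : Cn n))) (surfaceMeasure n) :=
      hh.integrable_mul hm
    have i2 : Integrable (fun ζ : unitSphere n => h ζ * g ζ) (surfaceMeasure n) :=
      hh.integrable_mul hfg.1
    rw [inner_toLp, ← integral_sub i1 i2]
    simp [mul_sub]
  rw [e1]
  refine (norm_inner_le_norm _ _).trans_eq ?_
  rw [Lp.norm_toLp (μ := surfaceMeasure n) _ hd]
  rfl

/-- Every function of `H²` is the Poisson–Szegő integral of a square-integrable function, namely of a
weak limit of its dilates: the difference is a Hardy function whose dilates tend weakly to zero. -/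
theorem MemHardy.exists_eq_poissonInt {n : ℕ} (hn : 1 ≤ n) {f : Cn n → ℂ} (hf : MemHardy f) :
    ∃ g : unitSphere n → ℂ, MemLp g 2 (surfaceMeasure n) ∧
      ∀ z ∈ unitBall n, f z = poissonInt g z := by
  obtain ⟨C, hC⟩ := hf.2
  let 𝒰 : Ultrafilter ℝ := Ultrafilter.of (𝓝[<] 1)
  have h𝒰 : (𝒰 : Filter ℝ) ≤ 𝓝[<] 1 := Ultrafilter.of_le _
  have hmem : ∀ {u : Cn n → ℂ}, IsMHarmonic u → ∀ {r : ℝ}, r ∈ Set.Ico (0 : ℝ) 1 →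
      MemLp (fun ζ : unitSphere n => u (r • (ζ : Cn n))) 2 (surfaceMeasure n) := fun hu r hr =>
    memLp_of_continuous (continuous_dilate hu.1.continuousOn hr.1 hr.2)
  obtain ⟨g, hg, hgw⟩ := exists_weak_boundary_value (f := f) (𝒰 := 𝒰) (C := C)
    (by
      filter_upwards [h𝒰 (eventually_mem_Ioo_of_lt zero_lt_one)] with r hr
      exact hmem hf.1 ⟨hr.1.le, hr.2⟩)
    (by
      filter_upwards [h𝒰 (eventually_mem_Ioo_of_lt zero_lt_one)] with r hr
      exact hC r ⟨hr.1.le, hr.2⟩)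
  have hu := memHardy_poissonInt hn hg
  obtain ⟨C', hC'⟩ := hu.2
  have hD : MemHardy fun z => f z - poissonInt g z := by
    refine ⟨hf.1.sub hu.1, 2 * C + 2 * C', fun r hr => ?_⟩
    have i1 := (memLp_two_iff_integrable_sq_norm (hmem hf.1 hr).1).1 (hmem hf.1 hr)
    have i2 := (memLp_two_iff_integrable_sq_norm (hmem hu.1 hr).1).1 (hmem hu.1 hr)
    have i3 := (memLp_two_iff_integrable_sq_norm (hmem (hf.1.sub hu.1) hr).1).1
      (hmem (hf.1.sub hu.1) hr)
    calc _ ≤ ∫ ζ : unitSphere n, (2 * ‖f (r • (ζ : Cn n))‖ ^ 2 +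
          2 * ‖poissonInt g (r • (ζ : Cn n))‖ ^ 2) ∂(surfaceMeasure n) := by
          refine integral_mono i3 ((i1.const_mul 2).add (i2.const_mul 2)) fun ζ => ?_
          change ‖f (r • (ζ : Cn n)) - poissonInt g (r • (ζ : Cn n))‖ ^ 2 ≤
            2 * ‖f (r • (ζ : Cn n))‖ ^ 2 + 2 * ‖poissonInt g (r • (ζ : Cn n))‖ ^ 2
          have := norm_sub_le (f (r • (ζ : Cn n))) (poissonInt g (r • (ζ : Cn n)))
          nlinarith [norm_nonneg (f (r • (ζ : Cn n)) - poissonInt g (r • (ζ : Cn n))),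
            sq_nonneg (‖f (r • (ζ : Cn n))‖ - ‖poissonInt g (r • (ζ : Cn n))‖)]
      _ ≤ _ := by
          rw [integral_add (i1.const_mul 2) (i2.const_mul 2), integral_const_mul,
            integral_const_mul]
          linarith [hC r hr, hC' r hr]
  refine ⟨g, hg, fun z hz => sub_eq_zero.1 (eq_zero_of_tendsto_weakly hn hD h𝒰
    (fun h hh => ?_) hz)⟩
  have h1 := (hgw h hh).sub (((isBoundaryValue_poissonInt hn hg).tendsto_integral
    hu.1.1.continuousOn hh).mono_left h𝒰)
  rw [sub_self] at h1
  refine h1.congr' ?_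
  filter_upwards [h𝒰 (eventually_mem_Ioo_of_lt zero_lt_one)] with r hr
  have hr' : r ∈ Set.Ico (0 : ℝ) 1 := ⟨hr.1.le, hr.2⟩
  have i1 : Integrable (fun ζ : unitSphere n => h ζ * f (r • (ζ : Cn n))) (surfaceMeasure n) :=
    hh.integrable_mul (hmem hf.1 hr')
  have i2 : Integrable (fun ζ : unitSphere n => h ζ * poissonInt g (r • (ζ : Cn n)))
      (surfaceMeasure n) := hh.integrable_mul (hmem hu.1 hr')
  rw [← integral_sub i1 i2]
  simp only [mul_sub]

/-! ### Existence and uniqueness of the Szegő kernel -/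

/-- Two boundary values of a function define the same functional on `L²`. -/
lemma IsBoundaryValue.integral_mul_eq {n : ℕ} {f : Cn n → ℂ} {g g' h : unitSphere n → ℂ}
    (hf : ContinuousOn f (unitBall n)) (hg : IsBoundaryValue f g) (hg' : IsBoundaryValue f g')
    (hh : MemLp h 2 (surfaceMeasure n)) :
    ∫ ζ, h ζ * g ζ ∂(surfaceMeasure n) = ∫ ζ, h ζ * g' ζ ∂(surfaceMeasure n) :=
  tendsto_nhds_unique (hg.tendsto_integral hf hh) (hg'.tendsto_integral hf hh)

lemma memLp_poisson {n : ℕ} {z : Cn n} (hz : z ∈ unitBall n) :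
    MemLp (fun ζ : unitSphere n => poisson z ζ) 2 (surfaceMeasure n) :=
  memLp_of_continuous (continuous_poisson hz)

lemma memHardy_szego {n : ℕ} (hn : 1 ≤ n) {z : Cn n} (hz : z ∈ unitBall n) :
    MemHardy (szego z) :=
  memHardy_poissonInt hn (memLp_poisson hz)

lemma isBoundaryValue_szego {n : ℕ} (hn : 1 ≤ n) {z : Cn n} (hz : z ∈ unitBall n) :
    IsBoundaryValue (szego z) fun ζ => poisson z ζ :=
  isBoundaryValue_poissonInt hn (memLp_poisson hz)

/-- The reproducing property is the Poisson–Szegő representation of functions of `H²`. -/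
theorem isSzegoKernel_szego {n : ℕ} (hn : 1 ≤ n) : IsSzegoKernel n szego where
  mharmonic_left w hw := by
    simp only [szego_comm _ w]
    exact (memHardy_szego hn hw).1
  mharmonic_right z hz := (memHardy_szego hn hz).1
  memHardy z hz := memHardy_szego hn hz
  reproducing f hf := by
    obtain ⟨g, hg, hfg⟩ := hf.exists_eq_poissonInt hn
    exact ⟨g, isBoundaryValue_congr (fun z hz => (hfg z hz).symm) (isBoundaryValue_poissonInt hn hg),
      fun z hz => ⟨_, isBoundaryValue_szego hn hz, hfg z hz⟩⟩

/-- Pairing the boundary values of `K(z, ·)` and of `szego w` gives `K(z, w)`, as `K(z, ·)` is the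
Poisson–Szegő integral of its boundary value, and `szego w z`, by the reproducing property of `K`. -/
theorem IsSzegoKernel.eq_szego {n : ℕ} (hn : 1 ≤ n) {K : Cn n → Cn n → ℂ}
    (hK : IsSzegoKernel n K) {z w : Cn n} (hz : z ∈ unitBall n) (hw : w ∈ unitBall n) :
    K z w = szego z w := by
  obtain ⟨k', hk', hKk⟩ := (hK.memHardy z hz).exists_eq_poissonInt hn
  have hbv : IsBoundaryValue (K z) k' :=
    isBoundaryValue_congr (fun x hx => (hKk x hx).symm) (isBoundaryValue_poissonInt hn hk')
  obtain ⟨g, hg, hrep⟩ := hK.reproducing (szego w) (memHardy_szego hn hw)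
  obtain ⟨k, hk, hkz⟩ := hrep z hz
  calc K z w = ∫ ζ, k' ζ * poisson w ζ ∂(surfaceMeasure n) := hKk w hw
    _ = ∫ ζ, k' ζ * g ζ ∂(surfaceMeasure n) :=
        (isBoundaryValue_szego hn hw).integral_mul_eq (memHardy_szego hn hw).1.1.continuousOn hg hk'
    _ = ∫ ζ, g ζ * k' ζ ∂(surfaceMeasure n) := by simp only [mul_comm]
    _ = ∫ ζ, g ζ * k ζ ∂(surfaceMeasure n) :=
        hbv.integral_mul_eq (hK.memHardy z hz).1.1.continuousOn hk hg.1
    _ = szego z w := by rw [← hkz, szego_comm]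

end MHarm

end

theorem corollary3p3 (n : ℕ) (hn : 1 ≤ n) :
    (∃ K : MHarm.Cn n → MHarm.Cn n → ℂ, MHarm.IsSzegoKernel n K) ∧
    ∀ K : MHarm.Cn n → MHarm.Cn n → ℂ, MHarm.IsSzegoKernel n K →
      ∀ z ∈ MHarm.unitBall n, ∀ w ∈ MHarm.unitBall n,
        Summable (MHarm.FD1term n n n n n
          ((‖z‖ : ℂ) ^ 2) (MHarm.herm z w) (MHarm.herm w z) ((‖w‖ : ℂ) ^ 2)) ∧
        K z w =
          Complex.Gamma n / (2 * (Real.pi : ℂ) ^ n) *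
            (1 - (‖z‖ : ℂ) ^ 2) ^ n * (1 - (‖w‖ : ℂ) ^ 2) ^ n *
            MHarm.FD1 n n n n n
              ((‖z‖ : ℂ) ^ 2) (MHarm.herm z w) (MHarm.herm w z) ((‖w‖ : ℂ) ^ 2) :=
  ⟨⟨_, MHarm.isSzegoKernel_szego hn⟩, fun _ hK _ hz _ hw =>
    ⟨MHarm.summable_FD1term hn hz hw, (hK.eq_szego hn hz hw).trans (MHarm.szego_eq hn hz hw)⟩⟩
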